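/- For $n\in\mathbb N$ let $\Lambda_n=\{-\lfloor n/2\rfloor,\dots,\lfloor n/2\rfloor\}^2\subset\mathbb Z^2$, with nearest-neighbour adjacency $x\sim y$, and let $\partial\Lambda_n$ be its outer vertex boundary. For $\beta>0$ and $\lambda\in\mathbb R$, the solid-on-solid (SOS) model on $\Lambda_n$ above a hard floor, with zero boundary condition and pinning parameter $\lambda$, is the probability measure on height functions $\phi:\Lambda_n\to\mathbb Z_{\ge 0}$ given by $$\mathbb P(\phi)\propto\exp\Big(-\beta\sum_{x\sim y}|\phi_x-\phi_y|+\lambda\sum_{x\in\Lambda_n}\mathbf 1_{\{\phi_x=0\}}\Big),$$ where the first sum is over unordered pairs of adjacent sites of $\Lambda_n\cup\partial\Lambda_n$ and $\phi$ is set to $0$ on $\partial\Lambda_n$. Let $\lambda_w=-\log(1-e^{-4\beta})$ and $h_n^*=\lfloor\frac{1}{6\beta}\log n+\frac13\rfloor$. **Theorem 1.** There exists an absolute constant $C>0$ such that for all $\beta$ large enough and $\lambda=\lambda_w$, with probability tending to $1$ as $n\to\infty$ (with $\beta$ fixed), $$\big|\{x\in\Lambda_n:\ \phi_x\notin\{h_n^*-1,\,h_n^*\}\}\big|\le\frac{C}{\beta}\,n^2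 .$$ -/

import Mathlib

open MeasureTheory Filter Topology
open scoped ENNReal

namespace SOS

/-- The nearest-neighbour graph on `ℤ²`: `x ∼ y` when their `ℓ¹` distance is `1`. -/
def lattice : SimpleGraph (ℤ × ℤ) where
  Adj x y := |x.1 - y.1| + |x.2 - y.2| = 1
  symm := ⟨fun x y h => by rw [abs_sub_comm y.1, abs_sub_comm y.2]; exact h⟩
  loopless := ⟨fun x h => by simp at h⟩

instance : DecidableRel lattice.Adj := fun x y =>
  inferInstanceAs (Decidable (|x.1 - y.1| + |x.2 - y.2| = 1))

/-- The box `Λ_n = {-⌊n/2⌋, …, ⌊n/2⌋}²`. -/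
noncomputable def box (n : ℕ) : Finset (ℤ × ℤ) :=
  Finset.Icc (-((n / 2 : ℕ) : ℤ)) ((n / 2 : ℕ) : ℤ) ×ˢ
    Finset.Icc (-((n / 2 : ℕ) : ℤ)) ((n / 2 : ℕ) : ℤ)

/-- The sites of `ℤ²` adjacent to `x`. -/
def neighbors (x : ℤ × ℤ) : Finset (ℤ × ℤ) :=
  {(x.1 + 1, x.2), (x.1 - 1, x.2), (x.1, x.2 + 1), (x.1, x.2 - 1)}

theorem mem_neighbors {x y : ℤ × ℤ} : y ∈ neighbors x ↔ lattice.Adj x y := by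
  simp only [neighbors, Finset.mem_insert, Finset.mem_singleton, lattice, Prod.ext_iff]
  grind

/-- The outer vertex boundary `∂Λ_n`: the sites outside `Λ_n` with a neighbour in `Λ_n`. -/
noncomputable def outerBoundary (n : ℕ) : Finset (ℤ × ℤ) :=
  (box n).biUnion neighbors \ box n

/-- The edges of `ℤ²` with both endpoints in `Λ_n ∪ ∂Λ_n`, as unordered pairs. -/
noncomputable def edges (n : ℕ) : Finset (Sym2 (ℤ × ℤ)) :=
  ((box n ∪ outerBoundary n).sym2).filter (fun e => e ∈ lattice.edgeSet)

/-- Nonnegative integer height functions on `Λ_n`. -/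
abbrev Config (n : ℕ) : Type := box n → ℕ

/-- A height function extended by the boundary condition `0` outside `Λ_n`. -/
noncomputable def extend {n : ℕ} (φ : Config n) (x : ℤ × ℤ) : ℤ :=
  if h : x ∈ box n then (φ ⟨x, h⟩ : ℤ) else 0

/-- `|φ_x - φ_y|` for an unordered pair `{x, y}`. -/
noncomputable def gradient {n : ℕ} (φ : Config n) : Sym2 (ℤ × ℤ) → ℤ :=
  Sym2.lift ⟨fun x y => |extend φ x - extend φ y|, fun _ _ => abs_sub_comm _ _⟩

/-- The total gradient `∑_{x ∼ y} |φ_x - φ_y|` over `Λ_n ∪ ∂Λ_n`. -/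
noncomputable def energy {n : ℕ} (φ : Config n) : ℤ :=
  ∑ e ∈ edges n, gradient φ e

/-- The number of sites of `Λ_n` at height zero. -/
noncomputable def zeros {n : ℕ} (φ : Config n) : ℕ :=
  (Finset.univ.filter (fun x => φ x = 0)).card

/-- The Gibbs weight `exp(-β ∑_{x ∼ y} |φ_x - φ_y| + lam ∑_x 1_{φ_x = 0})`. -/
noncomputable def weight (β lam : ℝ) {n : ℕ} (φ : Config n) : ℝ :=
  Real.exp (-β * (energy φ : ℝ) + lam * (zeros φ : ℝ))

/-- The partition function, in `[0, ∞]`. -/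
noncomputable def partitionFunction (β lam : ℝ) (n : ℕ) : ℝ≥0∞ :=
  ∑' φ : Config n, ENNReal.ofReal (weight β lam φ)

/-- The solid-on-solid measure on `Λ_n` above a hard floor, with zero boundary condition, inverse
temperature `β` and pinning parameter `lam`: each `φ` has mass `weight β lam φ` divided by the
partition function. -/
noncomputable def measure (β lam : ℝ) (n : ℕ) : Measure (Config n) :=
  Measure.sum fun φ : Config n =>
    (ENNReal.ofReal (weight β lam φ) / partitionFunction β lam n) • Measure.dirac φ

/-- The critical wetting point `λ_w = -log (1 - e^{-4β})`. -/
noncomputable def criticalPinning (β : ℝ) : ℝ :=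
  -Real.log (1 - Real.exp (-4 * β))

/-- The height `h_n^* = ⌊(1/(6β)) log n + 1/3⌋`. -/
noncomputable def typicalHeight (β : ℝ) (n : ℕ) : ℤ :=
  ⌊1 / (6 * β) * Real.log n + 1 / 3⌋

/-- The number of sites of `Λ_n` whose height is neither `h_n^* - 1` nor `h_n^*`. -/
noncomputable def atypicalCount (β : ℝ) {n : ℕ} (φ : Config n) : ℕ :=
  (Finset.univ.filter (fun x => (φ x : ℤ) ≠ typicalHeight β n - 1 ∧
    (φ x : ℤ) ≠ typicalHeight β n)).card

theorem gradient_le_energy {n : ℕ} (φ : Config n) {x y : ℤ × ℤ} (hx : x ∈ box n)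
    (h : lattice.Adj x y) : |extend φ x - extend φ y| ≤ energy φ := by
  have hy : y ∈ box n ∪ outerBoundary n := by
    by_cases hy : y ∈ box n
    · exact Finset.mem_union_left _ hy
    · exact Finset.mem_union_right _ (Finset.mem_sdiff.2
        ⟨Finset.mem_biUnion.2 ⟨x, hx, mem_neighbors.2 h⟩, hy⟩)
  have he : s(x, y) ∈ edges n := by
    refine Finset.mem_filter.2 ⟨Finset.mk_mem_sym2_iff.2 ⟨Finset.mem_union_left _ hx, hy⟩, ?_⟩
    simpa using h
  refine Finset.single_le_sum (f := gradient φ) (fun e _ => ?_) he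
  induction e with
  | _ a b => exact abs_nonneg _

theorem energy_nonneg {n : ℕ} (φ : Config n) : 0 ≤ energy φ := by
  refine Finset.sum_nonneg fun e _ => ?_
  induction e with
  | _ a b => exact abs_nonneg _

theorem extend_le {n : ℕ} (φ : Config n) (j : ℕ) (x : ℤ × ℤ)
    (hx : ((n / 2 : ℕ) : ℤ) < x.1 + j) : extend φ x ≤ j * energy φ := by
  induction j generalizing x with
  | zero =>
    have : x ∉ box n := by
      simp only [box, Finset.mem_product, Finset.mem_Icc]; push_cast at hx; omega
    simp [extend, this]
  | succ j ih =>
    by_cases h : x ∈ box n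
    · have h1 := gradient_le_energy φ (y := (x.1 + 1, x.2)) h (by simp [lattice])
      have h2 := ih (x.1 + 1, x.2) (by push_cast at hx ⊢; linarith)
      have h3 := (abs_le.1 h1).2
      push_cast
      linarith
    · have := energy_nonneg φ
      simp only [extend, h, dite_false]
      positivity

theorem summable_prod_exp {ι : Type*} [Fintype ι] [DecidableEq ι] {c : ℝ} (hc : 0 < c) :
    Summable fun φ : ι → ℕ => ∏ i, Real.exp (-c * φ i) := by
  have hs : Summable fun k : ℕ => Real.exp (-c * k) := by
    simpa [mul_comm] using Real.summable_exp_nat_mul_iff.2 (neg_lt_zero.2 hc)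
  refine summable_of_sum_le (c := ∏ _i : ι, ∑' k : ℕ, Real.exp (-c * k))
    (fun φ => Finset.prod_nonneg fun i _ => (Real.exp_pos _).le) fun s => ?_
  let t : ι → Finset ℕ := fun i => s.image (fun φ => φ i)
  calc ∑ φ ∈ s, ∏ i, Real.exp (-c * φ i)
      ≤ ∑ φ ∈ Fintype.piFinset t, ∏ i, Real.exp (-c * φ i) := by
        refine Finset.sum_le_sum_of_subset_of_nonneg (fun φ hφ => ?_) fun φ _ _ =>
          Finset.prod_nonneg fun i _ => (Real.exp_pos _).le
        exact Fintype.mem_piFinset.2 fun i => Finset.mem_image_of_mem (fun φ => φ i) hφ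
    _ = ∏ i, ∑ k ∈ t i, Real.exp (-c * k) :=
        (Finset.prod_univ_sum t fun _ (k : ℕ) => Real.exp (-c * k)).symm
    _ ≤ _ := Finset.prod_le_prod
        (fun i _ => Finset.sum_nonneg fun k _ => (Real.exp_pos _).le)
        fun i _ => hs.sum_le_tsum _ fun k _ => (Real.exp_pos _).le

theorem summable_weight {β : ℝ} (hβ : 0 < β) (lam : ℝ) (n : ℕ) :
    Summable fun φ : Config n => weight β lam φ := by
  set N : ℕ := 2 * (n / 2) + 1 with hN
  set K : ℝ := ((box n).card + 1) * N with hK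
  have hKpos : 0 < K := by positivity
  refine Summable.of_nonneg_of_le (fun φ => (Real.exp_pos _).le) (fun φ => ?_)
    ((summable_prod_exp (ι := box n) (div_pos hβ hKpos)).mul_left
      (Real.exp (|lam| * (box n).card)))
  rw [← Real.exp_sum, ← Real.exp_add]
  refine Real.exp_le_exp.2 ?_
  have h0 : (0 : ℝ) ≤ energy φ := by exact_mod_cast energy_nonneg φ
  have hle : ∀ x : box n, (φ x : ℝ) ≤ N * energy φ := by
    intro x
    have h := extend_le φ N x.1 (by
      have := x.2
      simp only [box, Finset.mem_product, Finset.mem_Icc] at this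
      rw [hN]; push_cast at *; omega)
    simp only [extend, x.2, dite_true] at h
    exact_mod_cast h
  have hsum : ∑ x, (φ x : ℝ) ≤ K * energy φ := by
    calc ∑ x, (φ x : ℝ) ≤ ∑ _x : box n, (N * energy φ : ℝ) := Finset.sum_le_sum fun x _ => hle x
      _ = (box n).card * (N * energy φ) := by simp
      _ ≤ K * energy φ := by
        rw [hK]
        have : (0 : ℝ) ≤ N * energy φ := by positivity
        nlinarith
  have hz : lam * (zeros φ : ℝ) ≤ |lam| * (box n).card := by
    have h1 : (zeros φ : ℝ) ≤ (box n).card := by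
      have := Finset.card_le_univ (Finset.univ.filter (fun x => φ x = 0))
      rw [Fintype.card_coe] at this
      exact_mod_cast this
    exact (mul_le_mul_of_nonneg_right (le_abs_self lam) (by positivity)).trans
      (mul_le_mul_of_nonneg_left h1 (abs_nonneg _))
  have hmain : β / K * ∑ x, (φ x : ℝ) ≤ β * energy φ := by
    calc β / K * ∑ x, (φ x : ℝ) ≤ β / K * (K * energy φ) :=
          mul_le_mul_of_nonneg_left hsum (by positivity)
      _ = β * energy φ := by field_simp
  rw [← Finset.mul_sum]
  linarith

/-- For `β > 0` the Gibbs weights are summable, so the model is a probability measure. -/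
theorem isProbabilityMeasure_measure {β : ℝ} (hβ : 0 < β) (lam : ℝ) (n : ℕ) :
    IsProbabilityMeasure (measure β lam n) := by
  have hZ : partitionFunction β lam n ≠ ∞ := (summable_weight hβ lam n).tsum_ofReal_ne_top
  have hZ0 : partitionFunction β lam n ≠ 0 := by
    intro h
    have := ENNReal.tsum_eq_zero.1 h (fun _ => 0)
    rw [ENNReal.ofReal_eq_zero] at this
    exact absurd this (not_le.2 (Real.exp_pos _))
  refine ⟨?_⟩
  simp only [measure, Measure.sum_apply _ MeasurableSet.univ, Measure.smul_apply,
    measure_univ, smul_eq_mul, mul_one, div_eq_mul_inv]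
  rw [ENNReal.tsum_mul_right]
  exact ENNReal.mul_inv_cancel hZ0 hZ

end SOS

/-! At `λ_w` the pinning reward is a geometric series: `e^{λ_w} = ∑_{m ≥ 0} e^{-4βm}`. A zero of `φ`
may therefore be read as a site at some height `-m ≤ 0`, and the law of `φ` is the image under the
positive part of a `ℤ`-valued field with energy `∑ |ψ_x - ψ_y| + 2 min(ψ_x⁻, ψ_y⁻)`
(`measure_eq_div`). Floor and pinning have become a penalty on pairs of adjacent negative sites
only. The cheapest penalised object is a domino, whose perimeter is `6`; this is the source of the
`6β` in `h_n^*`.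

Few sites lie below `h = h_n^* - 1`. Raising the whole field by one costs at most `4β` times the
side length and gains `2β` per negative domino, so `3n` such dominoes are exponentially unlikely
(`tsum_wetWeight_dominoes_ge`). On the other hand, if order `n²/β` sites are below `h`, nearly all
of them start a flat domino that can be pushed down to height `-1` at energy cost at most `6h + 2`.
As `e^{-β(6h+2)} ≥ e^{2β}/n`, entropy beats cost, and each number `d < 4n` of negative dominoes is
at most half as likely as `d + 1` (`lowFields_step`). Hence having fewer than `3n` of them is also
unlikely.

Few sites lie above `c = h_n^*`. By monotonicity the boundary value may be raised to `c`
(`wetWeight_mono_boundary`). From height `c` a given domino is negative with probability of order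
`e^{-6β(c+1)} ≤ e^{-2β}/n`, so by Jensen the penalty lowers the partition function by a factor no
worse than `e^{-O(n)}` (`freePartition_le_wetPartition`). It remains to beat `e^{O(n)}` in the model
without floor: a Peierls argument that survives a tilt of `β / side n` per high site shows that `300
n²/β` sites above `c` have probability at most `e^{-cn}` with a larger `c`
(`tsum_freeWeight_highCount_ge_le`). -/

namespace SOS

/-! ### Sums over a finite product -/

theorem tsum_pi_prod {ι α : Type*} [Fintype ι] (g : ι → α → ℝ≥0∞) :
    ∑' f : ι → α, ∏ i, g i (f i) = ∏ i, ∑' k, g i k := by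
  classical
  revert g
  refine Fintype.induction_empty_option (P := fun ι _ => ∀ g : ι → α → ℝ≥0∞,
    ∑' f : ι → α, ∏ i, g i (f i) = ∏ i, ∑' k, g i k) ?_ ?_ ?_ ι
  · intro ι κ _ e ih g
    let _ : Fintype ι := Fintype.ofEquiv κ e.symm
    rw [← (Equiv.arrowCongr e (Equiv.refl α)).tsum_eq, ← e.prod_comp]
    rw [← ih fun i => g (e i)]
    refine tsum_congr fun f => ?_
    rw [← e.prod_comp]
    simp
  · intro g
    simp
  · intro ι _ ih g
    rw [Fintype.prod_option, ← ih, ← ENNReal.tsum_mul_right,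
      ← (Equiv.piOptionEquivProd (β := fun _ => α)).symm.tsum_eq, ENNReal.tsum_prod']
    refine tsum_congr fun a => ?_
    rw [← ENNReal.tsum_mul_left]
    refine tsum_congr fun f => ?_
    rw [Fintype.prod_option]
    rfl

/-- The common form of the map arguments that follow: the raising map, the lowering of a flat domino
and the lowering of an isolated high domino. -/
theorem tsum_indicator_le_of_injOn {α β : Type*} {A : Set α} {T : α → β} (hT : Set.InjOn T A)
    {f : α → ℝ≥0∞} {g : β → ℝ≥0∞} (h : ∀ a ∈ A, f a ≤ g (T a)) :
    ∑' a, A.indicator f a ≤ ∑' b, g b := by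
  rw [← tsum_subtype]
  calc ∑' a : A, f a ≤ ∑' a : A, g (T a) := ENNReal.tsum_le_tsum fun a => h a a.2
    _ ≤ _ := ENNReal.tsum_comp_le_tsum_of_injective
      (f := fun a : A => T a) (fun a b hab => Subtype.ext (hT a.2 b.2 hab)) g

/-! ### Oriented edges -/

/-- An oriented edge of `ℤ²`: a tail and a direction (`false` is horizontal). -/
abbrev Edge : Type := (ℤ × ℤ) × Bool

/-- The endpoint of an oriented edge that is not its tail. -/
def head (e : Edge) : ℤ × ℤ := if e.2 then (e.1.1, e.1.2 + 1) else (e.1.1 + 1, e.1.2)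

@[simp] theorem head_true (p : ℤ × ℤ) : head (p, true) = (p.1, p.2 + 1) := rfl

@[simp] theorem head_false (p : ℤ × ℤ) : head (p, false) = (p.1 + 1, p.2) := rfl

theorem mem_box {n : ℕ} {p : ℤ × ℤ} :
    p ∈ box n ↔ (-((n / 2 : ℕ) : ℤ) ≤ p.1 ∧ p.1 ≤ ((n / 2 : ℕ) : ℤ)) ∧
      -((n / 2 : ℕ) : ℤ) ≤ p.2 ∧ p.2 ≤ ((n / 2 : ℕ) : ℤ) := by
  simp [box]

/-- The tails of the edges touching the box. -/
noncomputable def tails (n : ℕ) : Finset (ℤ × ℤ) :=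
  Finset.Icc (-((n / 2 : ℕ) : ℤ) - 1) ((n / 2 : ℕ) : ℤ) ×ˢ
    Finset.Icc (-((n / 2 : ℕ) : ℤ) - 1) ((n / 2 : ℕ) : ℤ)

/-- A finite set of edges containing all edges touching the box. -/
noncomputable def boxEdges (n : ℕ) : Finset Edge := tails n ×ˢ Finset.univ

theorem mem_boxEdges {n : ℕ} {e : Edge} :
    e ∈ boxEdges n ↔ (-((n / 2 : ℕ) : ℤ) - 1 ≤ e.1.1 ∧ e.1.1 ≤ ((n / 2 : ℕ) : ℤ)) ∧
      -((n / 2 : ℕ) : ℤ) - 1 ≤ e.1.2 ∧ e.1.2 ≤ ((n / 2 : ℕ) : ℤ) := by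
  simp [boxEdges, tails]

theorem mem_boxEdges_of_tail {n : ℕ} {e : Edge} (h : e.1 ∈ box n) : e ∈ boxEdges n := by
  rw [mem_box] at h; rw [mem_boxEdges]; omega

theorem mem_boxEdges_of_head {n : ℕ} {e : Edge} (h : head e ∈ box n) : e ∈ boxEdges n := by
  obtain ⟨p, b⟩ := e
  rw [mem_box] at h; rw [mem_boxEdges]
  cases b <;> simp at h ⊢ <;> omega

/-! ### Integer-valued fields, free and wetted energies. -/

/-- Integer-valued height functions on the box. -/
abbrev Field (n : ℕ) : Type := box n → ℤ

/-- A height function extended by the boundary condition `c`. -/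
noncomputable def ext {n : ℕ} (c : ℤ) (ψ : Field n) (x : ℤ × ℤ) : ℤ :=
  if h : x ∈ box n then ψ ⟨x, h⟩ else c

theorem ext_of_mem {n : ℕ} {c : ℤ} {ψ : Field n} {x : ℤ × ℤ} (h : x ∈ box n) :
    ext c ψ x = ψ ⟨x, h⟩ := dif_pos h

theorem ext_of_notMem {n : ℕ} {c : ℤ} {ψ : Field n} {x : ℤ × ℤ} (h : x ∉ box n) :
    ext c ψ x = c := dif_neg h

@[simp] theorem ext_coe {n : ℕ} {c : ℤ} {ψ : Field n} (x : box n) :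
    ext c ψ x = ψ x := ext_of_mem x.2

theorem ext_injective {n : ℕ} (c : ℤ) : Function.Injective (ext (n := n) c) := by
  intro ψ ψ' h
  funext x
  simpa using congrFun h x

/-- The energy of an edge with end heights `a` and `b` for the wetted model. -/
def wetEdge (a b : ℤ) : ℤ := |a - b| + 2 * max 0 (min (-a) (-b))

/-- The energy of the model without floor. -/
noncomputable def freeEnergy {n : ℕ} (c : ℤ) (ψ : Field n) : ℤ :=
  ∑ e ∈ boxEdges n, |ext c ψ e.1 - ext c ψ (head e)|

/-- The energy of the wetted model on `ℤ`-valued fields. -/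
noncomputable def wetEnergy {n : ℕ} (c : ℤ) (ψ : Field n) : ℤ :=
  ∑ e ∈ boxEdges n, wetEdge (ext c ψ e.1) (ext c ψ (head e))

/-- The two forms serve different ends. The defining one compares with the free model and isolates
the domino penalty; this one charges each negative site separately, which gives `4` per unit of
depth after summing over edges and makes submodularity visible. -/
theorem wetEdge_eq (a b : ℤ) :
    wetEdge a b = |max a 0 - max b 0| + max 0 (-a) + max 0 (-b) := by
  unfold wetEdge; grind

theorem wetEdge_nonneg (a b : ℤ) : 0 ≤ wetEdge a b := by
  unfold wetEdge; positivity

theorem freeEnergy_le_wetEnergy {n : ℕ} (c : ℤ) (ψ : Field n) :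
    freeEnergy c ψ ≤ wetEnergy c ψ :=
  Finset.sum_le_sum fun _ _ => by unfold wetEdge; grind

/-! ### Energies as sums over oriented edges -/

theorem edge_injective : Function.Injective fun e : Edge => s(e.1, head e) := by
  rintro ⟨⟨a, b⟩, d⟩ ⟨⟨a', b'⟩, d'⟩ h
  cases d <;> cases d' <;> simp at h ⊢ <;> omega

theorem adj_head (e : Edge) : lattice.Adj e.1 (head e) := by
  obtain ⟨⟨a, b⟩, d⟩ := e
  cases d <;> simp [lattice]

theorem exists_edge_of_adj {x y : ℤ × ℤ} (h : lattice.Adj x y) :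
    ∃ e : Edge, s(e.1, head e) = s(x, y) := by
  obtain ⟨a, b⟩ := x
  obtain ⟨c, d⟩ := y
  have h : |a - c| + |b - d| = 1 := h
  have : (c = a + 1 ∧ d = b) ∨ (c = a - 1 ∧ d = b) ∨ (c = a ∧ d = b + 1) ∨ (c = a ∧ d = b - 1) := by
    grind
  rcases this with ⟨h1, h2⟩ | ⟨h1, h2⟩ | ⟨h1, h2⟩ | ⟨h1, h2⟩
  · exact ⟨((a, b), false), by simp [h1, h2]⟩
  · exact ⟨((a - 1, b), false), by simp [h1, h2]⟩
  · exact ⟨((a, b), true), by simp [h1, h2]⟩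
  · exact ⟨((a, b - 1), true), by simp [h1, h2]⟩

/-- The two edge sets differ only by edges with both ends outside the box, where the extended field
vanishes. -/
theorem energy_eq {n : ℕ} (φ : Config n) :
    energy φ = ∑ e ∈ boxEdges n, |extend φ e.1 - extend φ (head e)| := by
  classical
  have key : ∀ x y, lattice.Adj x y → x ∈ box n → y ∈ box n ∪ outerBoundary n := by
    intro x y h hx
    by_cases hy : y ∈ box n
    · exact Finset.mem_union_left _ hy
    · exact Finset.mem_union_right _ (Finset.mem_sdiff.2
        ⟨Finset.mem_biUnion.2 ⟨x, hx, mem_neighbors.2 h⟩, hy⟩)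
  have h1 : ∑ e ∈ boxEdges n, |extend φ e.1 - extend φ (head e)| =
      ∑ s ∈ (boxEdges n).image fun e : Edge => s(e.1, head e), gradient φ s := by
    rw [Finset.sum_image fun a _ b _ h => edge_injective h]
    rfl
  rw [h1, energy]
  rw [Finset.sum_subset (s₁ := edges n)
    (s₂ := edges n ∪ (boxEdges n).image fun e : Edge => s(e.1, head e)) Finset.subset_union_left,
    Finset.sum_subset (s₁ := (boxEdges n).image fun e : Edge => s(e.1, head e))
    (s₂ := edges n ∪ (boxEdges n).image fun e : Edge => s(e.1, head e)) Finset.subset_union_right]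
  · intro s hs hs'
    have hs : s ∈ edges n := (Finset.mem_union.1 hs).resolve_right hs'
    induction s with
    | _ x y =>
      have hadj : lattice.Adj x y := by simpa using (Finset.mem_filter.1 hs).2
      obtain ⟨e, he⟩ := exists_edge_of_adj hadj
      have hx : e ∉ boxEdges n := fun h => hs' (Finset.mem_image.2 ⟨e, h, he⟩)
      rw [← he]
      have h1 : e.1 ∉ box n := fun h => hx (mem_boxEdges_of_tail h)
      have h2 : head e ∉ box n := fun h => hx (mem_boxEdges_of_head h)
      simp [gradient, extend, h1, h2]
  · intro s hs hs'
    obtain ⟨e, he, rfl⟩ := Finset.mem_image.1 ((Finset.mem_union.1 hs).resolve_left hs')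
    have hadj := adj_head e
    have hno : ∀ x y, s(x, y) ∉ edges n → lattice.Adj x y → x ∉ box n := by
      intro x y h hxy hx
      refine h (Finset.mem_filter.2 ⟨Finset.mk_mem_sym2_iff.2 ⟨Finset.mem_union_left _ hx,
        key _ _ hxy hx⟩, by simpa using hxy⟩)
    have h1 := hno _ _ hs' hadj
    have h2 := hno _ _ (by rwa [Sym2.eq_swap]) hadj.symm
    simp [gradient, extend, h1, h2]

theorem sum_tails_eq {n : ℕ} (f : ℤ × ℤ → ℤ) (hf : ∀ p ∉ box n, f p = 0) :
    ∑ e ∈ boxEdges n, f e.1 = 2 * ∑ p ∈ box n, f p := by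
  rw [boxEdges, Finset.sum_product]
  simp only [Finset.sum_const, Finset.card_univ, Fintype.card_bool]
  rw [← Finset.smul_sum, nsmul_eq_mul]
  congr 1
  refine (Finset.sum_subset (fun p hp => ?_) fun p _ hp => hf p hp).symm
  rw [mem_box] at hp
  simp [tails]; omega

theorem sum_heads_eq {n : ℕ} (f : ℤ × ℤ → ℤ) (hf : ∀ p ∉ box n, f p = 0) :
    ∑ e ∈ boxEdges n, f (head e) = 2 * ∑ p ∈ box n, f p := by
  have shift : ∀ v : ℤ × ℤ, (∀ p ∈ box n, p - v ∈ tails n) →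
      ∑ p ∈ tails n, f (p + v) = ∑ p ∈ box n, f p := by
    intro v hv
    rw [← Finset.sum_image (s := tails n) (g := fun p => p + v) (f := f)
      fun a _ b _ h => add_right_cancel h]
    refine (Finset.sum_subset (fun p hp => ?_) fun p _ hp => hf p hp).symm
    exact Finset.mem_image.2 ⟨p - v, hv p hp, by simp⟩
  rw [boxEdges, Finset.sum_product]
  simp only [Fintype.sum_bool, Finset.sum_add_distrib, head_true, head_false]
  have h1 := shift (0, 1) fun p hp => by rw [mem_box] at hp; simp [tails]; omega
  have h2 := shift (1, 0) fun p hp => by rw [mem_box] at hp; simp [tails]; omega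
  simp only [Prod.add_def, add_zero] at h1 h2
  rw [h1, h2]; ring

/-- The positive part of a field. -/
def posPart {n : ℕ} (ψ : Field n) : Config n := fun x => (ψ x).toNat

/-- Each site of the box is the tail of two edges and the head of two, so its negative part is
counted four times. -/
theorem wetEnergy_zero {n : ℕ} (ψ : Field n) :
    wetEnergy 0 ψ = energy (posPart ψ) + 4 * ∑ x, max 0 (-ψ x) := by
  have hpos : ∀ p, extend (posPart ψ) p = max (ext 0 ψ p) 0 := by
    intro p
    by_cases h : p ∈ box n <;> simp [extend, ext, h, posPart]
  have hf : ∀ p ∉ box n, max 0 (-ext 0 ψ p) = 0 := by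
    intro p hp; simp [ext_of_notMem hp]
  have hs : ∑ p ∈ box n, max 0 (-ext 0 ψ p) = ∑ x, max 0 (-ψ x) := by
    rw [← Finset.sum_coe_sort]
    simp
  rw [energy_eq, wetEnergy]
  simp only [wetEdge_eq, Finset.sum_add_distrib, hpos]
  rw [sum_tails_eq (fun p => max 0 (-ext 0 ψ p)) hf, sum_heads_eq (fun p => max 0 (-ext 0 ψ p)) hf,
    hs]
  ring

/-! ### Weights on `ℤ`-valued fields -/

/-- The Gibbs weight without floor. -/
noncomputable def freeWeight (β : ℝ) (c : ℤ) {n : ℕ} (ψ : Field n) : ℝ≥0∞ :=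
  ENNReal.ofReal (Real.exp (-β * (freeEnergy c ψ : ℝ)))

/-- The Gibbs weight of the wetted model on `ℤ`-valued fields. -/
noncomputable def wetWeight (β : ℝ) (c : ℤ) {n : ℕ} (ψ : Field n) : ℝ≥0∞ :=
  ENNReal.ofReal (Real.exp (-β * (wetEnergy c ψ : ℝ)))

/-- The only place where the critical value of the pinning matters: summing `e^{-4βm}` over the
depths `m ≥ 0` gives exactly `e^{λ_w}`. -/
theorem tsum_wet_site {β : ℝ} (hβ : 0 < β) (j : ℕ) :
    (∑' k : ℤ, if k.toNat = j then ENNReal.ofReal (Real.exp (-(4 * β) * (max 0 (-k) : ℤ))) else 0) =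
      ENNReal.ofReal (Real.exp (criticalPinning β * if j = 0 then 1 else 0)) := by
  rcases Nat.eq_zero_or_pos j with rfl | hj
  · have hinj : Function.Injective fun m : ℕ => -(m : ℤ) := fun a b h => by simpa using h
    rw [← hinj.tsum_eq]
    · have hr : Real.exp (-4 * β) < 1 :=
        (Real.exp_lt_exp.2 (by linarith : -4 * β < 0)).trans_eq Real.exp_zero
      have h1 : ∀ m : ℕ, (if (-(m : ℤ)).toNat = 0 then
          ENNReal.ofReal (Real.exp (-(4 * β) * (max 0 (- -(m : ℤ)) : ℤ))) else 0) =
          ENNReal.ofReal (Real.exp (-4 * β)) ^ m := by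
        intro m
        have h2 : max (0 : ℤ) (- -(m : ℤ)) = m := by simp
        rw [if_pos (by omega), h2, ← ENNReal.ofReal_pow (Real.exp_pos _).le, ← Real.exp_nat_mul]
        congr 2
        push_cast
        ring
      simp_rw [h1]
      rw [ENNReal.tsum_geometric, ← ENNReal.ofReal_one,
        ← ENNReal.ofReal_sub _ (Real.exp_pos _).le,
        ← ENNReal.ofReal_inv_of_pos (by linarith)]
      congr 1
      simp only [criticalPinning, if_true, mul_one]
      rw [Real.exp_neg, Real.exp_log (by linarith)]
    · intro k hk
      have : k.toNat = 0 := by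
        by_contra h
        simp at hk
        omega
      exact ⟨(-k).toNat, by simp; omega⟩
  · rw [tsum_eq_single (j : ℤ)]
    · simp [hj.ne']
    · intro k hk
      rw [if_neg]
      omega

theorem tsum_wetWeight_fiber {β : ℝ} (hβ : 0 < β) {n : ℕ} (φ : Config n) :
    (∑' ψ : Field n, if posPart ψ = φ then wetWeight β 0 ψ else 0) =
      ENNReal.ofReal (weight β (criticalPinning β) φ) := by
  classical
  have h1 : ∀ ψ : Field n, (if posPart ψ = φ then wetWeight β 0 ψ else 0) =
      ENNReal.ofReal (Real.exp (-β * (energy φ : ℝ))) * ∏ x, (if (ψ x).toNat = φ x then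
        ENNReal.ofReal (Real.exp (-(4 * β) * (max 0 (-ψ x) : ℤ))) else 0) := by
    intro ψ
    split_ifs with h
    · have : ∀ x, (ψ x).toNat = φ x := fun x => congrFun h x
      simp only [this, if_true]
      rw [← ENNReal.ofReal_prod_of_nonneg fun _ _ => (Real.exp_pos _).le, ← Real.exp_sum,
        ← ENNReal.ofReal_mul (Real.exp_pos _).le, ← Real.exp_add, wetWeight, wetEnergy_zero, h,
        ← Finset.mul_sum]
      push_cast
      congr 2
      ring
    · obtain ⟨x, hx⟩ := Function.ne_iff.1 h
      rw [Finset.prod_eq_zero (Finset.mem_univ x) (if_neg hx), mul_zero]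
  simp_rw [h1]
  rw [ENNReal.tsum_mul_left, tsum_pi_prod (fun x k => if k.toNat = φ x then
        ENNReal.ofReal (Real.exp (-(4 * β) * (max 0 (-k) : ℤ))) else 0)]
  simp_rw [tsum_wet_site hβ]
  rw [← ENNReal.ofReal_prod_of_nonneg fun _ _ => (Real.exp_pos _).le, ← Real.exp_sum,
    ← ENNReal.ofReal_mul (Real.exp_pos _).le, ← Real.exp_add, weight, ← Finset.mul_sum, zeros]
  simp

theorem tsum_weight_eq {β : ℝ} (hβ : 0 < β) {n : ℕ} (A : Set (Config n)) :
    ∑' φ, A.indicator (fun φ => ENNReal.ofReal (weight β (criticalPinning β) φ)) φ =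
      ∑' ψ : Field n, (posPart ⁻¹' A).indicator (wetWeight β 0) ψ := by
  classical
  have h1 : ∀ φ, A.indicator (fun φ => ENNReal.ofReal (weight β (criticalPinning β) φ)) φ =
      ∑' ψ : Field n, if posPart ψ = φ then (posPart ⁻¹' A).indicator (wetWeight β 0) ψ else 0 := by
    intro φ
    by_cases h : φ ∈ A
    · rw [Set.indicator_of_mem h, ← tsum_wetWeight_fiber hβ]
      refine tsum_congr fun ψ => ?_
      split_ifs with hψ
      · rw [Set.indicator_of_mem]
        rw [← hψ] at h; exact h
      · rfl
    · rw [Set.indicator_of_notMem h]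
      refine (ENNReal.tsum_eq_zero.2 fun ψ => ?_).symm
      split_ifs with hψ
      · rw [Set.indicator_of_notMem]
        rw [← hψ] at h; exact h
      · rfl
  simp_rw [h1]
  rw [ENNReal.tsum_comm]
  refine tsum_congr fun ψ => ?_
  refine (tsum_congr fun φ => ?_).trans
    (tsum_ite_eq (posPart ψ) fun _ => (posPart ⁻¹' A).indicator (wetWeight β 0) ψ)
  simp only [eq_comm]

/-- From here on, floor and pinning are replaced by the wetted weight on `ℤ`-valued fields. -/
theorem measure_eq_div {β : ℝ} (hβ : 0 < β) {n : ℕ} (A : Set (Config n)) :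
    measure β (criticalPinning β) n A =
      (∑' ψ : Field n, (posPart ⁻¹' A).indicator (wetWeight β 0) ψ) /
        ∑' ψ : Field n, wetWeight β 0 ψ := by
  have hZ : partitionFunction β (criticalPinning β) n = ∑' ψ : Field n, wetWeight β 0 ψ := by
    have := tsum_weight_eq hβ (Set.univ : Set (Config n))
    simpa [partitionFunction] using this
  rw [← tsum_weight_eq hβ, ← hZ, measure, Measure.sum_apply _ (Set.to_countable A).measurableSet,
    div_eq_mul_inv, ← ENNReal.tsum_mul_right]
  refine tsum_congr fun φ => ?_
  rw [Measure.smul_apply, Measure.dirac_apply' _ (Set.to_countable A).measurableSet]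
  by_cases h : φ ∈ A <;> simp [h, div_eq_mul_inv]

/-! ### Summability -/

theorem tsum_exp_abs_le {b : ℝ} (hb : 2 ≤ b) :
    ∑' k : ℤ, ENNReal.ofReal (Real.exp (-b * |(k : ℝ)|)) ≤ 2 := by
  have hr3 : Real.exp (-b) ≤ 1 / 3 := by
    have h1 : (3 : ℝ) ≤ Real.exp b := by have := Real.add_one_le_exp b; linarith
    rw [Real.exp_neg, one_div]
    exact inv_anti₀ (by norm_num) h1
  have hle : ∀ k : ℤ, ENNReal.ofReal (Real.exp (-b * |(k : ℝ)|)) ≤ (1 / 3) ^ k.natAbs := by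
    intro k
    have h1 : |(k : ℝ)| = (k.natAbs : ℝ) := by rw [Nat.cast_natAbs]; push_cast; rfl
    have h2 : (1 / 3 : ℝ≥0∞) = ENNReal.ofReal (1 / 3) := by
      rw [ENNReal.ofReal_div_of_pos (by norm_num)]; simp
    rw [h2, ← ENNReal.ofReal_pow (by norm_num), h1]
    refine ENNReal.ofReal_le_ofReal ?_
    rw [mul_comm, Real.exp_nat_mul]
    exact pow_le_pow_left₀ (Real.exp_pos _).le hr3 _
  refine (ENNReal.tsum_le_tsum hle).trans ?_
  have h3 : ∑' k : ℤ, (1 / 3 : ℝ≥0∞) ^ k.natAbs ≤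
      ∑' m : ℕ, (1 / 3 : ℝ≥0∞) ^ m + ∑' m : ℕ, (1 / 3 : ℝ≥0∞) ^ (m + 1) := by
    rw [tsum_of_nat_of_neg_add_one (f := fun k : ℤ => (1 / 3 : ℝ≥0∞) ^ k.natAbs)
      ENNReal.summable ENNReal.summable]
    refine le_of_eq ?_
    congr 1
  refine h3.trans ?_
  have h4 : (1 - 1 / 3 : ℝ≥0∞)⁻¹ = ENNReal.ofReal (3 / 2) := by
    have : (1 / 3 : ℝ≥0∞) = ENNReal.ofReal (1 / 3) := by
      rw [ENNReal.ofReal_div_of_pos (by norm_num)]; simp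
    rw [this, ← ENNReal.ofReal_one, ← ENNReal.ofReal_sub _ (by norm_num),
      ← ENNReal.ofReal_inv_of_pos (by norm_num)]
    norm_num
  simp_rw [pow_succ]
  rw [ENNReal.tsum_mul_right, ENNReal.tsum_geometric, h4]
  have : (1 / 3 : ℝ≥0∞) = ENNReal.ofReal (1 / 3) := by
    rw [ENNReal.ofReal_div_of_pos (by norm_num)]; simp
  rw [this, ← ENNReal.ofReal_mul (by norm_num), ← ENNReal.ofReal_add (by norm_num) (by norm_num)]
  norm_num

/-- The differences with the left neighbours determine the field, column by column from the
boundary, and they are gradients over distinct edges. Keeping only these edges leaves a product of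
one-site sums. -/
theorem tsum_freeWeight_le {b : ℝ} (hb : 2 ≤ b) (c : ℤ) (n : ℕ) :
    ∑' ψ : Field n, freeWeight b c ψ ≤ 2 ^ (box n).card := by
  let T : Field n → Field n := fun ψ x => ψ x - ext c ψ (x.1.1 - 1, x.1.2)
  have hT : Function.Injective T := by
    intro ψ ψ' h
    have key : ∀ j : ℕ, ∀ p : ℤ × ℤ, p.1 ≤ -((n / 2 : ℕ) : ℤ) - 1 + j → ext c ψ p = ext c ψ' p := by
      intro j
      induction j with
      | zero =>
        intro p hp
        have : p ∉ box n := by rw [mem_box]; push_cast at hp ⊢; omega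
        rw [ext_of_notMem this, ext_of_notMem this]
      | succ j ih =>
        intro p hp
        by_cases hpb : p ∈ box n
        · have h1 := congrFun h ⟨p, hpb⟩
          have h2 := ih (p.1 - 1, p.2) (by push_cast at hp ⊢; omega)
          simp only [T, h2] at h1
          rw [ext_of_mem hpb, ext_of_mem hpb]
          linarith
        · rw [ext_of_notMem hpb, ext_of_notMem hpb]
    refine ext_injective c (funext fun p => ?_)
    refine key (p.1 + ((n / 2 : ℕ) : ℤ) + 1).toNat p ?_
    omega
  have hle : ∀ ψ : Field n, freeWeight b c ψ ≤
      ∏ x, ENNReal.ofReal (Real.exp (-b * |((T ψ x : ℤ) : ℝ)|)) := by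
    intro ψ
    rw [← ENNReal.ofReal_prod_of_nonneg fun _ _ => (Real.exp_pos _).le, ← Real.exp_sum, freeWeight]
    refine ENNReal.ofReal_le_ofReal (Real.exp_le_exp.2 ?_)
    rw [← Finset.mul_sum]
    have h1 : ∑ x, |T ψ x| ≤ freeEnergy c ψ := by
      have hinj : Function.Injective fun x : box n => (((x.1.1 - 1, x.1.2), false) : Edge) := by
        intro x y hxy
        simp only [Prod.mk.injEq, and_true] at hxy
        exact Subtype.ext (Prod.ext (by linarith [hxy.1]) hxy.2)
      calc ∑ x, |T ψ x| = ∑ e ∈ Finset.univ.map ⟨_, hinj⟩,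
            |ext c ψ e.1 - ext c ψ (head e)| := by
            rw [Finset.sum_map]
            refine Finset.sum_congr rfl fun x _ => ?_
            simp [T, abs_sub_comm]
        _ ≤ _ := by
            refine Finset.sum_le_sum_of_subset_of_nonneg (fun e he => ?_) fun _ _ _ => abs_nonneg _
            obtain ⟨x, -, rfl⟩ := Finset.mem_map.1 he
            refine mem_boxEdges_of_head ?_
            simp
    have h2 : ∑ x, |((T ψ x : ℤ) : ℝ)| ≤ (freeEnergy c ψ : ℝ) := by exact_mod_cast h1
    nlinarith
  calc ∑' ψ : Field n, freeWeight b c ψ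
      ≤ ∑' ψ : Field n, ∏ x, ENNReal.ofReal (Real.exp (-b * |((T ψ x : ℤ) : ℝ)|)) :=
        ENNReal.tsum_le_tsum hle
    _ ≤ ∑' f : Field n, ∏ x, ENNReal.ofReal (Real.exp (-b * |((f x : ℤ) : ℝ)|)) :=
        ENNReal.tsum_comp_le_tsum_of_injective hT
          fun f : Field n => ∏ x, ENNReal.ofReal (Real.exp (-b * |((f x : ℤ) : ℝ)|))
    _ = ∏ _x : box n, ∑' k : ℤ, ENNReal.ofReal (Real.exp (-b * |(k : ℝ)|)) :=
        tsum_pi_prod fun _ (k : ℤ) => ENNReal.ofReal (Real.exp (-b * |(k : ℝ)|))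
    _ ≤ ∏ _x : box n, 2 := Finset.prod_le_prod' fun _ _ => tsum_exp_abs_le hb
    _ = _ := by simp

theorem wetWeight_le_freeWeight {β : ℝ} (hβ : 0 ≤ β) (c : ℤ) {n : ℕ} (ψ : Field n) :
    wetWeight β c ψ ≤ freeWeight β c ψ := by
  refine ENNReal.ofReal_le_ofReal (Real.exp_le_exp.2 ?_)
  have : (freeEnergy c ψ : ℝ) ≤ wetEnergy c ψ := by exact_mod_cast freeEnergy_le_wetEnergy c ψ
  nlinarith

theorem tsum_freeWeight_ne_top {b : ℝ} (hb : 2 ≤ b) (c : ℤ) (n : ℕ) :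
    ∑' ψ : Field n, freeWeight b c ψ ≠ ∞ :=
  ne_top_of_le_ne_top (ENNReal.pow_ne_top (by simp)) (tsum_freeWeight_le hb c n)

theorem tsum_wetWeight_ne_top {b : ℝ} (hb : 2 ≤ b) (c : ℤ) (n : ℕ) :
    ∑' ψ : Field n, wetWeight b c ψ ≠ ∞ :=
  ne_top_of_le_ne_top (tsum_freeWeight_ne_top hb c n)
    (ENNReal.tsum_le_tsum fun ψ => wetWeight_le_freeWeight (by linarith) c ψ)

theorem one_le_tsum_wetWeight (β : ℝ) (n : ℕ) : 1 ≤ ∑' ψ : Field n, wetWeight β 0 ψ := by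
  refine le_trans (le_of_eq ?_) (ENNReal.le_tsum (0 : Field n))
  have h : ∀ x, ext 0 (0 : Field n) x = 0 := by
    intro x; by_cases hx : x ∈ box n <;> simp [ext, hx]
  simp [wetWeight, wetEnergy, h, wetEdge]

/-! ### An exponential moment bound -/

/-- Jensen's inequality for the exponential, for weights of finite mass. -/
theorem ofReal_exp_neg_mul_tsum_le {α : Type*} {w : α → ℝ≥0∞} (hw : ∑' a, w a ≠ ∞) {X : α → ℝ}
    (hX : ∀ a, 0 ≤ X a) {m : ℝ} (hm : 0 ≤ m)
    (h : ∑' a, w a * ENNReal.ofReal (X a) ≤ ENNReal.ofReal m * ∑' a, w a) :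
    ENNReal.ofReal (Real.exp (-m)) * ∑' a, w a ≤
      ∑' a, w a * ENNReal.ofReal (Real.exp (-X a)) := by
  have hpt : ∀ a, ENNReal.ofReal (Real.exp (-m)) * (1 + ENNReal.ofReal m) * w a ≤
      w a * ENNReal.ofReal (Real.exp (-X a)) +
        ENNReal.ofReal (Real.exp (-m)) * (w a * ENNReal.ofReal (X a)) := by
    intro a
    -- The tangent line of `x ↦ e^{-x}` at `m`, arranged without subtraction so that it passes to
    -- `[0, ∞]`. Integrating it gives Jensen's inequality without normalising `w`.
    have h1 : Real.exp (-m) * (1 + m) ≤ Real.exp (-X a) + Real.exp (-m) * X a := by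
      have h2 : Real.exp (-X a) = Real.exp (-m) * Real.exp (m - X a) := by
        rw [← Real.exp_add]; congr 1; ring
      have h3 := Real.add_one_le_exp (m - X a)
      have h4 := Real.exp_pos (-m)
      rw [h2]; nlinarith
    have h5 := ENNReal.ofReal_le_ofReal h1
    rw [ENNReal.ofReal_mul (Real.exp_pos _).le, ENNReal.ofReal_add zero_le_one hm,
      ENNReal.ofReal_one,
      ENNReal.ofReal_add (Real.exp_pos _).le (mul_nonneg (Real.exp_pos _).le (hX a)),
      ENNReal.ofReal_mul (Real.exp_pos _).le] at h5
    calc _ ≤ (ENNReal.ofReal (Real.exp (-X a)) +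
          ENNReal.ofReal (Real.exp (-m)) * ENNReal.ofReal (X a)) * w a := by gcongr
      _ = _ := by ring
  have hsum := ENNReal.tsum_le_tsum hpt
  rw [ENNReal.tsum_mul_left, ENNReal.tsum_add, ENNReal.tsum_mul_left] at hsum
  have h6 := hsum.trans (add_le_add_right (mul_le_mul_right h (ENNReal.ofReal (Real.exp (-m)))) _)
  have h7 : ENNReal.ofReal (Real.exp (-m)) * (ENNReal.ofReal m * ∑' a, w a) ≠ ∞ :=
    ENNReal.mul_ne_top ENNReal.ofReal_ne_top (ENNReal.mul_ne_top ENNReal.ofReal_ne_top hw)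
  refine (ENNReal.add_le_add_iff_right h7).1 (le_trans (le_of_eq ?_) h6)
  ring

/-! ### Monotonicity in the boundary condition -/

/-- The finite four functions theorem passes to infinite sums because these are suprema of finite
ones. -/
theorem tsum_mul_tsum_le_of_four_functions {α : Type*} [DistribLattice α]
    {f₁ f₂ f₃ f₄ : α → ℝ} (h₁ : 0 ≤ f₁) (h₂ : 0 ≤ f₂) (h₃ : 0 ≤ f₃) (h₄ : 0 ≤ f₄)
    (h : ∀ a b, f₁ a * f₂ b ≤ f₃ (a ⊓ b) * f₄ (a ⊔ b)) :
    (∑' a, ENNReal.ofReal (f₁ a)) * ∑' a, ENNReal.ofReal (f₂ a) ≤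
      (∑' a, ENNReal.ofReal (f₃ a)) * ∑' a, ENNReal.ofReal (f₄ a) := by
  classical
  rw [ENNReal.tsum_eq_iSup_sum (f := fun a => ENNReal.ofReal (f₁ a)),
    ENNReal.tsum_eq_iSup_sum (f := fun a => ENNReal.ofReal (f₂ a)), ENNReal.iSup_mul]
  refine iSup_le fun s => ?_
  rw [ENNReal.mul_iSup]
  refine iSup_le fun t => ?_
  calc (∑ a ∈ s, ENNReal.ofReal (f₁ a)) * ∑ a ∈ t, ENNReal.ofReal (f₂ a)
      = ENNReal.ofReal ((∑ a ∈ s, f₁ a) * ∑ a ∈ t, f₂ a) := by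
        rw [ENNReal.ofReal_mul (Finset.sum_nonneg fun a _ => h₁ a),
          ENNReal.ofReal_sum_of_nonneg fun a _ => h₁ a,
          ENNReal.ofReal_sum_of_nonneg fun a _ => h₂ a]
    _ ≤ ENNReal.ofReal ((∑ a ∈ Finset.image₂ (· ⊓ ·) s t, f₃ a) *
          ∑ a ∈ Finset.image₂ (· ⊔ ·) s t, f₄ a) :=
        ENNReal.ofReal_le_ofReal (four_functions_theorem f₁ f₂ f₃ f₄ h₁ h₂ h₃ h₄ h s t)
    _ = (∑ a ∈ Finset.image₂ (· ⊓ ·) s t, ENNReal.ofReal (f₃ a)) *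
          ∑ a ∈ Finset.image₂ (· ⊔ ·) s t, ENNReal.ofReal (f₄ a) := by
        rw [ENNReal.ofReal_mul (Finset.sum_nonneg fun a _ => h₃ a),
          ENNReal.ofReal_sum_of_nonneg fun a _ => h₃ a,
          ENNReal.ofReal_sum_of_nonneg fun a _ => h₄ a]
    _ ≤ _ := mul_le_mul' (ENNReal.sum_le_tsum _) (ENNReal.sum_le_tsum _)

theorem abs_inf_sub_inf_add_le (a b c d : ℤ) :
    |min a c - min b d| + |max a c - max b d| ≤ |a - b| + |c - d| := by
  grind

/-- Positive parts commute with `min` and `max`, so the gradient part is submodular as in the free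
model; the negative parts are one-site terms and balance exactly. -/
theorem wetEdge_submodular (a b c d : ℤ) :
    wetEdge (min a c) (min b d) + wetEdge (max a c) (max b d) ≤ wetEdge a b + wetEdge c d := by
  simp only [wetEdge_eq]
  have h := abs_inf_sub_inf_add_le (max a 0) (max b 0) (max c 0) (max d 0)
  have h1 : ∀ x y : ℤ, max (min x y) 0 = min (max x 0) (max y 0) := by intro x y; omega
  have h2 : ∀ x y : ℤ, max (max x y) 0 = max (max x 0) (max y 0) := by intro x y; omega
  have h3 : ∀ x y : ℤ, max 0 (-min x y) + max 0 (-max x y) = max 0 (-x) + max 0 (-y) := by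
    intro x y; omega
  have h4 := h3 a c
  have h5 := h3 b d
  rw [h1, h1, h2, h2]
  linarith

theorem wetEnergy_submodular {n : ℕ} {c : ℤ} (hc : 0 ≤ c) (ψ ψ' : Field n) :
    wetEnergy 0 (ψ ⊓ ψ') + wetEnergy c (ψ ⊔ ψ') ≤ wetEnergy 0 ψ + wetEnergy c ψ' := by
  have h1 : ∀ p, ext 0 (ψ ⊓ ψ') p = min (ext 0 ψ p) (ext c ψ' p) := by
    intro p; by_cases h : p ∈ box n <;> simp [ext, h, hc]
  have h2 : ∀ p, ext c (ψ ⊔ ψ') p = max (ext 0 ψ p) (ext c ψ' p) := by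
    intro p; by_cases h : p ∈ box n <;> simp [ext, h, hc]
  simp only [wetEnergy, ← Finset.sum_add_distrib, h1, h2]
  exact Finset.sum_le_sum fun e _ => wetEdge_submodular _ _ _ _

/-- Stochastic domination in the manner of Holley, with denominators cleared. -/
theorem wetWeight_mono_boundary {β : ℝ} (hβ : 0 ≤ β) {n : ℕ} {c : ℤ} (hc : 0 ≤ c)
    {E : Set (Field n)} (hE : IsUpperSet E) :
    (∑' ψ, E.indicator (wetWeight β 0) ψ) * ∑' ψ : Field n, wetWeight β c ψ ≤
      (∑' ψ : Field n, wetWeight β 0 ψ) * ∑' ψ, E.indicator (wetWeight β c) ψ := by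
  classical
  have hind : ∀ c : ℤ, ∀ ψ : Field n, E.indicator (wetWeight β c) ψ =
      ENNReal.ofReal (E.indicator (fun ψ => Real.exp (-β * (wetEnergy c ψ : ℝ))) ψ) := by
    intro c ψ
    by_cases h : ψ ∈ E <;> simp [h, wetWeight]
  simp only [hind]
  refine tsum_mul_tsum_le_of_four_functions
    (f₁ := fun ψ => E.indicator (fun ψ => Real.exp (-β * (wetEnergy 0 ψ : ℝ))) ψ)
    (f₂ := fun ψ => Real.exp (-β * (wetEnergy c ψ : ℝ)))
    (f₃ := fun ψ => Real.exp (-β * (wetEnergy 0 ψ : ℝ)))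
    (f₄ := fun ψ => E.indicator (fun ψ => Real.exp (-β * (wetEnergy c ψ : ℝ))) ψ)
    (fun ψ => Set.indicator_nonneg (fun _ _ => (Real.exp_pos _).le) ψ)
    (fun ψ => (Real.exp_pos _).le) (fun ψ => (Real.exp_pos _).le)
    (fun ψ => Set.indicator_nonneg (fun _ _ => (Real.exp_pos _).le) ψ) ?_
  intro ψ ψ'
  by_cases h : ψ ∈ E
  · rw [Set.indicator_of_mem h, Set.indicator_of_mem (hE le_sup_left h), ← Real.exp_add,
      ← Real.exp_add]
    refine Real.exp_le_exp.2 ?_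
    have := wetEnergy_submodular hc ψ ψ'
    have h2 : (wetEnergy 0 (ψ ⊓ ψ') : ℝ) + wetEnergy c (ψ ⊔ ψ') ≤
        wetEnergy 0 ψ + wetEnergy c ψ' := by exact_mod_cast this
    nlinarith
  · rw [Set.indicator_of_notMem h, zero_mul]
    exact mul_nonneg (Real.exp_pos _).le
      (Set.indicator_nonneg (fun _ _ => (Real.exp_pos _).le) _)

/-! ### Large energies are unlikely -/

/-- Half of `β` pays for the large energy; the other half, still at least `2`, keeps the sum over
fields under control. -/
theorem tsum_wetWeight_energy_ge {β : ℝ} (hβ : 4 ≤ β) {n : ℕ} (s : ℝ) :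
    ∑' ψ : Field n, {ψ | s ≤ (wetEnergy 0 ψ : ℝ)}.indicator (wetWeight β 0) ψ ≤
      ENNReal.ofReal (Real.exp (-(β / 2) * s)) * 2 ^ (box n).card := by
  calc ∑' ψ : Field n, {ψ | s ≤ (wetEnergy 0 ψ : ℝ)}.indicator (wetWeight β 0) ψ
      ≤ ∑' ψ : Field n, ENNReal.ofReal (Real.exp (-(β / 2) * s)) * freeWeight (β / 2) 0 ψ := by
        refine ENNReal.tsum_le_tsum fun ψ => ?_
        refine Set.indicator_le (s := {ψ | s ≤ (wetEnergy 0 ψ : ℝ)})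
          (g := fun ψ => ENNReal.ofReal (Real.exp (-(β / 2) * s)) * freeWeight (β / 2) 0 ψ)
          (fun ψ h => ?_) ψ
        have h : s ≤ (wetEnergy 0 ψ : ℝ) := h
        rw [wetWeight, freeWeight, ← ENNReal.ofReal_mul (Real.exp_pos _).le, ← Real.exp_add]
        refine ENNReal.ofReal_le_ofReal (Real.exp_le_exp.2 ?_)
        have h2 : (freeEnergy 0 ψ : ℝ) ≤ wetEnergy 0 ψ := by
          exact_mod_cast freeEnergy_le_wetEnergy 0 ψ
        nlinarith
    _ ≤ _ := by
        rw [ENNReal.tsum_mul_left]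
        gcongr
        exact tsum_freeWeight_le (by linarith) 0 n

/-! ### Low dominoes and the raising map -/

/-- The side length of the box. -/
def side (n : ℕ) : ℕ := 2 * (n / 2) + 1

theorem card_box (n : ℕ) : (box n).card = side n ^ 2 := by
  simp only [box, Finset.card_product, Int.card_Icc, side, sq]
  congr 1 <;> omega

/-- The tails of the horizontal edges with both ends at negative height. -/
noncomputable def dominoes {n : ℕ} (ψ : Field n) : Finset (ℤ × ℤ) :=
  (box n).filter fun p => ext 0 ψ p ≤ -1 ∧ ext 0 ψ (p.1 + 1, p.2) ≤ -1

theorem card_boundary_edges_le (n : ℕ) :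
    ((boxEdges n).filter fun e => ¬(e.1 ∈ box n ↔ head e ∈ box n)).card ≤ 4 * side n := by
  classical
  set M : ℤ := ((n / 2 : ℕ) : ℤ) with hM
  let V : Finset Edge := (({-M - 1, M} : Finset ℤ) ×ˢ Finset.Icc (-M) M) ×ˢ {false}
  let W : Finset Edge := (Finset.Icc (-M) M ×ˢ ({-M - 1, M} : Finset ℤ)) ×ˢ {true}
  have hsub : ((boxEdges n).filter fun e => ¬(e.1 ∈ box n ↔ head e ∈ box n)) ⊆ V ∪ W := by
    rintro ⟨p, b⟩ he
    have h := (Finset.mem_filter.1 he).2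
    rw [mem_box, mem_box] at h
    cases b
    · refine Finset.mem_union_left _ ?_
      simp only [V, Finset.mem_product, Finset.mem_insert, Finset.mem_singleton, Finset.mem_Icc]
      simp only [head_false, ← hM] at h
      clear_value M
      grind
    · refine Finset.mem_union_right _ ?_
      simp only [W, Finset.mem_product, Finset.mem_insert, Finset.mem_singleton, Finset.mem_Icc]
      simp only [head_true, ← hM] at h
      clear_value M
      grind
  have hI : (Finset.Icc (-M) M).card = side n := by
    rw [Int.card_Icc, side]; omega
  have hP : (({-M - 1, M} : Finset ℤ)).card ≤ 2 := Finset.card_le_two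
  have hV : V.card ≤ 2 * side n := by
    simp only [V, Finset.card_product, hI, Finset.card_singleton, mul_one]
    gcongr
  have hW : W.card ≤ 2 * side n := by
    simp only [W, Finset.card_product, hI, Finset.card_singleton, mul_one]
    rw [mul_comm]; gcongr
  calc _ ≤ (V ∪ W).card := Finset.card_le_card hsub
    _ ≤ V.card + W.card := Finset.card_union_le _ _
    _ ≤ _ := by omega

/-- Inside the box gradients do not change and penalties do not grow, while each low domino saves
`2`. Edges across the boundary cost at most one each. -/
theorem wetEnergy_add_one_le {n : ℕ} (ψ : Field n) :
    wetEnergy 0 (ψ + 1) ≤ wetEnergy 0 ψ + 4 * side n - 2 * (dominoes ψ).card := by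
  classical
  have hext : ∀ p, ext 0 (ψ + 1) p = ext 0 ψ p + if p ∈ box n then 1 else 0 := by
    intro p; by_cases h : p ∈ box n <;> simp [ext, h]
  have hpt : ∀ e ∈ boxEdges n, wetEdge (ext 0 (ψ + 1) e.1) (ext 0 (ψ + 1) (head e)) +
      2 * (if e ∈ dominoes ψ ×ˢ {false} then 1 else 0) ≤
      wetEdge (ext 0 ψ e.1) (ext 0 ψ (head e)) +
        if ¬(e.1 ∈ box n ↔ head e ∈ box n) then 1 else 0 := by
    intro e _
    have hd : e ∈ dominoes ψ ×ˢ {false} → e.1 ∈ box n ∧ head e ∈ box n ∧ ext 0 ψ e.1 ≤ -1 ∧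
        ext 0 ψ (head e) ≤ -1 := by
      obtain ⟨p, b⟩ := e
      intro h
      simp only [dominoes, Finset.mem_product, Finset.mem_filter, Finset.mem_singleton] at h
      obtain ⟨⟨h1, h2, h3⟩, rfl⟩ := h
      refine ⟨h1, ?_, h2, h3⟩
      by_contra hc
      rw [head_false] at hc
      rw [ext_of_notMem hc] at h3
      omega
    rw [hext, hext]
    have h1 : e.1 ∉ box n → ext 0 ψ e.1 = 0 := fun h => ext_of_notMem h
    have h2 : head e ∉ box n → ext 0 ψ (head e) = 0 := fun h => ext_of_notMem h
    generalize ext 0 ψ e.1 = a at *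
    generalize ext 0 ψ (head e) = b at *
    unfold wetEdge
    by_cases hA : e.1 ∈ box n <;> by_cases hB : head e ∈ box n <;>
      by_cases hD : e ∈ dominoes ψ ×ˢ {false} <;>
      simp only [hA, hB, hD, if_true, if_false, not_true_eq_false, not_false_eq_true, iff_true,
        iff_false, false_and, and_false, forall_const, true_and] at * <;> grind
  have hsum := Finset.sum_le_sum hpt
  simp only [Finset.sum_add_distrib, ← Finset.mul_sum] at hsum
  have h1 : ∑ e ∈ boxEdges n, (if e ∈ dominoes ψ ×ˢ {false} then (1 : ℤ) else 0) =
      (dominoes ψ).card := by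
    rw [Finset.sum_ite_mem, Finset.inter_eq_right.2]
    · simp
    · intro e he
      exact mem_boxEdges_of_tail (Finset.mem_filter.1 (Finset.mem_product.1 he).1).1
  have h2 : ∑ e ∈ boxEdges n, (if ¬(e.1 ∈ box n ↔ head e ∈ box n) then (1 : ℤ) else 0) ≤
      4 * side n := by
    rw [← Finset.sum_filter]
    have := card_boundary_edges_le n
    simp only [Finset.sum_const, nsmul_eq_mul, mul_one]
    exact_mod_cast this
  rw [h1] at hsum
  unfold wetEnergy
  linarith

theorem tsum_wetWeight_dominoes_ge {β : ℝ} (hβ : 0 ≤ β) {n : ℕ} (d : ℕ) :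
    ∑' ψ : Field n, {ψ | d ≤ (dominoes ψ).card}.indicator (wetWeight β 0) ψ ≤
      ENNReal.ofReal (Real.exp (β * (4 * side n - 2 * d))) * ∑' ψ : Field n, wetWeight β 0 ψ := by
  rw [← ENNReal.tsum_mul_left]
  refine tsum_indicator_le_of_injOn (T := fun ψ => ψ + 1) (add_left_injective _).injOn ?_
  intro ψ hψ
  have hψ : d ≤ (dominoes ψ).card := hψ
  rw [wetWeight, wetWeight, ← ENNReal.ofReal_mul (Real.exp_pos _).le, ← Real.exp_add]
  refine ENNReal.ofReal_le_ofReal (Real.exp_le_exp.2 ?_)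
  have h1 : (wetEnergy 0 (ψ + 1) : ℝ) ≤ wetEnergy 0 ψ + 4 * side n - 2 * (dominoes ψ).card := by
    exact_mod_cast wetEnergy_add_one_le ψ
  have h2 : (d : ℝ) ≤ (dominoes ψ).card := by exact_mod_cast hψ
  nlinarith

/-! ### Creating low dominoes -/

/-- The domino with tail `p` and its six neighbours are all at the same height in `[0, h)`. -/
structure IsFlat {n : ℕ} (h : ℤ) (ψ : Field n) (p : ℤ × ℤ) : Prop where
  left_mem : p ∈ box n
  right_mem : (p.1 + 1, p.2) ∈ box n
  nonneg : 0 ≤ ext 0 ψ p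
  lt : ext 0 ψ p < h
  right : ext 0 ψ (p.1 + 1, p.2) = ext 0 ψ p
  left_left : ext 0 ψ (p.1 - 1, p.2) = ext 0 ψ p
  right_right : ext 0 ψ (p.1 + 2, p.2) = ext 0 ψ p
  left_up : ext 0 ψ (p.1, p.2 + 1) = ext 0 ψ p
  left_down : ext 0 ψ (p.1, p.2 - 1) = ext 0 ψ p
  right_up : ext 0 ψ (p.1 + 1, p.2 + 1) = ext 0 ψ p
  right_down : ext 0 ψ (p.1 + 1, p.2 - 1) = ext 0 ψ p

/-- Put the domino with tail `p` at height `-1`. -/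
def lowerDomino {n : ℕ} (p : ℤ × ℤ) (ψ : Field n) : Field n :=
  fun x => if x.1 = p ∨ x.1 = (p.1 + 1, p.2) then -1 else ψ x

theorem ext_lowerDomino {n : ℕ} {h : ℤ} {ψ : Field n} {p : ℤ × ℤ} (hp : IsFlat h ψ p) (z : ℤ × ℤ) :
    ext 0 (lowerDomino p ψ) z = if z = p ∨ z = (p.1 + 1, p.2) then -1 else ext 0 ψ z := by
  by_cases hz : z ∈ box n
  · rw [ext_of_mem hz, ext_of_mem hz]; rfl
  · rw [ext_of_notMem hz, ext_of_notMem hz, if_neg]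
    rintro (rfl | rfl)
    · exact hz hp.left_mem
    · exact hz hp.right_mem

/-- The erased common height can be read off the site above the tail, which the map leaves alone. -/
theorem lowerDomino_injOn {n : ℕ} (h : ℤ) (p : ℤ × ℤ) :
    Set.InjOn (lowerDomino (n := n) p) {ψ | IsFlat h ψ p} := by
  intro ψ hψ ψ' hψ' heq
  have hψ : IsFlat h ψ p := hψ
  have hψ' : IsFlat h ψ' p := hψ'
  have hz : ∀ z, ¬(z = p ∨ z = (p.1 + 1, p.2)) → ext 0 ψ z = ext 0 ψ' z := by
    intro z hz
    have h1 := ext_lowerDomino hψ z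
    have h2 := ext_lowerDomino hψ' z
    rw [if_neg hz] at h1 h2
    rw [← h1, ← h2, heq]
  have hp : ext 0 ψ p = ext 0 ψ' p := by
    rw [← hψ.left_up, ← hψ'.left_up]
    exact hz _ (by simp [Prod.ext_iff])
  refine ext_injective 0 (funext fun z => ?_)
  by_cases h1 : z = p ∨ z = (p.1 + 1, p.2)
  · rcases h1 with rfl | rfl
    · exact hp
    · rw [hψ.right, hψ'.right, hp]
  · exact hz z h1

/-- The six edges leaving the domino go from energy `0` to at most `h`, since the former height is
at most `h - 1`. The inner edge, now between two sites at `-1`, costs `2`. -/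
theorem wetEnergy_lowerDomino_le {n : ℕ} {h : ℤ} {ψ : Field n} {p : ℤ × ℤ} (hp : IsFlat h ψ p) :
    wetEnergy 0 (lowerDomino p ψ) ≤ wetEnergy 0 ψ + (6 * h + 2) := by
  classical
  let K : Finset Edge := {((p.1 - 1, p.2), false), ((p.1 + 1, p.2), false), (p, true),
    ((p.1, p.2 - 1), true), ((p.1 + 1, p.2), true), ((p.1 + 1, p.2 - 1), true)}
  have hh : 0 ≤ h := hp.nonneg.trans hp.lt.le
  have hpt : ∀ e ∈ boxEdges n, wetEdge (ext 0 (lowerDomino p ψ) e.1)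
      (ext 0 (lowerDomino p ψ) (head e)) ≤ wetEdge (ext 0 ψ e.1) (ext 0 ψ (head e)) +
        ((if e ∈ K then h else 0) + if e = (p, false) then 2 else 0) := by
    intro e _
    obtain ⟨hm1, hm2, hn, hl, h1, h2, h3, h4, h5, h6, h7⟩ := hp
    have hp : IsFlat h ψ p := ⟨hm1, hm2, hn, hl, h1, h2, h3, h4, h5, h6, h7⟩
    obtain ⟨x, y⟩ := p
    simp only at h1 h2 h3 h4 h5 h6 h7
    have hone : wetEdge (-1) (ext 0 ψ (x, y)) ≤ h := by
      unfold wetEdge; rw [abs_eq_max_neg]; omega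
    have hone' : wetEdge (ext 0 ψ (x, y)) (-1) ≤ h := by
      unfold wetEdge; rw [abs_eq_max_neg]; omega
    have hzero : wetEdge (ext 0 ψ (x, y)) (ext 0 ψ (x, y)) = 0 := by
      unfold wetEdge; rw [abs_eq_max_neg]; omega
    have htwo : wetEdge (-1) (-1) = 2 := rfl
    have e3 : x + 1 + 1 = x + 2 := by ring
    have f0 : ext 0 (lowerDomino (x, y) ψ) (x, y) = -1 := by simp [ext_lowerDomino hp]
    have f1 : ext 0 (lowerDomino (x, y) ψ) (x + 1, y) = -1 := by simp [ext_lowerDomino hp]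
    have f2 : ext 0 (lowerDomino (x, y) ψ) (x - 1, y) = ext 0 ψ (x, y) := by
      rw [ext_lowerDomino hp, if_neg, h2]; simp; omega
    have f3 : ext 0 (lowerDomino (x, y) ψ) (x + 2, y) = ext 0 ψ (x, y) := by
      rw [ext_lowerDomino hp, if_neg, h3]; simp
    have f4 : ext 0 (lowerDomino (x, y) ψ) (x, y + 1) = ext 0 ψ (x, y) := by
      rw [ext_lowerDomino hp, if_neg, h4]; simp
    have f5 : ext 0 (lowerDomino (x, y) ψ) (x, y - 1) = ext 0 ψ (x, y) := by
      rw [ext_lowerDomino hp, if_neg, h5]; simp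
    have f6 : ext 0 (lowerDomino (x, y) ψ) (x + 1, y + 1) = ext 0 ψ (x, y) := by
      rw [ext_lowerDomino hp, if_neg, h6]; simp
    have f7 : ext 0 (lowerDomino (x, y) ψ) (x + 1, y - 1) = ext 0 ψ (x, y) := by
      rw [ext_lowerDomino hp, if_neg, h7]; simp
    by_cases hK : e ∈ K
    · have hpos : 0 ≤ if e = ((x, y), false) then (2 : ℤ) else 0 := by split_ifs <;> norm_num
      have hpos' := wetEdge_nonneg (ext 0 ψ e.1) (ext 0 ψ (head e))
      rw [if_pos hK]
      suffices wetEdge (ext 0 (lowerDomino (x, y) ψ) e.1)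
          (ext 0 (lowerDomino (x, y) ψ) (head e)) ≤ h by linarith
      clear hpos hpos'
      simp only [K, Finset.mem_insert, Finset.mem_singleton] at hK
      rcases hK with rfl | rfl | rfl | rfl | rfl | rfl
      · rw [head_false]; simp only [sub_add_cancel, f0, f2]; exact hone'
      · rw [head_false]; simp only [e3, f1, f3]; exact hone
      · rw [head_true]; simp only [f0, f4]; exact hone
      · rw [head_true]; simp only [sub_add_cancel, f0, f5]; exact hone'
      · rw [head_true]; simp only [f1, f6]; exact hone
      · rw [head_true]; simp only [sub_add_cancel, f1, f7]; exact hone'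
    · by_cases he : e = ((x, y), false)
      · subst he
        rw [if_neg hK, if_pos rfl, head_false]
        simp only [f0, f1, h1, hzero, htwo]
        norm_num
      · rw [if_neg hK, if_neg he, ext_lowerDomino hp, ext_lowerDomino hp, if_neg, if_neg]
        · simp
        · obtain ⟨⟨a, b⟩, d⟩ := e
          simp only [K, Finset.mem_insert, Finset.mem_singleton, Prod.mk.injEq] at hK he
          cases d <;> simp at hK he ⊢ <;> omega
        · obtain ⟨⟨a, b⟩, d⟩ := e
          simp only [K, Finset.mem_insert, Finset.mem_singleton, Prod.mk.injEq] at hK he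
          cases d <;> simp at hK he ⊢ <;> omega
  have hsum := Finset.sum_le_sum hpt
  simp only [Finset.sum_add_distrib] at hsum
  have hK6 : K.card ≤ 6 := Finset.card_le_six
  have s1 : ∑ e ∈ boxEdges n, (if e ∈ K then h else 0) ≤ 6 * h := by
    rw [← Finset.sum_filter, Finset.sum_const, nsmul_eq_mul]
    refine mul_le_mul_of_nonneg_right ?_ hh
    have : ((boxEdges n).filter fun e => e ∈ K).card ≤ K.card :=
      Finset.card_le_card fun e he => (Finset.mem_filter.1 he).2
    exact_mod_cast this.trans hK6
  have s2 : ∑ e ∈ boxEdges n, (if e = (p, false) then (2 : ℤ) else 0) ≤ 2 := by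
    rw [Finset.sum_ite_eq']
    split_ifs <;> omega
  unfold wetEnergy
  linarith

/-- The sites to the left and right of the domino have nonnegative height, so no overlapping
horizontal domino becomes low. -/
theorem dominoes_lowerDomino {n : ℕ} {h : ℤ} {ψ : Field n} {p : ℤ × ℤ} (hp : IsFlat h ψ p) :
    dominoes (lowerDomino p ψ) = insert p (dominoes ψ) := by
  classical
  ext r
  simp only [dominoes, Finset.mem_filter, Finset.mem_insert, ext_lowerDomino hp]
  obtain ⟨hm1, hm2, hn, hl, h1, h2, h3, h4, h5, h6, h7⟩ := hp
  obtain ⟨x, y⟩ := p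
  obtain ⟨a, b⟩ := r
  simp only [Prod.mk.injEq] at *
  by_cases hy : b = y
  · subst hy
    by_cases ha : a = x
    · subst ha; simp [hm1]
    · by_cases ha1 : a = x + 1
      · subst ha1
        have : x + 1 + 1 = x + 2 := by ring
        have h8 : ¬ (ext 0 ψ (x + 2, b) ≤ -1) := by omega
        simp [this, h8]
      · by_cases ha2 : a = x - 1
        · subst ha2
          have h8 : ¬ (ext 0 ψ (x - 1, b) ≤ -1) := by omega
          simp only [ha, ha1, h8, if_false, false_and, and_false, or_false, and_true]
        · have : a + 1 ≠ x := by omega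
          simp [ha, ha1, this]
  · simp [hy]

theorem card_dominoes_lowerDomino {n : ℕ} {h : ℤ} {ψ : Field n} {p : ℤ × ℤ} (hp : IsFlat h ψ p) :
    (dominoes (lowerDomino p ψ)).card = (dominoes ψ).card + 1 := by
  rw [dominoes_lowerDomino hp, Finset.card_insert_of_notMem]
  intro h
  have := (Finset.mem_filter.1 h).2.1
  have := hp.nonneg
  omega

/-! ### Abundance of flat dominoes and the entropy gained by lowering them. -/

/-- The number of sites below height `h`. -/
noncomputable def lowCount {n : ℕ} (h : ℤ) (ψ : Field n) : ℕ :=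
  ((box n).filter fun p => ext 0 ψ p < h).card

theorem lowCount_le_lowerDomino {n : ℕ} {h : ℤ} {ψ : Field n} {p : ℤ × ℤ} (hp : IsFlat h ψ p) :
    lowCount h ψ ≤ lowCount h (lowerDomino p ψ) := by
  refine Finset.card_le_card fun q hq => ?_
  rw [Finset.mem_filter] at hq ⊢
  refine ⟨hq.1, ?_⟩
  rw [ext_lowerDomino hp]
  have := hp.nonneg
  have := hp.lt
  split_ifs
  · omega
  · exact hq.2

theorem card_nonzero_edges_le {n : ℕ} (ψ : Field n) (v : ℤ × ℤ) (d : Bool) :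
    (((box n).filter fun p => (((p + v, d) : Edge) ∈ boxEdges n ∧
      wetEdge (ext 0 ψ (p + v)) (ext 0 ψ (head (p + v, d))) ≠ 0)).card : ℤ) ≤ wetEnergy 0 ψ := by
  classical
  rw [Finset.card_eq_sum_ones]
  have hinj : Function.Injective fun p : ℤ × ℤ => ((p + v, d) : Edge) := fun a b h => by
    simpa using h
  calc _ ≤ ∑ p ∈ (box n).filter fun p => (((p + v, d) : Edge) ∈ boxEdges n ∧
      wetEdge (ext 0 ψ (p + v)) (ext 0 ψ (head (p + v, d))) ≠ 0),
        wetEdge (ext 0 ψ (p + v)) (ext 0 ψ (head (p + v, d))) := by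
        push_cast
        refine Finset.sum_le_sum fun p hp => ?_
        have h1 := (Finset.mem_filter.1 hp).2.2
        have h2 := wetEdge_nonneg (ext 0 ψ (p + v)) (ext 0 ψ (head (p + v, d)))
        omega
    _ = ∑ e ∈ ((box n).filter fun p => (((p + v, d) : Edge) ∈ boxEdges n ∧
      wetEdge (ext 0 ψ (p + v)) (ext 0 ψ (head (p + v, d))) ≠ 0)).map ⟨_, hinj⟩,
        wetEdge (ext 0 ψ e.1) (ext 0 ψ (head e)) := by
        rw [Finset.sum_map]; rfl
    _ ≤ _ := by
        refine Finset.sum_le_sum_of_subset_of_nonneg (fun e he => ?_) fun _ _ _ =>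
          wetEdge_nonneg _ _
        obtain ⟨p, hp, rfl⟩ := Finset.mem_map.1 he
        exact (Finset.mem_filter.1 hp).2.1

open Classical in
/-- The tails of the flat dominoes below height `h`. -/
noncomputable def flats {n : ℕ} (h : ℤ) (ψ : Field n) : Finset (ℤ × ℤ) :=
  (box n).filter (IsFlat h ψ)

theorem wetEdge_eq_zero {a b : ℤ} (h : wetEdge a b = 0) : a = b ∧ 0 ≤ a := by
  unfold wetEdge at h; grind

/-- An edge of zero energy joins equal nonnegative heights. A low site off the last column is thus
the tail of a flat domino unless one of the seven edges touching that domino has positive energy,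
and for each of the seven relative positions an edge is charged by one site only. -/
theorem lowCount_le_card_flats {n : ℕ} (h : ℤ) (ψ : Field n) :
    (lowCount h ψ : ℤ) ≤ (flats h ψ).card + side n + 7 * wetEnergy 0 ψ := by
  classical
  let X : (ℤ × ℤ) → Bool → Finset (ℤ × ℤ) := fun v d =>
    (box n).filter fun p => (((p + v, d) : Edge) ∈ boxEdges n ∧
      wetEdge (ext 0 ψ (p + v)) (ext 0 ψ (head (p + v, d))) ≠ 0)
  have hX : ∀ v d, ((X v d).card : ℤ) ≤ wetEnergy 0 ψ := fun v d => card_nonzero_edges_le ψ v d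
  let L : Finset (ℤ × ℤ) := {((n / 2 : ℕ) : ℤ)} ×ˢ
    Finset.Icc (-((n / 2 : ℕ) : ℤ)) ((n / 2 : ℕ) : ℤ)
  have hL : L.card = side n := by
    simp only [L, Finset.card_product, Finset.card_singleton, Int.card_Icc, side]; omega
  have hsub : ((box n).filter fun p => ext 0 ψ p < h) ⊆ flats h ψ ∪ (L ∪ (X (0, 0) false ∪
      (X (-1, 0) false ∪ (X (1, 0) false ∪ (X (0, 0) true ∪ (X (0, -1) true ∪
        (X (1, 0) true ∪ X (1, -1) true))))))) := by
    intro p hp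
    obtain ⟨hp, hlow⟩ := Finset.mem_filter.1 hp
    by_contra hcon
    simp only [Finset.mem_union, not_or] at hcon
    obtain ⟨c0, c1, c2, c3, c4, c5, c6, c7, c8⟩ := hcon
    have hq : (p.1 + 1, p.2) ∈ box n := by
      simp only [L, Finset.mem_product, Finset.mem_singleton, Finset.mem_Icc] at c1
      rw [mem_box] at hp ⊢
      simp only
      omega
    have key : ∀ v d, p ∉ X v d → ((p + v, d) : Edge) ∈ boxEdges n →
        ext 0 ψ (p + v) = ext 0 ψ (head (p + v, d)) ∧ 0 ≤ ext 0 ψ (p + v) := by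
      intro v d h1 h2
      by_contra h3
      exact h1 (Finset.mem_filter.2 ⟨hp, h2, fun h4 => h3 (wetEdge_eq_zero h4)⟩)
    have k2 := key _ _ c2 (mem_boxEdges_of_tail (by simpa [Prod.add_def] using hp))
    have k3 := key _ _ c3 (mem_boxEdges_of_head (by simpa using hp))
    have k4 := key _ _ c4 (mem_boxEdges_of_tail (by simpa [Prod.add_def] using hq))
    have k5 := key _ _ c5 (mem_boxEdges_of_tail (by simpa [Prod.add_def] using hp))
    have k6 := key _ _ c6 (mem_boxEdges_of_head (by simpa using hp))
    have k7 := key _ _ c7 (mem_boxEdges_of_tail (by simpa [Prod.add_def] using hq))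
    have k8 := key _ _ c8 (mem_boxEdges_of_head (by simpa using hq))
    obtain ⟨x, y⟩ := p
    simp only [Prod.mk_add_mk, head_true, head_false, add_zero, ← sub_eq_add_neg, sub_add_cancel,
      add_assoc, one_add_one_eq_two] at k2 k3 k4 k5 k6 k7 k8
    refine c0 (Finset.mem_filter.2 ⟨hp, ⟨hp, hq, k2.2, hlow, k2.1.symm, k3.1, ?_, k5.1.symm, k6.1,
      ?_, ?_⟩⟩)
    · exact k4.1.symm.trans k2.1.symm
    · exact k7.1.symm.trans k2.1.symm
    · exact k8.1.trans k2.1.symm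
  have hcard := (Finset.card_le_card hsub).trans (Finset.card_union_le _ _)
  have u1 := Finset.card_union_le L (X (0, 0) false ∪
      (X (-1, 0) false ∪ (X (1, 0) false ∪ (X (0, 0) true ∪ (X (0, -1) true ∪
        (X (1, 0) true ∪ X (1, -1) true))))))
  have u2 := Finset.card_union_le (X (0, 0) false)
      (X (-1, 0) false ∪ (X (1, 0) false ∪ (X (0, 0) true ∪ (X (0, -1) true ∪
        (X (1, 0) true ∪ X (1, -1) true)))))
  have u3 := Finset.card_union_le (X (-1, 0) false) (X (1, 0) false ∪ (X (0, 0) true ∪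
    (X (0, -1) true ∪ (X (1, 0) true ∪ X (1, -1) true))))
  have u4 := Finset.card_union_le (X (1, 0) false) (X (0, 0) true ∪ (X (0, -1) true ∪
    (X (1, 0) true ∪ X (1, -1) true)))
  have u5 := Finset.card_union_le (X (0, 0) true) (X (0, -1) true ∪
    (X (1, 0) true ∪ X (1, -1) true))
  have u6 := Finset.card_union_le (X (0, -1) true) (X (1, 0) true ∪ X (1, -1) true)
  have u7 := Finset.card_union_le (X (1, 0) true) (X (1, -1) true)
  have w1 := hX (0, 0) false
  have w2 := hX (-1, 0) false
  have w3 := hX (1, 0) false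
  have w4 := hX (0, 0) true
  have w5 := hX (0, -1) true
  have w6 := hX (1, 0) true
  have w7 := hX (1, -1) true
  unfold lowCount
  omega

/-- Low fields with `d` low dominoes, of energy controlled in terms of `d`. -/
def lowFields (n : ℕ) (h : ℤ) (A s : ℝ) (d : ℕ) : Set (Field n) :=
  {ψ | A ≤ lowCount h ψ ∧ (dominoes ψ).card = d ∧ (wetEnergy 0 ψ : ℝ) ≤ s + d * (6 * h + 2)}

/-- Double counting of pairs of a field and a flat domino. Each field with `d` low dominoes offers
at least `K` choices; a field with `d + 1` is reached at most once through each of its dominoes. The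
energy allowance in `lowFields` grows with `d` precisely so that the lowering map respects it. -/
theorem lowFields_step {β : ℝ} (hβ : 0 ≤ β) {n : ℕ} {h : ℤ} {A s : ℝ} {d K : ℕ}
    (hK : ∀ ψ ∈ lowFields n h A s d, K ≤ (flats h ψ).card) :
    (K * ENNReal.ofReal (Real.exp (-β * (6 * h + 2)))) *
        ∑' ψ, (lowFields n h A s d).indicator (wetWeight β 0) ψ ≤
      ((d + 1 : ℕ) : ℝ≥0∞) * ∑' ψ, (lowFields n h A s (d + 1)).indicator (wetWeight β 0) ψ := by
  classical
  set ρ : ℝ≥0∞ := ENNReal.ofReal (Real.exp (-β * (6 * h + 2))) with hρ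
  have step : ∀ p ∈ box n, ∑' ψ, ({ψ | IsFlat h ψ p} ∩ lowFields n h A s d).indicator
      (fun ψ => ρ * wetWeight β 0 ψ) ψ ≤ ∑' ψ : Field n, if p ∈ dominoes ψ then
        (lowFields n h A s (d + 1)).indicator (wetWeight β 0) ψ else 0 := by
    intro p _
    refine tsum_indicator_le_of_injOn (T := lowerDomino p)
      ((lowerDomino_injOn h p).mono Set.inter_subset_left) ?_
    rintro ψ ⟨hp, h1, h2, h3⟩
    have hp : IsFlat h ψ p := hp
    have hen : (wetEnergy 0 (lowerDomino p ψ) : ℝ) ≤ wetEnergy 0 ψ + (6 * h + 2) := by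
      exact_mod_cast wetEnergy_lowerDomino_le hp
    have hmem : lowerDomino p ψ ∈ lowFields n h A s (d + 1) := by
      refine ⟨h1.trans (by exact_mod_cast lowCount_le_lowerDomino hp), ?_, ?_⟩
      · rw [card_dominoes_lowerDomino hp, h2]
      · push_cast; linarith
    rw [if_pos (by rw [dominoes_lowerDomino hp]; exact Finset.mem_insert_self _ _),
      Set.indicator_of_mem hmem, hρ, wetWeight, wetWeight,
      ← ENNReal.ofReal_mul (Real.exp_pos _).le, ← Real.exp_add]
    refine ENNReal.ofReal_le_ofReal (Real.exp_le_exp.2 ?_)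
    nlinarith
  calc (K * ρ) * ∑' ψ, (lowFields n h A s d).indicator (wetWeight β 0) ψ
      ≤ ∑' ψ, ∑ p ∈ box n, ({ψ | IsFlat h ψ p} ∩ lowFields n h A s d).indicator
        (fun ψ => ρ * wetWeight β 0 ψ) ψ := by
        rw [← ENNReal.tsum_mul_left]
        refine ENNReal.tsum_le_tsum fun ψ => ?_
        by_cases hψ : ψ ∈ lowFields n h A s d
        · have : ∀ p ∈ box n, ({ψ | IsFlat h ψ p} ∩ lowFields n h A s d).indicator
              (fun ψ => ρ * wetWeight β 0 ψ) ψ =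
                if IsFlat h ψ p then ρ * wetWeight β 0 ψ else 0 := by
            intro p _
            simp [Set.indicator_apply, hψ]
          rw [Finset.sum_congr rfl this, ← Finset.sum_filter, Finset.sum_const, nsmul_eq_mul,
            Set.indicator_of_mem hψ, mul_assoc]
          gcongr
          have := hK ψ hψ
          unfold flats at this
          convert this
        · rw [Set.indicator_of_notMem hψ, mul_zero]; exact bot_le
    _ = ∑ p ∈ box n, ∑' ψ, ({ψ | IsFlat h ψ p} ∩ lowFields n h A s d).indicator
        (fun ψ => ρ * wetWeight β 0 ψ) ψ := Summable.tsum_finsetSum fun _ _ => ENNReal.summable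
    _ ≤ ∑ p ∈ box n, ∑' ψ : Field n, (if p ∈ dominoes ψ then
        (lowFields n h A s (d + 1)).indicator (wetWeight β 0) ψ else 0) :=
        Finset.sum_le_sum step
    _ = ∑' ψ : Field n, ∑ p ∈ box n, (if p ∈ dominoes ψ then
        (lowFields n h A s (d + 1)).indicator (wetWeight β 0) ψ else 0) :=
        (Summable.tsum_finsetSum fun _ _ => ENNReal.summable).symm
    _ = _ := by
        rw [← ENNReal.tsum_mul_left]
        refine tsum_congr fun ψ => ?_
        have hsub : dominoes ψ ⊆ box n := Finset.filter_subset _ _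
        rw [Finset.sum_ite_mem, Finset.inter_eq_right.2 hsub, Finset.sum_const, nsmul_eq_mul]
        by_cases hψ : ψ ∈ lowFields n h A s (d + 1)
        · rw [hψ.2.1]
        · rw [Set.indicator_of_notMem hψ, mul_zero, mul_zero]

/-! ### Low sites are rare -/

/-- Below `4n` dominoes the ratio of consecutive masses is at least `8n / 4n = 2`; from `d ≤ 3n`
there is room for `n` doublings. -/
theorem two_pow_mul_tsum_lowFields_le {β : ℝ} (hβ : 0 ≤ β) {n : ℕ} (hn : 1 ≤ n) {h : ℤ} {A s : ℝ}
    {K : ℕ} (hK : ∀ d < 4 * n, ∀ ψ ∈ lowFields n h A s d, K ≤ (flats h ψ).card)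
    (hKn : 8 * (n : ℝ) ≤ K * Real.exp (-β * (6 * h + 2))) {d : ℕ} (hd : d ≤ 3 * n) :
    2 ^ n * ∑' ψ, (lowFields n h A s d).indicator (wetWeight β 0) ψ ≤
      ∑' ψ : Field n, wetWeight β 0 ψ := by
  set W : ℕ → ℝ≥0∞ := fun d => ∑' ψ, (lowFields n h A s d).indicator (wetWeight β 0) ψ with hW
  have hstep : ∀ d < 4 * n, 2 * W d ≤ W (d + 1) := by
    intro d hd
    have h1 := lowFields_step hβ (hK d hd)
    have h2 : ((8 * n : ℕ) : ℝ≥0∞) ≤ K * ENNReal.ofReal (Real.exp (-β * (6 * h + 2))) := by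
      rw [← ENNReal.ofReal_natCast, ← ENNReal.ofReal_natCast,
        ← ENNReal.ofReal_mul (Nat.cast_nonneg _)]
      exact ENNReal.ofReal_le_ofReal (by push_cast; exact hKn)
    have h3 : ((d + 1 : ℕ) : ℝ≥0∞) ≤ ((4 * n : ℕ) : ℝ≥0∞) := by exact_mod_cast hd
    have h4 : ((4 * n : ℕ) : ℝ≥0∞) * (2 * W d) ≤ ((4 * n : ℕ) : ℝ≥0∞) * W (d + 1) := by
      calc ((4 * n : ℕ) : ℝ≥0∞) * (2 * W d) = ((8 * n : ℕ) : ℝ≥0∞) * W d := by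
            push_cast; ring
        _ ≤ _ := mul_le_mul_left h2 _
        _ ≤ _ := h1
        _ ≤ _ := mul_le_mul_left h3 _
    exact (ENNReal.mul_le_mul_iff_right (by simp; omega) (ENNReal.natCast_ne_top _)).1 h4
  have hiter : ∀ k, d + k ≤ 4 * n → 2 ^ k * W d ≤ W (d + k) := by
    intro k
    induction k with
    | zero => intro _; simp
    | succ k ih =>
      intro hk
      calc 2 ^ (k + 1) * W d = 2 * (2 ^ k * W d) := by ring
        _ ≤ 2 * W (d + k) := by gcongr; exact ih (by omega)
        _ ≤ _ := hstep _ (by omega)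
  refine (hiter n (by omega)).trans (ENNReal.tsum_le_tsum fun ψ => ?_)
  exact Set.indicator_le_self _ _ _

theorem tsum_indicator_biUnion_le {α ι : Type*} (w : α → ℝ≥0∞) (s : Finset ι) (A : ι → Set α) :
    ∑' a, (⋃ i ∈ s, A i).indicator w a ≤ ∑ i ∈ s, ∑' a, (A i).indicator w a := by
  rw [← Summable.tsum_finsetSum fun _ _ => ENNReal.summable]
  refine ENNReal.tsum_le_tsum fun a => ?_
  by_cases h : a ∈ ⋃ i ∈ s, A i
  · obtain ⟨i, hi, ha⟩ := Set.mem_iUnion₂.1 h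
    rw [Set.indicator_of_mem h]
    calc w a = (A i).indicator w a := (Set.indicator_of_mem ha _).symm
      _ ≤ _ := Finset.single_le_sum (f := fun i => (A i).indicator w a) (fun _ _ => bot_le) hi
  · rw [Set.indicator_of_notMem h]; exact bot_le

theorem tsum_indicator_union_le {α : Type*} (w : α → ℝ≥0∞) (A B : Set α) :
    ∑' a, (A ∪ B).indicator w a ≤ ∑' a, A.indicator w a + ∑' a, B.indicator w a := by
  rw [← ENNReal.tsum_add]
  refine ENNReal.tsum_le_tsum fun a => ?_
  by_cases hA : a ∈ A <;> by_cases hB : a ∈ B <;> simp [hA, hB]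

theorem tsum_indicator_mono {α : Type*} (w : α → ℝ≥0∞) {A B : Set α} (h : A ⊆ B) :
    ∑' a, A.indicator w a ≤ ∑' a, B.indicator w a :=
  ENNReal.tsum_le_tsum fun a => Set.indicator_le_indicator_of_subset h (fun _ => bot_le) a

theorem tsum_lowCount_ge_le {β : ℝ} (hβ : 4 ≤ β) {n : ℕ} (hn : 1 ≤ n) {h : ℤ} {A s r : ℝ}
    (hr : 0 ≤ r) (hhr : 6 * (h : ℝ) + 2 ≤ r) {K : ℕ}
    (hKA : (K : ℝ) ≤ A - side n - 7 * (s + 4 * n * r))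
    (hKn : 8 * (n : ℝ) ≤ K * Real.exp (-β * (6 * h + 2))) :
    ∑' ψ : Field n, {ψ | A ≤ lowCount h ψ}.indicator (wetWeight β 0) ψ ≤
      (ENNReal.ofReal (Real.exp (-(β / 2) * s)) * 2 ^ (box n).card +
        ENNReal.ofReal (Real.exp (β * (4 * side n - 6 * n))) + 3 * n * 2⁻¹ ^ n) *
        ∑' ψ : Field n, wetWeight β 0 ψ := by
  set Z := ∑' ψ : Field n, wetWeight β 0 ψ with hZ
  have hsub : {ψ : Field n | A ≤ lowCount h ψ} ⊆ ({ψ | s ≤ (wetEnergy 0 ψ : ℝ)} ∪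
      {ψ | 3 * n ≤ (dominoes ψ).card}) ∪ ⋃ d ∈ Finset.range (3 * n), lowFields n h A s d := by
    intro ψ hψ
    by_cases h1 : s ≤ (wetEnergy 0 ψ : ℝ)
    · exact Or.inl (Or.inl h1)
    by_cases h2 : 3 * n ≤ (dominoes ψ).card
    · exact Or.inl (Or.inr h2)
    by_cases hh : 0 ≤ 6 * (h : ℝ) + 2
    · refine Or.inr (Set.mem_iUnion₂.2 ⟨(dominoes ψ).card, by simpa using h2, hψ, rfl, ?_⟩)
      push Not at h1
      have : 0 ≤ ((dominoes ψ).card : ℝ) * (6 * h + 2) := by positivity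
      linarith
    -- If `6h + 2 < 0`, no height lies in `[0, h)`, so there are no flat dominoes and the low count
    -- is below `A`.
    · exfalso
      have hh' : 6 * h + 2 < 0 := by push Not at hh; exact_mod_cast hh
      have h3 := lowCount_le_card_flats h ψ
      have h4 : flats h ψ = ∅ := by
        classical
        refine Finset.filter_eq_empty_iff.2 fun p _ hp => ?_
        have := hp.nonneg
        have := hp.lt
        omega
      rw [h4] at h3
      have h5 : (lowCount h ψ : ℝ) ≤ side n + 7 * wetEnergy 0 ψ := by
        have h3 : (lowCount h ψ : ℤ) ≤ side n + 7 * wetEnergy 0 ψ := by simpa using h3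
        exact_mod_cast h3
      have hψ : A ≤ lowCount h ψ := hψ
      have h6 : 0 ≤ (n : ℝ) * r := by positivity
      have h7 : (0 : ℝ) ≤ K := Nat.cast_nonneg _
      push Not at h1
      linarith
  refine (tsum_indicator_mono _ hsub).trans ((tsum_indicator_union_le _ _ _).trans ?_)
  rw [add_mul, add_mul]
  refine add_le_add ((tsum_indicator_union_le _ _ _).trans (add_le_add ?_ ?_)) ?_
  · refine (tsum_wetWeight_energy_ge hβ s).trans ?_
    exact le_mul_of_one_le_right' (one_le_tsum_wetWeight β n)
  · refine (tsum_wetWeight_dominoes_ge (by linarith) (3 * n)).trans (le_of_eq ?_)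
    congr 3
    push_cast
    ring
  · refine (tsum_indicator_biUnion_le _ _ _).trans ?_
    have hK : ∀ d < 4 * n, ∀ ψ ∈ lowFields n h A s d, K ≤ (flats h ψ).card := by
      rintro d hd ψ ⟨h1, -, h2⟩
      have h3 : (lowCount h ψ : ℝ) ≤ (flats h ψ).card + side n + 7 * wetEnergy 0 ψ := by
        exact_mod_cast lowCount_le_card_flats h ψ
      have h4 : (d : ℝ) ≤ 4 * n := by exact_mod_cast hd.le
      have h5 : (d : ℝ) * (6 * h + 2) ≤ 4 * n * r :=
        (mul_le_mul_of_nonneg_left hhr (Nat.cast_nonneg d)).trans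
          (mul_le_mul_of_nonneg_right h4 hr)
      have h6 : (K : ℝ) ≤ (flats h ψ).card := by linarith
      exact_mod_cast h6
    have hone : ∀ d ∈ Finset.range (3 * n),
        ∑' ψ, (lowFields n h A s d).indicator (wetWeight β 0) ψ ≤ 2⁻¹ ^ n * Z := by
      intro d hd
      have h1 := two_pow_mul_tsum_lowFields_le (by linarith : 0 ≤ β) hn hK hKn
        (Finset.mem_range.1 hd).le
      calc _ = 2⁻¹ ^ n * (2 ^ n * ∑' ψ, (lowFields n h A s d).indicator (wetWeight β 0) ψ) := by
            rw [← mul_assoc, ← mul_pow, ENNReal.inv_mul_cancel (by simp) (by simp), one_pow,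
              one_mul]
        _ ≤ _ := by gcongr
    refine (Finset.sum_le_sum hone).trans (le_of_eq ?_)
    rw [Finset.sum_const, Finset.card_range, nsmul_eq_mul]
    push_cast
    ring

theorem side_le (n : ℕ) : side n ≤ n + 1 := by unfold side; omega

theorem typicalHeight_le {β : ℝ} (hβ : 0 < β) (n : ℕ) :
    6 * β * typicalHeight β n ≤ Real.log n + 2 * β := by
  have h : (typicalHeight β n : ℝ) ≤ 1 / (6 * β) * Real.log n + 1 / 3 := Int.floor_le _
  calc 6 * β * typicalHeight β n ≤ 6 * β * (1 / (6 * β) * Real.log n + 1 / 3) := by gcongr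
    _ = _ := by field_simp; ring

theorem lt_typicalHeight {β : ℝ} (hβ : 0 < β) (n : ℕ) :
    Real.log n - 4 * β < 6 * β * typicalHeight β n := by
  have h : 1 / (6 * β) * Real.log n + 1 / 3 < typicalHeight β n + 1 := Int.lt_floor_add_one _
  have h2 : 6 * β * (1 / (6 * β) * Real.log n + 1 / 3) < 6 * β * (typicalHeight β n + 1) := by
    gcongr
  have h3 : 6 * β * (1 / (6 * β) * Real.log n + 1 / 3) = Real.log n + 2 * β := by
    field_simp; ring
  linarith

theorem eventually_tsum_lowCount_le {β : ℝ} (hβ : 4 ≤ β) :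
    ∀ᶠ n : ℕ in atTop, ∑' ψ : Field n,
      {ψ | 300 / β * (n : ℝ) ^ 2 ≤ lowCount (typicalHeight β n - 1) ψ}.indicator
        (wetWeight β 0) ψ ≤
      ENNReal.ofReal (2 * Real.exp (-n) + 3 * (n * (1 / 2) ^ n)) *
        ∑' ψ : Field n, wetWeight β 0 ψ := by
  filter_upwards [eventually_ge_atTop ⌈2 * β⌉₊, eventually_ge_atTop 8] with n hn hn8
  have hβ0 : 0 < β := by linarith
  have hnβ : 2 * β ≤ n := Nat.ceil_le.1 hn
  have hn1 : (8 : ℝ) ≤ n := by exact_mod_cast hn8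
  have hn0 : (0 : ℝ) < n := by linarith
  have hlog0 : 0 ≤ Real.log n := Real.log_nonneg (by linarith)
  have hlog : Real.log n ≤ n := (Real.log_le_sub_one_of_pos hn0).trans (by linarith)
  have hup := typicalHeight_le hβ0 n
  have hside : (side n : ℝ) ≤ n + 1 := by exact_mod_cast side_le n
  have hfl := Nat.lt_floor_add_one (100 * (n : ℝ) ^ 2 / β)
  have hfl2 := Nat.floor_le (show 0 ≤ 100 * (n : ℝ) ^ 2 / β by positivity)
  have hnn : 2 * (n : ℝ) ≤ n ^ 2 / β := by
    rw [le_div_iff₀ hβ0]; nlinarith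
  have e1 : 100 * (n : ℝ) ^ 2 / β = 100 * (n ^ 2 / β) := by ring
  have e2 : 300 / β * (n : ℝ) ^ 2 = 300 * (n ^ 2 / β) := by ring
  have e3 : 8 / β * (n : ℝ) ^ 2 = 8 * (n ^ 2 / β) := by ring
  -- With `s = 8n²/β` the factor `e^{-βs/2} = e^{-4n²}` beats `2 ^ (box n).card ≤ e^{2n²}`. Of the
  -- `300 n²/β` low sites, `7s` uses `56` units of `n²/β`, the dominoes at most `28`, and the last
  -- column is absorbed as `n ≥ 2β`, which leaves `100` for `K`.
  refine (tsum_lowCount_ge_le (r := Real.log n / β) (s := 8 / β * (n : ℝ) ^ 2)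
    (K := ⌊100 * (n : ℝ) ^ 2 / β⌋₊) hβ (by omega) (by positivity) ?_ ?_ ?_).trans ?_
  · rw [le_div_iff₀ hβ0]
    push_cast
    nlinarith
  · have h1 : (n : ℝ) * (Real.log n / β) ≤ n ^ 2 / β := by
      rw [← mul_div_assoc, sq]
      gcongr
    rw [e2, e3]
    rw [e1] at hfl2
    rw [e1]
    nlinarith
  -- Here the height `h_n^* - 1` enters: `6β(h_n^* - 1) ≤ log n - 4β`, of which the energy `2`
  -- inside the domino takes back `2β`.
  · have h1 : Real.exp (2 * β) / n ≤
        Real.exp (-β * (6 * ((typicalHeight β n - 1 : ℤ) : ℝ) + 2)) := by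
      have : Real.exp (2 * β) / n = Real.exp (2 * β - Real.log n) := by
        rw [Real.exp_sub, Real.exp_log hn0]
      rw [this]
      refine Real.exp_le_exp.2 ?_
      push_cast
      linarith
    have h2 : 50 * (n : ℝ) ^ 2 / β ≤ ⌊100 * (n : ℝ) ^ 2 / β⌋₊ := by
      have : 50 * (n : ℝ) ^ 2 / β = 50 * (n ^ 2 / β) := by ring
      rw [this]
      rw [e1] at hfl ⊢
      linarith
    have h3 := Real.add_one_le_exp (2 * β)
    calc 8 * (n : ℝ) ≤ 50 * n * (2 * β) / β := by field_simp; linarith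
      _ ≤ 50 * n * Real.exp (2 * β) / β := by gcongr; linarith
      _ = 50 * (n : ℝ) ^ 2 / β * (Real.exp (2 * β) / n) := by field_simp
      _ ≤ _ := mul_le_mul h2 h1 (by positivity) (by positivity)
  · refine mul_le_mul_left ?_ _
    have e4 : -(β / 2) * (8 / β * (n : ℝ) ^ 2) = -4 * n ^ 2 := by field_simp; ring
    have hbox : (box n).card ≤ 2 * n ^ 2 := by
      rw [card_box]
      have := side_le n
      nlinarith
    have t1 : ENNReal.ofReal (Real.exp (-(β / 2) * (8 / β * (n : ℝ) ^ 2))) * 2 ^ (box n).card ≤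
        ENNReal.ofReal (Real.exp (-n)) := by
      have h2 : (2 : ℝ≥0∞) = ENNReal.ofReal 2 := by simp
      rw [e4, h2, ← ENNReal.ofReal_pow (by norm_num), ← ENNReal.ofReal_mul (Real.exp_pos _).le]
      refine ENNReal.ofReal_le_ofReal ?_
      have h3 : (2 : ℝ) ≤ Real.exp 1 := by have := Real.add_one_le_exp (1 : ℝ); linarith
      calc Real.exp (-4 * n ^ 2) * 2 ^ (box n).card
          ≤ Real.exp (-4 * n ^ 2) * Real.exp 1 ^ (2 * n ^ 2) := by
            gcongr
            exact (pow_le_pow_left₀ (by norm_num) h3 _).trans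
              (pow_le_pow_right₀ (Real.one_le_exp zero_le_one) hbox)
        _ = Real.exp (-2 * n ^ 2) := by
            rw [← Real.exp_nat_mul, ← Real.exp_add]; congr 1; push_cast; ring
        _ ≤ _ := Real.exp_le_exp.2 (by nlinarith)
    have t2 : ENNReal.ofReal (Real.exp (β * (4 * side n - 6 * n))) ≤
        ENNReal.ofReal (Real.exp (-n)) := by
      refine ENNReal.ofReal_le_ofReal (Real.exp_le_exp.2 ?_)
      nlinarith
    have t3 : (3 * n * 2⁻¹ ^ n : ℝ≥0∞) = ENNReal.ofReal (3 * (n * (1 / 2) ^ n)) := by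
      have h2 : (2 : ℝ≥0∞)⁻¹ = ENNReal.ofReal (1 / 2) := by
        rw [one_div, ENNReal.ofReal_inv_of_pos (by norm_num)]; simp
      rw [h2, ← mul_assoc, ENNReal.ofReal_mul (by positivity), ENNReal.ofReal_mul (by norm_num),
        ENNReal.ofReal_pow (by norm_num)]
      simp
    rw [two_mul, ENNReal.ofReal_add (by positivity) (by positivity),
      ENNReal.ofReal_add (by positivity) (by positivity), t3]
    gcongr

/-! ### Edge boundaries and faces -/

/-- The edge boundary of a set of sites of the box. -/
noncomputable def cut (n : ℕ) (S : Finset (ℤ × ℤ)) : Finset Edge :=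
  (boxEdges n).filter fun e => ¬(e.1 ∈ S ↔ head e ∈ S)

/-- The four edges of the unit square with lower left corner `p`. -/
def face (p : ℤ × ℤ) : Finset Edge :=
  {(p, false), ((p.1, p.2 + 1), false), (p, true), ((p.1 + 1, p.2), true)}

/-- The edges of the two faces containing a given edge. -/
def faceNeighbors (e : Edge) : Finset Edge :=
  face e.1 ∪ face (if e.2 then (e.1.1 - 1, e.1.2) else (e.1.1, e.1.2 - 1))

theorem card_faceNeighbors_le (e : Edge) : (faceNeighbors e).card ≤ 8 :=
  (Finset.card_union_le _ _).trans
    (Nat.add_le_add (b := 4) (d := 4) Finset.card_le_four Finset.card_le_four)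

theorem face_subset_faceNeighbors {e : Edge} {p : ℤ × ℤ} (h : e ∈ face p) :
    face p ⊆ faceNeighbors e := by
  simp only [face, Finset.mem_insert, Finset.mem_singleton] at h
  rcases h with rfl | rfl | rfl | rfl
  · exact Finset.subset_union_left
  · unfold faceNeighbors
    simp only [Bool.false_eq_true, if_false, add_sub_cancel_right]
    exact Finset.subset_union_right
  · exact Finset.subset_union_left
  · unfold faceNeighbors
    simp only [if_true, add_sub_cancel_right]
    exact Finset.subset_union_right

/-- A set of edges is connected when it cannot be split into two parts without common faces. -/
def IsFaceConnected (P : Finset Edge) : Prop :=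
  ∀ P₁ ⊆ P, P₁.Nonempty → P₁ ≠ P → ∃ e ∈ P₁, ∃ e' ∈ P \ P₁, e' ∈ faceNeighbors e

theorem mem_cut_iff {n : ℕ} {S : Finset (ℤ × ℤ)} (hS : S ⊆ box n) {e : Edge} :
    e ∈ cut n S ↔ ¬(e.1 ∈ S ↔ head e ∈ S) := by
  refine ⟨fun h => (Finset.mem_filter.1 h).2, fun h => Finset.mem_filter.2 ⟨?_, h⟩⟩
  by_cases h1 : e.1 ∈ S
  · exact mem_boxEdges_of_tail (hS h1)
  · exact mem_boxEdges_of_head (hS (by tauto))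

/-- A Poincaré lemma over `ℤ/2`: a form that is closed around every unit square is exact. The
potential is the sum along a row from the left. It vanishes to the left, above and below because the
form does, and to the right by descending along columns from above the box. -/
theorem exists_potential {n : ℕ} {P : Finset Edge}
    (hP : ∀ e ∈ P, e.1 ∈ box n ∨ head e ∈ box n)
    (hclosed : ∀ p : ℤ × ℤ, ((if (p, false) ∈ P then 1 else 0 : ZMod 2) +
      if ((p.1 + 1, p.2), true) ∈ P then 1 else 0) =
        (if (p, true) ∈ P then 1 else 0) + if ((p.1, p.2 + 1), false) ∈ P then 1 else 0) :
    ∃ g : ℤ × ℤ → ZMod 2, (∀ p ∉ box n, g p = 0) ∧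
      ∀ e : Edge, g (head e) = g e.1 + if e ∈ P then 1 else 0 := by
  classical
  set M : ℤ := ((n / 2 : ℕ) : ℤ) with hM
  have hM0 : 0 ≤ M := by positivity
  let ω : Edge → ZMod 2 := fun e => if e ∈ P then 1 else 0
  have hω : ∀ e : Edge, e.1 ∉ box n → head e ∉ box n → ω e = 0 := by
    intro e h1 h2
    refine if_neg fun h => ?_
    rcases hP e h with h | h <;> contradiction
  let g : ℤ × ℤ → ZMod 2 := fun p => ∑ i ∈ Finset.Ico (-M - 1) p.1, ω ((i, p.2), false)
  have hleft : ∀ p : ℤ × ℤ, p.1 ≤ -M - 1 → g p = 0 := by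
    intro p hp
    simp [g, Finset.Ico_eq_empty_of_le hp]
  have hhor : ∀ p : ℤ × ℤ, g (p.1 + 1, p.2) = g p + ω (p, false) := by
    intro p
    by_cases hp : -M - 1 ≤ p.1
    · simp only [g]
      rw [← Finset.insert_Ico_right_eq_Ico_add_one hp, Finset.sum_insert (by simp), add_comm]
    · rw [hleft _ (by simp only; omega), hleft p (by omega), hω]
      · simp
      · rw [mem_box]; simp only; omega
      · rw [mem_box, head_false]; simp only; omega
  have hver : ∀ k : ℕ, ∀ p : ℤ × ℤ, p.1 ≤ -M - 1 + k →
      g (p.1, p.2 + 1) = g p + ω (p, true) := by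
    intro k
    induction k with
    | zero =>
      intro p hp
      rw [hleft _ (by simpa using hp), hleft p (by simpa using hp), hω]
      · simp
      · rw [mem_box]; simp only; push_cast at hp; omega
      · rw [mem_box, head_true]; simp only; push_cast at hp; omega
    | succ k ih =>
      intro p hp
      have h1 := ih (p.1 - 1, p.2) (by push_cast at hp ⊢; omega)
      have h2 := hhor (p.1 - 1, p.2)
      have h3 := hhor (p.1 - 1, p.2 + 1)
      have h4 : ω ((p.1 - 1, p.2), false) + ω ((p.1 - 1 + 1, p.2), true) =
        ω ((p.1 - 1, p.2), true) + ω ((p.1 - 1, p.2 + 1), false) := hclosed (p.1 - 1, p.2)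
      simp only [sub_add_cancel] at h1 h2 h3 h4
      rw [h3, h1, add_assoc, ← h4, ← add_assoc, ← h2]
  have hver' : ∀ p : ℤ × ℤ, g (p.1, p.2 + 1) = g p + ω (p, true) := fun p =>
    hver (p.1 + M + 1).toNat p (by omega)
  have hrow : ∀ p : ℤ × ℤ, (p.2 < -M ∨ M < p.2) → g p = 0 := by
    intro p hp
    refine Finset.sum_eq_zero fun i _ => hω _ ?_ ?_
    · rw [mem_box]; simp only; omega
    · rw [mem_box, head_false]; simp only; omega
  have hright : ∀ k : ℕ, ∀ p : ℤ × ℤ, M < p.1 → M < p.2 + k → g p = 0 := by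
    intro k
    induction k with
    | zero => intro p _ hp; exact hrow p (Or.inr (by simpa using hp))
    | succ k ih =>
      intro p hp1 hp
      have h1 := ih (p.1, p.2 + 1) hp1 (by push_cast at hp ⊢; omega)
      have h2 := hver' p
      rw [h1, hω] at h2
      · simpa using h2.symm
      · rw [mem_box]; simp only; omega
      · rw [mem_box, head_true]; simp only; omega
  refine ⟨g, fun p hp => ?_, fun e => ?_⟩
  · rw [mem_box] at hp
    by_cases h1 : p.1 ≤ -M - 1
    · exact hleft p h1
    by_cases h2 : p.2 < -M ∨ M < p.2
    · exact hrow p h2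
    · exact hright (M - p.2 + 1).toNat p (by omega) (by omega)
  · obtain ⟨p, b⟩ := e
    cases b
    · exact hhor p
    · exact hver' p

/-- On a face meeting `P` the set `P` agrees with the whole cut, which is a coboundary; on the other
faces it is empty. So `P` is closed modulo `2`, and its potential is the indicator of the required
set. -/
theorem exists_cut_eq {n : ℕ} {S : Finset (ℤ × ℤ)} (hS : S ⊆ box n) {P : Finset Edge}
    (hP : P ⊆ cut n S) (hsplit : ∀ e ∈ P, ∀ e' ∈ cut n S, e' ∈ faceNeighbors e → e' ∈ P) :
    ∃ S₁ ⊆ box n, cut n S₁ = P := by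
  classical
  let σ : ℤ × ℤ → ZMod 2 := fun p => if p ∈ S then 1 else 0
  have hcut : ∀ e : Edge, (if e ∈ cut n S then 1 else 0 : ZMod 2) = σ e.1 + σ (head e) := by
    intro e
    simp only [mem_cut_iff hS, σ]
    by_cases h1 : e.1 ∈ S <;> by_cases h2 : head e ∈ S <;> simp [h1, h2]
    decide
  obtain ⟨g, hg0, hg⟩ := exists_potential (n := n) (P := P) (fun e he => by
      have := (mem_cut_iff hS).1 (hP he)
      by_cases h1 : e.1 ∈ S
      · exact Or.inl (hS h1)
      · exact Or.inr (hS (by tauto))) (fun p => by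
      by_cases h : ∃ e ∈ face p, e ∈ P
      · obtain ⟨e, he, heP⟩ := h
        have key : ∀ e' ∈ face p, (if e' ∈ P then 1 else 0 : ZMod 2) = σ e'.1 + σ (head e') := by
          intro e' he'
          rw [← hcut]
          have h1 : e' ∈ P ↔ e' ∈ cut n S := ⟨fun h => hP h, fun h =>
            hsplit e heP e' h (face_subset_faceNeighbors he he')⟩
          simp only [h1]
        rw [key _ (by simp [face]), key _ (by simp [face]), key _ (by simp [face]),
          key _ (by simp [face])]
        simp only [head_true, head_false]
        generalize σ p = a
        generalize σ (p.1 + 1, p.2) = b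
        generalize σ (p.1 + 1, p.2 + 1) = c
        generalize σ (p.1, p.2 + 1) = d
        revert a b c d
        decide
      · push Not at h
        rw [if_neg (h _ (by simp [face])), if_neg (h _ (by simp [face])),
          if_neg (h _ (by simp [face])), if_neg (h _ (by simp [face]))])
  refine ⟨(box n).filter fun p => g p = 1, Finset.filter_subset _ _, ?_⟩
  ext e
  have hmem : ∀ p, p ∈ (box n).filter (fun p => g p = 1) ↔ g p = 1 := by
    intro p
    rw [Finset.mem_filter, and_iff_right_iff_imp]
    intro h
    by_contra hp
    rw [hg0 p hp] at h
    exact absurd h (by decide)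
  rw [mem_cut_iff (Finset.filter_subset _ _), hmem, hmem, hg]
  by_cases h : e ∈ P
  · simp only [h, if_true, iff_true]
    generalize g e.1 = a
    revert a
    decide
  · simp [h]

/-- The connected component of `x` in a set of sites, as a minimal closed set. -/
theorem exists_component {B : Finset (ℤ × ℤ)} {x : ℤ × ℤ} (hx : x ∈ B) :
    ∃ C ⊆ B, x ∈ C ∧
      (∀ e : Edge, e.1 ∈ B → head e ∈ B → (e.1 ∈ C ↔ head e ∈ C)) ∧
      ∀ D : Finset (ℤ × ℤ), x ∈ D → (∀ e : Edge, e.1 ∈ C → head e ∈ C → (e.1 ∈ D ↔ head e ∈ D)) →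
        C ⊆ D := by
  classical
  let r : ℤ × ℤ → ℤ × ℤ → Prop := fun u v => u ∈ B ∧ v ∈ B ∧
    ∃ e : Edge, (e.1 = u ∧ head e = v) ∨ (e.1 = v ∧ head e = u)
  have hmem : ∀ z, z ∈ B.filter (fun z => Relation.ReflTransGen r x z) ↔
      Relation.ReflTransGen r x z := by
    intro z
    rw [Finset.mem_filter, and_iff_right_iff_imp]
    intro h
    rcases Relation.ReflTransGen.cases_tail h with rfl | ⟨w, -, hw⟩
    · exact hx
    · exact hw.2.1
  refine ⟨B.filter fun z => Relation.ReflTransGen r x z, Finset.filter_subset _ _,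
    (hmem x).2 Relation.ReflTransGen.refl, fun e h1 h2 => ?_, fun D hD h => ?_⟩
  · rw [hmem, hmem]
    exact ⟨fun h => h.tail ⟨h1, h2, e, Or.inl ⟨rfl, rfl⟩⟩,
      fun h => h.tail ⟨h2, h1, e, Or.inr ⟨rfl, rfl⟩⟩⟩
  · intro z hz
    have hz := (hmem z).1 hz
    induction hz with
    | refl => exact hD
    | @tail u v huv hr ih =>
      have hu := (hmem u).2 huv
      have hv := (hmem v).2 (huv.tail hr)
      obtain ⟨-, -, e, ⟨rfl, rfl⟩ | ⟨rfl, rfl⟩⟩ := hr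
      · exact (h e hu hv).1 (ih hu)
      · exact (h e hv hu).2 (ih hu)

/-- Every site of a finite set `B` is enclosed by a face-connected part of the boundary of the
component of `B` containing it. -/
theorem exists_contour {n : ℕ} {B : Finset (ℤ × ℤ)} (hB : B ⊆ box n) {x : ℤ × ℤ} (hx : x ∈ B) :
    ∃ C S : Finset (ℤ × ℤ), x ∈ C ∧ C ⊆ S ∧ S ⊆ box n ∧
      (∀ e : Edge, e.1 ∈ B → head e ∈ B → (e.1 ∈ C ↔ head e ∈ C)) ∧
      (∀ e ∈ cut n S, (e.1 ∈ S → e.1 ∈ B ∧ head e ∉ B) ∧ (head e ∈ S → head e ∈ B ∧ e.1 ∉ B)) ∧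
      IsFaceConnected (cut n S) := by
  classical
  obtain ⟨C, hCB, hxC, hclosed, hmin⟩ := exists_component hx
  have hCbox := hCB.trans hB
  -- The enclosed set is chosen with the fewest cut edges among those containing `C` whose cut lies
  -- in that of `C`; this discards the boundaries of holes.
  let F : Finset (Finset (ℤ × ℤ)) := (box n).powerset.filter fun S => C ⊆ S ∧ cut n S ⊆ cut n C
  have hF : F.Nonempty := ⟨C, Finset.mem_filter.2
    ⟨Finset.mem_powerset.2 hCbox, subset_rfl, subset_rfl⟩⟩
  obtain ⟨S, hSF, hSmin⟩ := Finset.exists_min_image F (fun S => (cut n S).card) hF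
  obtain ⟨hS, hCS, hcutS⟩ := Finset.mem_filter.1 hSF
  have hS := Finset.mem_powerset.1 hS
  refine ⟨C, S, hxC, hCS, hS, hclosed, fun e he => ?_, fun P₁ hP₁ hne hneq => ?_⟩
  · have h1 := (mem_cut_iff hS).1 he
    have h2 := (mem_cut_iff hCbox).1 (hcutS he)
    have h3 := hclosed e
    have h4 := @hCS e.1
    have h5 := @hCS (head e)
    have h6 := @hCB e.1
    have h7 := @hCB (head e)
    refine ⟨fun a => ?_, fun a => ?_⟩
    · have c : head e ∉ C := fun c => h1 (iff_of_true a (h5 c))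
      have d : e.1 ∈ C := by_contra fun d => h2 (iff_of_false d c)
      exact ⟨h6 d, fun f => c ((h3 (h6 d) f).1 d)⟩
    · have c : e.1 ∉ C := fun c => h1 (iff_of_true (h4 c) a)
      have d : head e ∈ C := by_contra fun d => h2 (iff_of_false c d)
      exact ⟨h7 d, fun f => c ((h3 f (h7 d)).2 d)⟩
  · by_contra hcon
    push Not at hcon
    have hsplit : ∀ e ∈ P₁, ∀ e' ∈ cut n S, e' ∈ faceNeighbors e → e' ∈ P₁ := by
      intro e he e' he' hn
      by_contra h
      exact hcon e he e' (Finset.mem_sdiff.2 ⟨he', h⟩) hn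
    obtain ⟨S₁, hS₁, hcut₁⟩ := exists_cut_eq hS hP₁ hsplit
    have hlt : P₁.card < (cut n S).card := Finset.card_lt_card (hP₁.ssubset_of_ne hneq)
    have hnoedge : ∀ e : Edge, e.1 ∈ C → head e ∈ C → e ∉ cut n S := by
      intro e h1 h2 h
      exact (mem_cut_iff hS).1 h (by simp [hCS h1, hCS h2])
    -- A split cut is the disjoint union of the cuts of `S₁` and of the symmetric difference of `S`
    -- and `S₁`. One of these sets contains `x`, hence all of `C` since no edge inside `C` is cut,
    -- and it has a strictly smaller cut, against minimality.
    by_cases hxS : x ∈ S₁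
    · have hCS₁ : C ⊆ S₁ := by
        refine hmin S₁ hxS fun e h1 h2 => ?_
        by_contra h
        exact hnoedge e h1 h2 (hP₁ (hcut₁ ▸ (mem_cut_iff hS₁).2 h))
      have := hSmin S₁ (Finset.mem_filter.2 ⟨Finset.mem_powerset.2 hS₁, hCS₁, by
        rw [hcut₁]; exact hP₁.trans hcutS⟩)
      rw [hcut₁] at this
      omega
    · let S₂ := (S \ S₁) ∪ (S₁ \ S)
      have hS₂ : S₂ ⊆ box n := Finset.union_subset (Finset.sdiff_subset.trans hS)
        (Finset.sdiff_subset.trans hS₁)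
      have hmem₂ : ∀ p, p ∈ S₂ ↔ ¬(p ∈ S ↔ p ∈ S₁) := by
        intro p
        simp only [S₂, Finset.mem_union, Finset.mem_sdiff]
        tauto
      have hcut₂ : cut n S₂ = cut n S \ P₁ := by
        ext e
        have h1 := @hP₁ e
        rw [← hcut₁] at h1 ⊢
        rw [mem_cut_iff hS₁, mem_cut_iff hS] at h1
        rw [Finset.mem_sdiff, mem_cut_iff hS₂, mem_cut_iff hS, mem_cut_iff hS₁, hmem₂, hmem₂]
        revert h1
        generalize (e.1 ∈ S) = a, (e.1 ∈ S₁) = b, (head e ∈ S) = c, (head e ∈ S₁) = d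
        by_cases a <;> by_cases b <;> by_cases c <;> by_cases d <;> simp [*]
      have hCS₂ : C ⊆ S₂ := by
        refine hmin S₂ ((hmem₂ x).2 (by simp [hCS hxC, hxS])) fun e h1 h2 => ?_
        by_contra h
        have := (mem_cut_iff hS₂).2 h
        rw [hcut₂] at this
        exact hnoedge e h1 h2 (Finset.sdiff_subset this)
      have := hSmin S₂ (Finset.mem_filter.2 ⟨Finset.mem_powerset.2 hS₂, hCS₂, by
        rw [hcut₂]; exact Finset.sdiff_subset.trans hcutS⟩)
      rw [hcut₂, Finset.card_sdiff_of_subset hP₁] at this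
      have := hne.card_pos
      omega

/-! ### Counting connected sets of edges -/

/-- Each term bounds the probability that an exploration with fair coins, started from open `A` and
closed `X`, finds exactly `P`; these events are disjoint. The induction reveals one undecided
neighbour `v` of `A` and splits the family according to whether `v ∈ P`. -/
theorem sum_connected_le (U : Finset Edge) (k : ℕ) : ∀ A X : Finset Edge, A.Nonempty →
    Disjoint A X → (U \ (A ∪ X)).card ≤ k → ∀ F : Finset (Finset Edge),
    (∀ P ∈ F, P ⊆ U ∧ A ⊆ P ∧ Disjoint P X ∧ IsFaceConnected P) →
    ∑ P ∈ F, (1 / 2 : ℝ) ^ (P \ A).card *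
      (1 / 2) ^ ((P.biUnion faceNeighbors \ P) \ X).card ≤ 1 := by
  induction k with
  | zero =>
    intro A X hA hAX hk F hF
    have hFA : F ⊆ {A} := by
      intro P hP
      obtain ⟨hPU, hAP, hPX, hc⟩ := hF P hP
      rw [Finset.mem_singleton]
      refine (Finset.Subset.antisymm hAP fun e he => ?_).symm
      by_contra heA
      have : e ∈ U \ (A ∪ X) := by
        simp only [Finset.mem_sdiff, Finset.mem_union, not_or]
        exact ⟨hPU he, heA, Finset.disjoint_left.1 hPX he⟩
      rw [Finset.card_eq_zero.1 (Nat.le_zero.1 hk)] at this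
      simp at this
    calc _ ≤ ∑ P ∈ ({A} : Finset (Finset Edge)), (1 / 2 : ℝ) ^ (P \ A).card *
          (1 / 2) ^ ((P.biUnion faceNeighbors \ P) \ X).card :=
          Finset.sum_le_sum_of_subset_of_nonneg hFA fun _ _ _ => by positivity
      _ ≤ 1 := by
          rw [Finset.sum_singleton]
          exact mul_le_one₀ (pow_le_one₀ (by norm_num) (by norm_num)) (by positivity)
            (pow_le_one₀ (by norm_num) (by norm_num))
  | succ k ih =>
    intro A X hA hAX hk F hF
    by_cases h : ∃ v ∈ U, v ∈ A.biUnion faceNeighbors ∧ v ∉ A ∧ v ∉ X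
    · obtain ⟨v, hvU, hvN, hvA, hvX⟩ := h
      have hcard : ∀ Y, Y = insert v (A ∪ X) → (U \ Y).card ≤ k := by
        rintro Y rfl
        have h1 : U \ insert v (A ∪ X) ⊂ U \ (A ∪ X) := by
          refine (Finset.ssubset_iff_of_subset
            (Finset.sdiff_subset_sdiff subset_rfl (Finset.subset_insert _ _))).2 ⟨v, ?_, ?_⟩
          · simp [hvU, hvA, hvX]
          · simp
        have := Finset.card_lt_card h1
        omega
      rw [← Finset.sum_filter_add_sum_filter_not F (fun P => v ∈ P)]
      have h1 := ih (insert v A) X (Finset.insert_nonempty _ _)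
        (Finset.disjoint_insert_left.2 ⟨hvX, hAX⟩) (hcard _ (Finset.insert_union _ _ _))
        (F.filter fun P => v ∈ P) (fun P hP => by
          obtain ⟨hP, hvP⟩ := Finset.mem_filter.1 hP
          obtain ⟨h1, h2, h3⟩ := hF P hP
          exact ⟨h1, Finset.insert_subset hvP h2, h3⟩)
      have h2 := ih A (insert v X) hA
        (Finset.disjoint_insert_right.2 ⟨hvA, hAX⟩) (hcard _ (Finset.union_insert _ _ _))
        (F.filter fun P => v ∉ P) (fun P hP => by
          obtain ⟨hP, hvP⟩ := Finset.mem_filter.1 hP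
          obtain ⟨h1, h2, h3, h4⟩ := hF P hP
          exact ⟨h1, h2, Finset.disjoint_insert_right.2 ⟨hvP, h3⟩, h4⟩)
      have e1 : ∑ P ∈ F.filter (fun P => v ∈ P), (1 / 2 : ℝ) ^ (P \ A).card *
          (1 / 2) ^ ((P.biUnion faceNeighbors \ P) \ X).card =
          1 / 2 * ∑ P ∈ F.filter (fun P => v ∈ P), (1 / 2 : ℝ) ^ (P \ insert v A).card *
          (1 / 2) ^ ((P.biUnion faceNeighbors \ P) \ X).card := by
        rw [Finset.mul_sum]
        refine Finset.sum_congr rfl fun P hP => ?_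
        have hvP := (Finset.mem_filter.1 hP).2
        have : (P \ A).card = (P \ insert v A).card + 1 := by
          rw [Finset.sdiff_insert, Finset.card_erase_add_one]
          exact Finset.mem_sdiff.2 ⟨hvP, hvA⟩
        rw [this, pow_succ]; ring
      have e2 : ∑ P ∈ F.filter (fun P => v ∉ P), (1 / 2 : ℝ) ^ (P \ A).card *
          (1 / 2) ^ ((P.biUnion faceNeighbors \ P) \ X).card =
          1 / 2 * ∑ P ∈ F.filter (fun P => v ∉ P), (1 / 2 : ℝ) ^ (P \ A).card *
          (1 / 2) ^ ((P.biUnion faceNeighbors \ P) \ insert v X).card := by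
        rw [Finset.mul_sum]
        refine Finset.sum_congr rfl fun P hP => ?_
        obtain ⟨hPF, hvP⟩ := Finset.mem_filter.1 hP
        have : ((P.biUnion faceNeighbors \ P) \ X).card =
            ((P.biUnion faceNeighbors \ P) \ insert v X).card + 1 := by
          rw [Finset.sdiff_insert, Finset.card_erase_add_one]
          refine Finset.mem_sdiff.2 ⟨Finset.mem_sdiff.2 ⟨?_, hvP⟩, hvX⟩
          exact Finset.biUnion_subset_biUnion_of_subset_left _ (hF P hPF).2.1 hvN
        rw [this, pow_succ]; ring
      rw [e1, e2]
      linarith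
    · have hFA : F ⊆ {A} := by
        intro P hP
        obtain ⟨hPU, hAP, hPX, hc⟩ := hF P hP
        rw [Finset.mem_singleton]
        by_contra hne
        obtain ⟨e, he, e', he', hn⟩ := hc A hAP hA (fun h => hne h.symm)
        obtain ⟨he'P, he'A⟩ := Finset.mem_sdiff.1 he'
        exact h ⟨e', hPU he'P, Finset.mem_biUnion.2 ⟨e, he, hn⟩, he'A,
          Finset.disjoint_left.1 hPX he'P⟩
      calc _ ≤ ∑ P ∈ ({A} : Finset (Finset Edge)), (1 / 2 : ℝ) ^ (P \ A).card *
            (1 / 2) ^ ((P.biUnion faceNeighbors \ P) \ X).card :=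
            Finset.sum_le_sum_of_subset_of_nonneg hFA fun _ _ _ => by positivity
        _ ≤ 1 := by
            rw [Finset.sum_singleton]
            exact mul_le_one₀ (pow_le_one₀ (by norm_num) (by norm_num)) (by positivity)
              (pow_le_one₀ (by norm_num) (by norm_num))

/-- At most `|P|` coins show open and `8|P|` show closed, as an edge has at most eight face
neighbours. -/
theorem sum_connected_pow_le (U : Finset Edge) (e₀ : Edge) (F : Finset (Finset Edge))
    (hF : ∀ P ∈ F, P ⊆ U ∧ e₀ ∈ P ∧ IsFaceConnected P) :
    ∑ P ∈ F, (1 / 2 : ℝ) ^ (9 * P.card) ≤ 1 := by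
  refine le_trans (Finset.sum_le_sum fun P hP => ?_) (sum_connected_le U _ {e₀} ∅
    (Finset.singleton_nonempty _) (Finset.disjoint_empty_right _) le_rfl F fun P hP => ?_)
  · rw [← pow_add]
    refine pow_le_pow_of_le_one (by norm_num) (by norm_num) ?_
    have h1 : (P \ {e₀}).card ≤ P.card := Finset.card_le_card Finset.sdiff_subset
    have h2 : ((P.biUnion faceNeighbors \ P) \ ∅).card ≤ P.card * 8 :=
      (Finset.card_le_card (Finset.sdiff_subset.trans Finset.sdiff_subset)).trans
        (Finset.card_biUnion_le_card_mul _ _ _ fun e _ => card_faceNeighbors_le e)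
    omega
  · obtain ⟨h1, h2, h3⟩ := hF P hP
    exact ⟨h1, Finset.singleton_subset_iff.2 h2, Finset.disjoint_empty_right _, h3⟩

/-! ### Isoperimetry -/

theorem exists_exit {S : Finset (ℤ × ℤ)} {f : ℤ → ℤ × ℤ} (hf : Function.Injective f) {i : ℤ}
    (hi : f i ∈ S) : (∃ j, f j ∈ S ∧ f (j + 1) ∉ S) ∧ ∃ j, f j ∉ S ∧ f (j + 1) ∈ S := by
  classical
  have hne : (S.preimage f hf.injOn).Nonempty := ⟨i, Finset.mem_preimage.2 hi⟩
  constructor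
  · refine ⟨(S.preimage f hf.injOn).max' hne, Finset.mem_preimage.1 (Finset.max'_mem _ hne),
      fun h => ?_⟩
    have := Finset.le_max' (S.preimage f hf.injOn) _ (Finset.mem_preimage.2 h)
    omega
  · refine ⟨(S.preimage f hf.injOn).min' hne - 1, fun h => ?_, ?_⟩
    · have := Finset.min'_le (S.preimage f hf.injOn) _ (Finset.mem_preimage.2 h)
      omega
    · rw [sub_add_cancel]
      exact Finset.mem_preimage.1 (Finset.min'_mem _ hne)

/-- Every column meeting `S` is entered and left through distinct vertical cut edges, and likewise
every row through horizontal ones. -/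
theorem two_mul_card_image_add_le_card_cut {n : ℕ} {S : Finset (ℤ × ℤ)} (hS : S ⊆ box n) :
    2 * (S.image Prod.fst).card + 2 * (S.image Prod.snd).card ≤ (cut n S).card := by
  classical
  have hsum := Finset.card_filter_add_card_filter_not (s := cut n S) (fun e => e.2 = true)
  simp only [Bool.not_eq_true] at hsum
  rw [← hsum]
  refine Nat.add_le_add ?_ ?_
  · refine le_trans (Finset.mul_card_image_le_card_of_maps_to (f := fun e : Edge => e.1.1)
      (s := ((cut n S).filter fun e => e.2 = true).filter fun e => e.1.1 ∈ S.image Prod.fst)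
      (t := S.image Prod.fst) (fun e he => (Finset.mem_filter.1 he).2) 2 fun c hc => ?_)
      (Finset.card_le_card (Finset.filter_subset _ _))
    obtain ⟨⟨a, b⟩, hp, rfl⟩ := Finset.mem_image.1 hc
    obtain ⟨⟨j, hj, hj'⟩, k, hk, hk'⟩ := exists_exit (f := fun i => (a, i))
      (fun i i' h => by simpa using h) hp
    refine Finset.one_lt_card.2 ⟨((a, j), true), ?_, ((a, k), true), ?_, ?_⟩
    · simp only [Finset.mem_filter, mem_cut_iff hS, head_true, hj, hj', and_true, true_iff,
        not_false_eq_true, true_and]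
      exact hc
    · simp only [Finset.mem_filter, mem_cut_iff hS, head_true, hk, hk', and_true, iff_true,
        not_false_eq_true, true_and]
      exact hc
    · rintro h
      simp only [Prod.mk.injEq, and_true, true_and] at h
      exact hk (h ▸ hj)
  · refine le_trans (Finset.mul_card_image_le_card_of_maps_to (f := fun e : Edge => e.1.2)
      (s := ((cut n S).filter fun e => e.2 = false).filter fun e => e.1.2 ∈ S.image Prod.snd)
      (t := S.image Prod.snd) (fun e he => (Finset.mem_filter.1 he).2) 2 fun c hc => ?_)
      (Finset.card_le_card (Finset.filter_subset _ _))
    obtain ⟨⟨a, b⟩, hp, rfl⟩ := Finset.mem_image.1 hc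
    obtain ⟨⟨j, hj, hj'⟩, k, hk, hk'⟩ := exists_exit (f := fun i => (i, b))
      (fun i i' h => by simpa using h) hp
    refine Finset.one_lt_card.2 ⟨((j, b), false), ?_, ((k, b), false), ?_, ?_⟩
    · simp only [Finset.mem_filter, mem_cut_iff hS, head_false, hj, hj', and_true, true_iff,
        not_false_eq_true, true_and]
      exact hc
    · simp only [Finset.mem_filter, mem_cut_iff hS, head_false, hk, hk', and_true, iff_true,
        not_false_eq_true, true_and]
      exact hc
    · rintro h
      simp only [Prod.mk.injEq, and_true] at h
      exact hk (h ▸ hj)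

/-- The area is at most the side times the number of rows met. Being linear in the perimeter, this
bound lets the surface energy absorb a volume tilt of order `β / side n`. -/
theorem two_mul_card_le_side_mul_card_cut {n : ℕ} {S : Finset (ℤ × ℤ)} (hS : S ⊆ box n) :
    2 * S.card ≤ side n * (cut n S).card := by
  have h1 := two_mul_card_image_add_le_card_cut hS
  have h2 : S.card ≤ side n * (S.image Prod.snd).card := by
    have hsub : S ⊆ Finset.Icc (-((n / 2 : ℕ) : ℤ)) ((n / 2 : ℕ) : ℤ) ×ˢ S.image Prod.snd := by
      intro p hp
      have := mem_box.1 (hS hp)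
      exact Finset.mem_product.2 ⟨Finset.mem_Icc.2 this.1, Finset.mem_image_of_mem _ hp⟩
    refine (Finset.card_le_card hsub).trans ?_
    rw [Finset.card_product, Int.card_Icc]
    refine Nat.mul_le_mul_right _ ?_
    unfold side; omega
  nlinarith

/-- A set of sites containing a connected triple has edge boundary at least `8`. -/
theorem eight_le_card_cut {n : ℕ} {S : Finset (ℤ × ℤ)} (hS : S ⊆ box n) {x y z : ℤ × ℤ}
    (hx : x ∈ S) (hy : y ∈ S) (hz : z ∈ S) (hxy : x ≠ y) (hxz : x ≠ z) (hyz : y ≠ z) :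
    8 ≤ (cut n S).card := by
  classical
  have h1 := two_mul_card_image_add_le_card_cut hS
  have hsub : S ⊆ S.image Prod.fst ×ˢ S.image Prod.snd := fun p hp =>
    Finset.mem_product.2 ⟨Finset.mem_image_of_mem _ hp, Finset.mem_image_of_mem _ hp⟩
  have h2 := Finset.card_le_card hsub
  rw [Finset.card_product] at h2
  have h3 : 2 < S.card := Finset.two_lt_card.2 ⟨x, hx, y, hy, z, hz, hxy, hxz, hyz⟩
  generalize (S.image Prod.fst).card = a at *
  generalize (S.image Prod.snd).card = b at *
  by_contra hlt
  have : a + b ≤ 3 := by omega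
  have ha : a ≤ 3 := by omega
  interval_cases a <;> omega

/-- Membership is propagated by the cut from left to right, starting outside the box. Sums over
enclosed sets thereby become sums over edge sets. -/
theorem cut_injOn (n : ℕ) : Set.InjOn (cut n) {S | S ⊆ box n} := by
  intro S hS S' hS' h
  have hS : S ⊆ box n := hS
  have hS' : S' ⊆ box n := hS'
  have key : ∀ k : ℕ, ∀ p : ℤ × ℤ, p.1 ≤ -((n / 2 : ℕ) : ℤ) - 1 + k → (p ∈ S ↔ p ∈ S') := by
    intro k
    induction k with
    | zero =>
      intro p hp
      have hp : p ∉ box n := by rw [mem_box]; push_cast at hp ⊢; omega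
      exact iff_of_false (fun h => hp (hS h)) fun h => hp (hS' h)
    | succ k ih =>
      intro p hp
      have h1 := ih (p.1 - 1, p.2) (by push_cast at hp ⊢; omega)
      have h2 : ((p.1 - 1, p.2), false) ∈ cut n S ↔ ((p.1 - 1, p.2), false) ∈ cut n S' := by rw [h]
      rw [mem_cut_iff hS, mem_cut_iff hS', head_false, sub_add_cancel] at h2
      simp only [h1] at h2
      have hpp : ((p.1, p.2) : ℤ × ℤ) = p := rfl
      rw [hpp] at h2
      tauto
  ext p
  exact key (p.1 + ((n / 2 : ℕ) : ℤ) + 1).toNat p (by omega)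

/-! ### Sums over contours -/

open Classical in
/-- The sets enclosed by a contour of length at least `m` around `x`. -/
noncomputable def contours (n m : ℕ) (x : ℤ × ℤ) : Finset (Finset (ℤ × ℤ)) :=
  (box n).powerset.filter fun S => x ∈ S ∧ m ≤ (cut n S).card ∧ IsFaceConnected (cut n S)

theorem mem_contours {n m : ℕ} {x : ℤ × ℤ} {S : Finset (ℤ × ℤ)} :
    S ∈ contours n m x ↔ S ⊆ box n ∧ x ∈ S ∧ m ≤ (cut n S).card ∧ IsFaceConnected (cut n S) := by
  simp [contours]

/-- Walking right from `x` until leaving `S` crosses a cut edge, and the sites passed lie in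
distinct columns, so the length of the contour controls the distance walked. -/
theorem exists_root {n : ℕ} {S : Finset (ℤ × ℤ)} (hS : S ⊆ box n) {x : ℤ × ℤ} (hx : x ∈ S) :
    ∃ j < side n, ((x.1 + j, x.2), false) ∈ cut n S ∧ j + 1 ≤ (cut n S).card := by
  classical
  have hex : ∃ j : ℕ, (x.1 + j + 1, x.2) ∉ S := by
    refine ⟨side n, fun h => ?_⟩
    have h1 := mem_box.1 (hS h)
    have h2 := mem_box.1 (hS hx)
    simp only [side] at h1
    push_cast at h1
    omega
  have hj := Nat.find_spec hex
  have hlt : ∀ i : ℕ, i ≤ Nat.find hex → (x.1 + i, x.2) ∈ S := by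
    intro i hi
    rcases i with _ | i
    · simpa using hx
    · have := not_not.1 (Nat.find_min hex (m := i) (by omega))
      push_cast
      rwa [← add_assoc]
  set j := Nat.find hex
  refine ⟨j, ?_, ?_, ?_⟩
  · have h1 := mem_box.1 (hS (hlt j le_rfl))
    have h2 := mem_box.1 (hS hx)
    simp only [side]
    simp only at h1
    omega
  · rw [mem_cut_iff hS, head_false]
    simp only [hlt j le_rfl, true_iff]
    exact hj
  · have h1 := two_mul_card_image_add_le_card_cut hS
    have h2 : (Finset.range (j + 1)).card ≤ (S.image Prod.fst).card := by
      refine Finset.card_le_card_of_injOn (fun i : ℕ => x.1 + i) (fun i hi => ?_) ?_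
      · have hi : i < j + 1 := by simpa using hi
        exact Finset.mem_coe.2 (Finset.mem_image.2 ⟨_, hlt i (by omega), rfl⟩)
      · intro a _ b _ h
        simpa using h
    rw [Finset.card_range] at h2
    omega

/-- Of the factor `2 ^ 10` per edge, `2 ^ 9` pays for counting connected sets through a root, and
the last `2` for the position of the root, through `∑ 2^{-(j+1)} ≤ 1`. -/
theorem sum_contours_le (n m : ℕ) (x : ℤ × ℤ) {q : ℝ} (hq : 0 ≤ q) (hq' : 2 ^ 10 * q ≤ 1) :
    ∑ S ∈ contours n m x, q ^ (cut n S).card ≤ (2 ^ 10 * q) ^ m := by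
  classical
  let F : ℕ → Finset (Finset (ℤ × ℤ)) := fun j => (contours n m x).filter fun S =>
    ((x.1 + j, x.2), false) ∈ cut n S ∧ j + 1 ≤ (cut n S).card
  have hF : ∀ j, ∑ S ∈ F j, q ^ (cut n S).card ≤ (2 ^ 10 * q) ^ m * (1 / 2) ^ (j + 1) := by
    intro j
    have h1 : ∀ S ∈ F j, q ^ (cut n S).card ≤
        ((2 ^ 10 * q) ^ m * (1 / 2) ^ (j + 1)) * (1 / 2) ^ (9 * (cut n S).card) := by
      intro S hS
      obtain ⟨hS, -, hj⟩ := Finset.mem_filter.1 hS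
      obtain ⟨-, -, hm, -⟩ := mem_contours.1 hS
      calc q ^ (cut n S).card = (2 ^ 10 * q) ^ (cut n S).card * (1 / 2) ^ (cut n S).card *
            (1 / 2) ^ (9 * (cut n S).card) := by
            rw [pow_mul, ← mul_pow, ← mul_pow]
            congr 1
            ring
        _ ≤ _ := by
            refine mul_le_mul_of_nonneg_right (mul_le_mul
              (pow_le_pow_of_le_one (by positivity) hq' hm)
              (pow_le_pow_of_le_one (by norm_num) (by norm_num) hj) (by positivity)
              (by positivity)) (by positivity)
    refine (Finset.sum_le_sum h1).trans ?_
    rw [← Finset.mul_sum]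
    refine mul_le_of_le_one_right (by positivity) ?_
    have hinj : Set.InjOn (cut n) (F j) := (cut_injOn n).mono fun S hS =>
      (mem_contours.1 (Finset.mem_filter.1 hS).1).1
    rw [← Finset.sum_image (f := fun P : Finset Edge => (1 / 2 : ℝ) ^ (9 * P.card)) hinj]
    refine sum_connected_pow_le (boxEdges n) ((x.1 + j, x.2), false) _ fun P hP => ?_
    obtain ⟨S, hS, rfl⟩ := Finset.mem_image.1 hP
    obtain ⟨hS, hj, -⟩ := Finset.mem_filter.1 hS
    exact ⟨Finset.filter_subset _ _, hj, (mem_contours.1 hS).2.2.2⟩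
  calc ∑ S ∈ contours n m x, q ^ (cut n S).card
      ≤ ∑ S ∈ contours n m x, ∑ j ∈ Finset.range (side n),
          if ((x.1 + j, x.2), false) ∈ cut n S ∧ j + 1 ≤ (cut n S).card then
            q ^ (cut n S).card else 0 := by
        refine Finset.sum_le_sum fun S hS => ?_
        obtain ⟨h1, h2, -⟩ := mem_contours.1 hS
        obtain ⟨j, hj, hj'⟩ := exists_root h1 h2
        refine le_trans (le_of_eq (if_pos hj').symm) (Finset.single_le_sum
          (f := fun j : ℕ => if ((x.1 + j, x.2), false) ∈ cut n S ∧ j + 1 ≤ (cut n S).card then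
            q ^ (cut n S).card else 0) (fun i _ => ?_) (Finset.mem_range.2 hj))
        split_ifs <;> positivity
    _ = ∑ j ∈ Finset.range (side n), ∑ S ∈ F j, q ^ (cut n S).card := by
        rw [Finset.sum_comm]
        simp only [F, Finset.sum_filter]
    _ ≤ ∑ j ∈ Finset.range (side n), (2 ^ 10 * q) ^ m * (1 / 2) ^ (j + 1) :=
        Finset.sum_le_sum fun j _ => hF j
    _ ≤ _ := by
        rw [← Finset.mul_sum]
        refine mul_le_of_le_one_right (by positivity) ?_
        have := sum_geometric_two_le (side n)
        simp_rw [pow_succ]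
        rw [← Finset.sum_mul]
        linarith

/-! ### The Peierls argument -/

open Classical in
/-- Lower a field by one on a set of sites. -/
noncomputable def lowerOn {n : ℕ} (S : Finset (ℤ × ℤ)) (ψ : Field n) : Field n :=
  fun x => ψ x - if x.1 ∈ S then 1 else 0

theorem lowerOn_injective {n : ℕ} (S : Finset (ℤ × ℤ)) :
    Function.Injective (lowerOn (n := n) S) := by
  intro ψ ψ' h
  funext x
  have := congrFun h x
  simp only [lowerOn] at this
  linarith

theorem ext_lowerOn {n : ℕ} {S : Finset (ℤ × ℤ)} (hS : S ⊆ box n) (c : ℤ) (ψ : Field n)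
    (p : ℤ × ℤ) : ext c (lowerOn S ψ) p = ext c ψ p - if p ∈ S then 1 else 0 := by
  by_cases h : p ∈ box n
  · rw [ext_of_mem h, ext_of_mem h, lowerOn]
  · rw [ext_of_notMem h, ext_of_notMem h, if_neg (fun h' => h (hS h')), sub_zero]

theorem ext_sub_one_le_lowerOn {n : ℕ} {S : Finset (ℤ × ℤ)} (hS : S ⊆ box n) (c : ℤ) (ψ : Field n)
    (p : ℤ × ℤ) : ext c ψ p - 1 ≤ ext c (lowerOn S ψ) p := by
  rw [ext_lowerOn hS]; split_ifs <;> omega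

/-- Every cut edge descends strictly out of `S`, so lowering `S` by one saves exactly one unit on
each. -/
theorem freeEnergy_lowerOn {n : ℕ} {S : Finset (ℤ × ℤ)} (hS : S ⊆ box n) {c : ℤ} {ψ : Field n}
    (h : ∀ e ∈ cut n S, (e.1 ∈ S → ext c ψ (head e) < ext c ψ e.1) ∧
      (head e ∈ S → ext c ψ e.1 < ext c ψ (head e))) :
    freeEnergy c (lowerOn S ψ) + (cut n S).card = freeEnergy c ψ := by
  classical
  have h1 : ((cut n S).card : ℤ) = ∑ e ∈ boxEdges n, if ¬(e.1 ∈ S ↔ head e ∈ S) then 1 else 0 := by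
    rw [cut, Finset.sum_boole]
  rw [h1, freeEnergy, freeEnergy, ← Finset.sum_add_distrib]
  refine Finset.sum_congr rfl fun e he => ?_
  rw [ext_lowerOn hS, ext_lowerOn hS]
  have h2 := h e
  rw [mem_cut_iff hS] at h2
  by_cases ha : e.1 ∈ S <;> by_cases hb : head e ∈ S <;> simp [ha, hb] at h2 ⊢
  · rw [abs_of_nonneg (by omega), abs_of_pos (by omega)]; ring
  · rw [abs_of_nonpos (by omega), abs_of_neg (by omega)]; ring

/-! ### Contour bounds for weights tilted by the number of high sites. -/

/-- The number of sites strictly above the boundary height. -/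
noncomputable def highCount {n : ℕ} (c : ℤ) (ψ : Field n) : ℕ :=
  ((box n).filter fun p => c < ext c ψ p).card

/-- The Gibbs weight without floor, tilted by the number of sites above the boundary height. -/
noncomputable def tiltWeight (t β : ℝ) (c : ℤ) {n : ℕ} (ψ : Field n) : ℝ≥0∞ :=
  ENNReal.ofReal (Real.exp (-β * (freeEnergy c ψ : ℝ) + t * highCount c ψ))

theorem tiltWeight_zero (β : ℝ) (c : ℤ) {n : ℕ} :
    tiltWeight 0 β c = (freeWeight β c : Field n → ℝ≥0∞) := by
  funext ψ; simp [tiltWeight, freeWeight]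

theorem highCount_le_lowerOn {n : ℕ} {S : Finset (ℤ × ℤ)} (hS : S ⊆ box n) (c : ℤ) (ψ : Field n) :
    highCount c ψ ≤ highCount c (lowerOn S ψ) + S.card := by
  classical
  refine le_trans (Finset.card_le_card fun p hp => ?_) (Finset.card_union_le _ S)
  rw [Finset.mem_union, Finset.mem_filter]
  rw [Finset.mem_filter] at hp
  by_cases h : p ∈ S
  · exact Or.inr h
  · refine Or.inl ⟨hp.1, ?_⟩
    rw [ext_lowerOn hS, if_neg h, sub_zero]
    exact hp.2

/-- Lowering loses at most `|S|` high sites, a tilt of at most `t · side n / 2` per cut edge by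
isoperimetry; `b` is what remains of `β`. -/
theorem tiltWeight_le_lowerOn {t β b : ℝ} (ht : 0 ≤ t) {n : ℕ} (hb : b ≤ β - t * side n / 2)
    {S : Finset (ℤ × ℤ)} (hS : S ⊆ box n) {c : ℤ} {ψ : Field n}
    (h : ∀ e ∈ cut n S, (e.1 ∈ S → ext c ψ (head e) < ext c ψ e.1) ∧
      (head e ∈ S → ext c ψ e.1 < ext c ψ (head e))) :
    tiltWeight t β c ψ ≤
      ENNReal.ofReal (Real.exp (-b) ^ (cut n S).card) * tiltWeight t β c (lowerOn S ψ) := by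
  rw [tiltWeight, tiltWeight, ← ENNReal.ofReal_mul (by positivity), ← Real.exp_nat_mul,
    ← Real.exp_add]
  refine ENNReal.ofReal_le_ofReal (Real.exp_le_exp.2 ?_)
  have h1 : (freeEnergy c (lowerOn S ψ) : ℝ) + (cut n S).card = freeEnergy c ψ := by
    exact_mod_cast freeEnergy_lowerOn hS h
  have h2 : (highCount c ψ : ℝ) ≤ highCount c (lowerOn S ψ) + S.card := by
    exact_mod_cast highCount_le_lowerOn hS c ψ
  have h3 : 2 * (S.card : ℝ) ≤ side n * (cut n S).card := by
    exact_mod_cast two_mul_card_le_side_mul_card_cut hS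
  have h4 := mul_le_mul_of_nonneg_left h2 ht
  have h5 := mul_le_mul_of_nonneg_left h3 ht
  have h6 := mul_le_mul_of_nonneg_right hb (Nat.cast_nonneg (α := ℝ) (cut n S).card)
  rw [← h1]
  linarith

/-- Lower the region enclosed by a contour of the superlevel component of `x`, and sum over
contours. The length bound `m` may depend on the component, so that further high sites joined to `x`
force longer contours; the target `Q` records what survives the lowering, so that the bound can be
iterated level by level. -/
theorem peierls {t β b : ℝ} (ht : 0 ≤ t) {n : ℕ} (hb : b ≤ β - t * side n / 2)
    (hb' : 2 ^ 10 * Real.exp (-b) ≤ 1) {c k : ℤ} (hk : c < k) {x : ℤ × ℤ} (m : ℕ)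
    {P Q : Set (Field n)} (hP : ∀ ψ ∈ P, k ≤ ext c ψ x)
    (hm : ∀ ψ ∈ P, ∀ C S : Finset (ℤ × ℤ), x ∈ C → C ⊆ S → S ⊆ box n →
      (∀ e : Edge, k ≤ ext c ψ e.1 → k ≤ ext c ψ (head e) → (e.1 ∈ C ↔ head e ∈ C)) →
      m ≤ (cut n S).card)
    (hQ : ∀ ψ ∈ P, ∀ S ⊆ box n, lowerOn S ψ ∈ Q) :
    ∑' ψ, P.indicator (tiltWeight t β c) ψ ≤
      ENNReal.ofReal ((2 ^ 10 * Real.exp (-b)) ^ m) * ∑' ψ, Q.indicator (tiltWeight t β c) ψ := by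
  classical
  have hpt : ∀ ψ, P.indicator (tiltWeight t β c) ψ ≤ ∑ S ∈ contours n m x,
      ENNReal.ofReal (Real.exp (-b) ^ (cut n S).card) *
        Q.indicator (tiltWeight t β c) (lowerOn S ψ) := by
    intro ψ
    by_cases hψ : ψ ∈ P
    · rw [Set.indicator_of_mem hψ]
      let B := (box n).filter fun p => k ≤ ext c ψ p
      have hB : ∀ p, p ∈ B ↔ k ≤ ext c ψ p := by
        intro p
        rw [Finset.mem_filter, and_iff_right_iff_imp]
        intro h
        by_contra hp
        rw [ext_of_notMem hp] at h
        omega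
      have hBbox : B ⊆ box n := Finset.filter_subset _ _
      clear_value B
      obtain ⟨C, S, hxC, hCS, hS, hC, hcut, hconn⟩ := exists_contour hBbox ((hB x).2 (hP ψ hψ))
      simp only [hB] at hC hcut
      have hmem : S ∈ contours n m x :=
        mem_contours.2 ⟨hS, hCS hxC, hm ψ hψ C S hxC hCS hS hC, hconn⟩
      refine le_trans ?_ (Finset.single_le_sum (f := fun S =>
        ENNReal.ofReal (Real.exp (-b) ^ (cut n S).card) *
          Q.indicator (tiltWeight t β c) (lowerOn S ψ)) (fun _ _ => bot_le) hmem)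
      rw [Set.indicator_of_mem (hQ ψ hψ S hS)]
      refine tiltWeight_le_lowerOn ht hb hS fun e he => ⟨fun h => ?_, fun h => ?_⟩
      · have := (hcut e he).1 h
        omega
      · have := (hcut e he).2 h
        omega
    · rw [Set.indicator_of_notMem hψ]; exact bot_le
  calc ∑' ψ, P.indicator (tiltWeight t β c) ψ
      ≤ ∑' ψ, ∑ S ∈ contours n m x, ENNReal.ofReal (Real.exp (-b) ^ (cut n S).card) *
        Q.indicator (tiltWeight t β c) (lowerOn S ψ) := ENNReal.tsum_le_tsum hpt
    _ = ∑ S ∈ contours n m x, ENNReal.ofReal (Real.exp (-b) ^ (cut n S).card) *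
        ∑' ψ, Q.indicator (tiltWeight t β c) (lowerOn S ψ) := by
        rw [Summable.tsum_finsetSum fun _ _ => ENNReal.summable]
        simp_rw [ENNReal.tsum_mul_left]
    _ ≤ ∑ S ∈ contours n m x, ENNReal.ofReal (Real.exp (-b) ^ (cut n S).card) *
        ∑' ψ, Q.indicator (tiltWeight t β c) ψ := by
        refine Finset.sum_le_sum fun S _ => mul_le_mul_right ?_ _
        exact ENNReal.tsum_comp_le_tsum_of_injective (lowerOn_injective S)
          (Q.indicator (tiltWeight t β c))
    _ ≤ _ := by
        rw [← Finset.sum_mul, ← ENNReal.ofReal_sum_of_nonneg fun _ _ => by positivity]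
        gcongr
        exact sum_contours_le n m x (Real.exp_pos _).le hb'

/-! ### High sites and high dominoes without floor -/

theorem tsum_tiltWeight_high_le {t β b : ℝ} (ht : 0 ≤ t) {n : ℕ} (hb : b ≤ β - t * side n / 2)
    (hb' : 2 ^ 10 * Real.exp (-b) ≤ 1) (c : ℤ) (x : ℤ × ℤ) :
    ∑' ψ : Field n, {ψ | c < ext c ψ x}.indicator (tiltWeight t β c) ψ ≤
      ENNReal.ofReal (2 ^ 10 * Real.exp (-b)) * ∑' ψ : Field n, tiltWeight t β c ψ := by
  have h := peierls (P := {ψ : Field n | c < ext c ψ x}) (Q := Set.univ) (x := x) (k := c + 1)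
    ht hb hb' (by omega) 1 (fun ψ hψ => hψ) (fun ψ _ C S hx hCS hS _ => ?_)
    (fun _ _ _ _ => Set.mem_univ _)
  · simpa using h
  · have h1 := two_mul_card_image_add_le_card_cut hS
    have h2 : 0 < (S.image Prod.fst).card :=
      Finset.card_pos.2 ⟨_, Finset.mem_image_of_mem _ (hCS hx)⟩
    omega

theorem mem_iff_mem_of_adj {C : Finset (ℤ × ℤ)} {p : ℤ × ℤ → Prop}
    (hC : ∀ e : Edge, p e.1 → p (head e) → (e.1 ∈ C ↔ head e ∈ C)) {u v : ℤ × ℤ}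
    (huv : lattice.Adj u v) (hu : p u) (hv : p v) : u ∈ C ↔ v ∈ C := by
  obtain ⟨e, he⟩ := exists_edge_of_adj huv
  rcases Sym2.eq_iff.1 he with ⟨rfl, rfl⟩ | ⟨rfl, rfl⟩
  · exact hC e hu hv
  · exact (hC e hv hu).symm

theorem tsum_freeWeight_triple_le {β : ℝ} {n : ℕ} (hβ : 2 ^ 10 * Real.exp (-β) ≤ 1) (c : ℤ)
    {x y z : ℤ × ℤ} (hxy : lattice.Adj x y) (hz : lattice.Adj x z ∨ lattice.Adj y z) (hzx : z ≠ x)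
    (hzy : z ≠ y) (k : ℕ) :
    ∑' ψ : Field n, {ψ | c + k ≤ ext c ψ x ∧ c + k ≤ ext c ψ y ∧ c + k ≤ ext c ψ z}.indicator
        (freeWeight β c) ψ ≤
      ENNReal.ofReal ((2 ^ 10 * Real.exp (-β)) ^ 8) ^ k * ∑' ψ : Field n, freeWeight β c ψ := by
  rw [← tiltWeight_zero]
  induction k with
  | zero =>
    rw [pow_zero, one_mul]
    exact ENNReal.tsum_le_tsum fun ψ => Set.indicator_le_self _ _ _
  | succ k ih =>
    rw [pow_succ', mul_assoc]
    refine le_trans ?_ (mul_le_mul_right ih _)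
    refine peierls (x := x) (k := c + (k + 1 : ℕ)) le_rfl (by simp) hβ (by omega) 8
      (fun ψ hψ => hψ.1) (fun ψ hψ C S hx hCS hS hC => ?_) (fun ψ hψ S hS => ?_)
    · obtain ⟨h1, h2, h3⟩ := hψ
      have hy : y ∈ C :=
        (mem_iff_mem_of_adj (p := fun u => c + (k + 1 : ℕ) ≤ ext c ψ u) hC hxy h1 h2).1 hx
      have hzC : z ∈ C := by
        rcases hz with hz | hz
        · exact (mem_iff_mem_of_adj (p := fun u => c + (k + 1 : ℕ) ≤ ext c ψ u) hC hz h1 h3).1 hx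
        · exact (mem_iff_mem_of_adj (p := fun u => c + (k + 1 : ℕ) ≤ ext c ψ u) hC hz h2 h3).1 hy
      exact eight_le_card_cut hS (hCS hx) (hCS hy) (hCS hzC) hxy.ne hzx.symm hzy.symm
    · obtain ⟨h1, h2, h3⟩ := hψ
      have h4 := ext_sub_one_le_lowerOn hS c ψ x
      have h5 := ext_sub_one_le_lowerOn hS c ψ y
      have h6 := ext_sub_one_le_lowerOn hS c ψ z
      push_cast at h1 h2 h3
      exact ⟨by linarith, by linarith, by linarith⟩

theorem six_le_card_cut {n : ℕ} {S : Finset (ℤ × ℤ)} (hS : S ⊆ box n) {x y : ℤ × ℤ}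
    (hx : x ∈ S) (hy : y ∈ S) (hxy : x ≠ y) : 6 ≤ (cut n S).card := by
  classical
  have h1 := two_mul_card_image_add_le_card_cut hS
  have hsub : S ⊆ S.image Prod.fst ×ˢ S.image Prod.snd := fun p hp =>
    Finset.mem_product.2 ⟨Finset.mem_image_of_mem _ hp, Finset.mem_image_of_mem _ hp⟩
  have h2 := Finset.card_le_card hsub
  rw [Finset.card_product] at h2
  have h3 : 1 < S.card := Finset.one_lt_card.2 ⟨x, hx, y, hy, hxy⟩
  generalize (S.image Prod.fst).card = a at *
  generalize (S.image Prod.snd).card = b at *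
  by_contra hlt
  have ha : a ≤ 2 := by omega
  interval_cases a <;> omega

/-- When no neighbour reaches the level, the region to lower is the domino itself. No sum over
contours is needed, and the factor is `e^{-6β}` with constant one. -/
theorem tsum_freeWeight_isolated_domino_le {β : ℝ} (hβ : 0 ≤ β) {n : ℕ} (c : ℤ) {x y : ℤ × ℤ}
    (hxy : lattice.Adj x y) (k : ℕ) :
    ∑' ψ : Field n, {ψ | (c + (k + 1 : ℕ) ≤ ext c ψ x ∧ c + (k + 1 : ℕ) ≤ ext c ψ y) ∧
        ∀ z, (lattice.Adj x z ∨ lattice.Adj y z) → z ≠ x → z ≠ y →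
          ext c ψ z < c + (k + 1 : ℕ)}.indicator (freeWeight β c) ψ ≤
      ENNReal.ofReal (Real.exp (-β) ^ 6) *
        ∑' ψ : Field n, {ψ | c + k ≤ ext c ψ x ∧ c + k ≤ ext c ψ y}.indicator
          (freeWeight β c) ψ := by
  classical
  rw [← tiltWeight_zero, ← ENNReal.tsum_mul_left]
  refine tsum_indicator_le_of_injOn (T := lowerOn {x, y}) (lowerOn_injective _).injOn ?_
  rintro ψ ⟨⟨hx, hy⟩, hz⟩
  have hbox : ∀ p, c + (k + 1 : ℕ) ≤ ext c ψ p → p ∈ box n := by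
    intro p hp
    by_contra h
    rw [ext_of_notMem h] at hp
    omega
  have hS : ({x, y} : Finset (ℤ × ℤ)) ⊆ box n := by
    intro p hp
    rcases Finset.mem_insert.1 hp with rfl | hp
    · exact hbox _ hx
    · rw [Finset.mem_singleton.1 hp]; exact hbox _ hy
  have hmem : ∀ p, p ∈ ({x, y} : Finset (ℤ × ℤ)) → c + (k + 1 : ℕ) ≤ ext c ψ p := by
    intro p hp
    rcases Finset.mem_insert.1 hp with rfl | hp
    · exact hx
    · rw [Finset.mem_singleton.1 hp]; exact hy
  have hout : ∀ p q, p ∈ ({x, y} : Finset (ℤ × ℤ)) → q ∉ ({x, y} : Finset (ℤ × ℤ)) →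
      lattice.Adj p q → ext c ψ q < c + (k + 1 : ℕ) := by
    intro p q hp hq hpq
    simp only [Finset.mem_insert, Finset.mem_singleton, not_or] at hp hq
    refine hz q ?_ hq.1 hq.2
    rcases hp with rfl | rfl
    · exact Or.inl hpq
    · exact Or.inr hpq
  have hw := tiltWeight_le_lowerOn (t := 0) (β := β) (b := β) le_rfl (by simp) hS (c := c) (ψ := ψ)
    (fun e he => by
      have hne := (mem_cut_iff hS).1 he
      refine ⟨fun h => ?_, fun h => ?_⟩
      · have h1 := hmem _ h
        have h2 := hout _ _ h (fun h' => hne (iff_of_true h h')) (adj_head e)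
        omega
      · have h1 := hmem _ h
        have h2 := hout _ _ h (fun h' => hne (iff_of_true h' h)) (adj_head e).symm
        omega)
  have hQ : lowerOn {x, y} ψ ∈ {ψ : Field n | c + k ≤ ext c ψ x ∧ c + k ≤ ext c ψ y} := by
    have h4 := ext_sub_one_le_lowerOn hS c ψ x
    have h5 := ext_sub_one_le_lowerOn hS c ψ y
    push_cast at hx hy
    exact ⟨by linarith, by linarith⟩
  rw [Set.indicator_of_mem hQ]
  refine hw.trans ?_
  gcongr 1
  refine ENNReal.ofReal_le_ofReal (pow_le_pow_of_le_one (Real.exp_pos _).le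
    (Real.exp_le_one_iff.2 (by linarith)) ?_)
  exact six_le_card_cut hS (by simp) (by simp) hxy.ne

/-- The rate must be exactly `e^{-6β}` per level, since a constant lost at each level would become a
power of `n` at heights of order `log n`. A high domino is either isolated or part of one of at most
eight high triples, whose contours have length at least `8` and so absorb their entropy. -/
theorem tsum_freeWeight_domino_le {β : ℝ}
    (hβ : 9 * (2 ^ 10 * Real.exp (-β)) ^ 8 ≤ Real.exp (-β) ^ 6)
    (hβ' : 2 ^ 10 * Real.exp (-β) ≤ 1) (hβ0 : 0 ≤ β) {n : ℕ} (c : ℤ) {x y : ℤ × ℤ}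
    (hxy : lattice.Adj x y) (k : ℕ) :
    ∑' ψ : Field n, {ψ | c + k ≤ ext c ψ x ∧ c + k ≤ ext c ψ y}.indicator (freeWeight β c) ψ ≤
      2 * ENNReal.ofReal (Real.exp (-β) ^ 6) ^ k * ∑' ψ : Field n, freeWeight β c ψ := by
  classical
  set Z := ∑' ψ : Field n, freeWeight β c ψ with hZ
  set r := ENNReal.ofReal (Real.exp (-β) ^ 6) with hr
  set ε := ENNReal.ofReal ((2 ^ 10 * Real.exp (-β)) ^ 8) with hε
  have hεr : 9 * ε ≤ r := by
    have : (9 : ℝ≥0∞) = ENNReal.ofReal 9 := by simp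
    rw [this, hε, ← ENNReal.ofReal_mul (by norm_num)]
    exact ENNReal.ofReal_le_ofReal hβ
  let q : ℕ → ℝ≥0∞ := fun k =>
    ∑' ψ : Field n, {ψ | c + k ≤ ext c ψ x ∧ c + k ≤ ext c ψ y}.indicator (freeWeight β c) ψ
  -- Adding `ε ^ k * Z` closes the recursion: the eight triples together with the new correction
  -- make `9ε ≤ r`.
  have key : ∀ k, q k + ε ^ k * Z ≤ 2 * r ^ k * Z := by
    intro k
    induction k with
    | zero =>
      rw [pow_zero, pow_zero, one_mul, mul_one, two_mul]
      gcongr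
      exact ENNReal.tsum_le_tsum fun ψ => Set.indicator_le_self _ _ _
    | succ k ih =>
      let N := ((neighbors x ∪ neighbors y).erase x).erase y
      have hN : N.card ≤ 8 := by
        have h1 : ∀ u, (neighbors u).card ≤ 4 := fun u => Finset.card_le_four
        exact ((Finset.card_erase_le).trans Finset.card_erase_le).trans
          ((Finset.card_union_le _ _).trans (Nat.add_le_add (h1 x) (h1 y)))
      have hNmem : ∀ z, z ∈ N ↔ z ≠ y ∧ z ≠ x ∧ (lattice.Adj x z ∨ lattice.Adj y z) := by
        intro z
        simp only [N, Finset.mem_erase, Finset.mem_union, mem_neighbors]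
      have hsub : {ψ : Field n | c + (k + 1 : ℕ) ≤ ext c ψ x ∧ c + (k + 1 : ℕ) ≤ ext c ψ y} ⊆
          {ψ | (c + (k + 1 : ℕ) ≤ ext c ψ x ∧ c + (k + 1 : ℕ) ≤ ext c ψ y) ∧
          ∀ z, (lattice.Adj x z ∨ lattice.Adj y z) → z ≠ x → z ≠ y →
          ext c ψ z < c + (k + 1 : ℕ)} ∪ ⋃ z ∈ N, {ψ | c + (k + 1 : ℕ) ≤ ext c ψ x ∧
            c + (k + 1 : ℕ) ≤ ext c ψ y ∧ c + (k + 1 : ℕ) ≤ ext c ψ z} := by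
        intro ψ hψ
        by_cases h : ∀ z, (lattice.Adj x z ∨ lattice.Adj y z) → z ≠ x → z ≠ y →
          ext c ψ z < c + (k + 1 : ℕ)
        · exact Or.inl ⟨hψ, h⟩
        · push Not at h
          obtain ⟨z, h1, h2, h3, h4⟩ := h
          exact Or.inr (Set.mem_iUnion₂.2 ⟨z, (hNmem z).2 ⟨h3, h2, h1⟩, hψ.1, hψ.2, h4⟩)
      have h1 : q (k + 1) ≤ r * q k + 8 * (ε ^ (k + 1) * Z) := by
        refine (tsum_indicator_mono _ hsub).trans ((tsum_indicator_union_le _ _ _).trans ?_)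
        refine add_le_add (tsum_freeWeight_isolated_domino_le hβ0 c hxy k) ?_
        refine (tsum_indicator_biUnion_le _ _ _).trans ?_
        calc _ ≤ ∑ z ∈ N, ε ^ (k + 1) * Z := Finset.sum_le_sum fun z hz => by
              obtain ⟨h1, h2, h3⟩ := (hNmem z).1 hz
              exact tsum_freeWeight_triple_le hβ' c hxy h3 h2 h1 (k + 1)
          _ ≤ _ := by
              rw [Finset.sum_const, nsmul_eq_mul]
              gcongr
              exact_mod_cast hN
      calc q (k + 1) + ε ^ (k + 1) * Z ≤ r * q k + 8 * (ε ^ (k + 1) * Z) + ε ^ (k + 1) * Z := by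
            gcongr
        _ = r * q k + (9 * ε) * (ε ^ k * Z) := by ring
        _ ≤ r * q k + r * (ε ^ k * Z) := by gcongr
        _ = r * (q k + ε ^ k * Z) := by ring
        _ ≤ r * (2 * r ^ k * Z) := by gcongr
        _ = _ := by ring
  exact le_self_add.trans (key k)

/-! ### The wetted partition function above a high boundary condition -/

theorem ofReal_max_zero_eq_tsum (m : ℤ) :
    ENNReal.ofReal ((max 0 m : ℤ) : ℝ) = ∑' k : ℕ, if (k : ℤ) + 1 ≤ m then 1 else 0 := by
  rw [tsum_eq_sum (s := Finset.range m.toNat)]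
  · rw [Finset.sum_congr rfl (g := fun _ => 1)]
    · have : (max 0 m : ℤ) = (m.toNat : ℤ) := by omega
      rw [this, Int.cast_natCast, ENNReal.ofReal_natCast, Finset.sum_const, Finset.card_range,
        nsmul_eq_mul, mul_one]
    · intro k hk
      rw [Finset.mem_range] at hk
      rw [if_pos (by omega)]
  · intro k hk
    rw [Finset.mem_range] at hk
    rw [if_neg (by omega)]

theorem ext_sub_left {n : ℕ} (c : ℤ) (ψ : Field n) (p : ℤ × ℤ) :
    ext c ((fun _ => 2 * c) - ψ) p = 2 * c - ext c ψ p := by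
  by_cases h : p ∈ box n
  · rw [ext_of_mem h, ext_of_mem h]; rfl
  · rw [ext_of_notMem h, ext_of_notMem h]; ring

theorem freeWeight_sub_left (β : ℝ) {n : ℕ} (c : ℤ) (ψ : Field n) :
    freeWeight β c ((fun _ => 2 * c) - ψ) = freeWeight β c ψ := by
  have : freeEnergy c ((fun _ => 2 * c) - ψ) = freeEnergy c ψ := by
    refine Finset.sum_congr rfl fun e _ => ?_
    rw [ext_sub_left, ext_sub_left, abs_sub_comm]
    congr 1
    ring
  rw [freeWeight, freeWeight, this]

/-- Reflection about `c` turns depth `k + 1` below zero into height `c + 1 + k` above the boundary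
value. Summing over depths is geometric with ratio at most `1/2`, which gives the constant `2 · 2`.
-/
theorem tsum_freeWeight_low_domino_le {β : ℝ}
    (hβ : 9 * (2 ^ 10 * Real.exp (-β)) ^ 8 ≤ Real.exp (-β) ^ 6)
    (hβ' : 2 ^ 10 * Real.exp (-β) ≤ 1) (hβ0 : 0 ≤ β) {n : ℕ} (c : ℕ) {x y : ℤ × ℤ}
    (hxy : lattice.Adj x y) :
    ∑' ψ : Field n, freeWeight β c ψ *
        ENNReal.ofReal ((max 0 (min (-ext c ψ x) (-ext c ψ y)) : ℤ) : ℝ) ≤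
      ENNReal.ofReal (4 * Real.exp (-(6 * β) * (c + 1))) * ∑' ψ : Field n, freeWeight β c ψ := by
  set Z := ∑' ψ : Field n, freeWeight β c ψ with hZ
  set r := ENNReal.ofReal (Real.exp (-β) ^ 6) with hr
  have hr2 : r ≤ 2⁻¹ := by
    have h2 : (2 : ℝ≥0∞)⁻¹ = ENNReal.ofReal (1 / 2) := by
      rw [one_div, ENNReal.ofReal_inv_of_pos (by norm_num)]; simp
    rw [h2]
    refine ENNReal.ofReal_le_ofReal ?_
    have h1 : Real.exp (-β) ≤ 1 / 2 := by linarith [Real.exp_pos (-β)]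
    calc Real.exp (-β) ^ 6 ≤ (1 / 2) ^ 6 := pow_le_pow_left₀ (Real.exp_pos _).le h1 6
      _ ≤ 1 / 2 := by norm_num
  have hstep : ∀ k : ℕ, ∑' ψ : Field n, (freeWeight β c ψ *
      if (k : ℤ) + 1 ≤ min (-ext c ψ x) (-ext c ψ y) then 1 else 0) ≤
        2 * r ^ (c + 1 + k) * Z := by
    intro k
    refine le_trans (le_of_eq ?_) (tsum_freeWeight_domino_le hβ hβ' hβ0 (n := n) c hxy (c + 1 + k))
    rw [← (Equiv.subLeft (fun _ => 2 * (c : ℤ) : Field n)).tsum_eq]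
    refine tsum_congr fun ψ => ?_
    rw [Equiv.subLeft_apply, freeWeight_sub_left, ext_sub_left, ext_sub_left]
    simp only [Set.indicator_apply, Set.mem_ofPred_eq]
    by_cases h : (c : ℤ) + (c + 1 + k : ℕ) ≤ ext c ψ x ∧ (c : ℤ) + (c + 1 + k : ℕ) ≤ ext c ψ y
    · rw [if_pos h, if_pos (by push_cast at h; omega), mul_one]
    · rw [if_neg h, if_neg (by push_cast at h; omega), mul_zero]
  calc ∑' ψ : Field n, freeWeight β c ψ *
        ENNReal.ofReal ((max 0 (min (-ext c ψ x) (-ext c ψ y)) : ℤ) : ℝ)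
      = ∑' k : ℕ, ∑' ψ : Field n, (freeWeight β c ψ *
        if (k : ℤ) + 1 ≤ min (-ext c ψ x) (-ext c ψ y) then 1 else 0) := by
        rw [ENNReal.tsum_comm]
        refine tsum_congr fun ψ => ?_
        rw [ENNReal.tsum_mul_left, ofReal_max_zero_eq_tsum]
    _ ≤ ∑' k : ℕ, 2 * r ^ (c + 1 + k) * Z := ENNReal.tsum_le_tsum hstep
    _ = 2 * r ^ (c + 1) * (1 - r)⁻¹ * Z := by
        have e : ∀ k, 2 * r ^ (c + 1 + k) * Z = 2 * r ^ (c + 1) * Z * r ^ k := by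
          intro k; rw [pow_add]; ring
        simp_rw [e]
        rw [ENNReal.tsum_mul_left, ENNReal.tsum_geometric]
        ring
    _ ≤ 2 * r ^ (c + 1) * 2 * Z := by
        gcongr
        have : (2 : ℝ≥0∞)⁻¹ ≤ 1 - r := by
          rw [← ENNReal.one_sub_inv_two]
          exact tsub_le_tsub_left hr2 1
        exact ENNReal.inv_le_iff_inv_le.1 this
    _ = _ := by
        congr 1
        have h4 : ENNReal.ofReal 4 = 4 := by simp
        rw [ENNReal.ofReal_mul (by norm_num), h4, hr, ← ENNReal.ofReal_pow (by positivity),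
          ← Real.exp_nat_mul, ← Real.exp_nat_mul]
        have : ((c + 1 : ℕ) : ℝ) * (((6 : ℕ) : ℝ) * -β) = -(6 * β) * (c + 1) := by push_cast; ring
        rw [this]
        ring

theorem card_boxEdges (n : ℕ) : (boxEdges n).card = 2 * (side n + 1) ^ 2 := by
  simp only [boxEdges, tails, Finset.card_product, Int.card_Icc, side, Finset.card_univ,
    Fintype.card_bool]
  rw [mul_comm, sq]
  congr 2 <;> omega

/-- Jensen's inequality under the free law: the wetted weight is the free one times `e^{-2βY}`, with
`Y` the total depth of low edges. The constant is `2β` times `2 (side n + 1)²` edges times `4`. -/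
theorem freePartition_le_wetPartition {β : ℝ}
    (hβ : 9 * (2 ^ 10 * Real.exp (-β)) ^ 8 ≤ Real.exp (-β) ^ 6)
    (hβ' : 2 ^ 10 * Real.exp (-β) ≤ 1) (hβ2 : 2 ≤ β) (n c : ℕ) :
    ENNReal.ofReal (Real.exp (-(16 * β * (side n + 1) ^ 2 * Real.exp (-(6 * β) * (c + 1))))) *
      ∑' ψ : Field n, freeWeight β c ψ ≤ ∑' ψ : Field n, wetWeight β c ψ := by
  have hβ0 : 0 ≤ β := by linarith
  let Y : Field n → Edge → ℤ := fun ψ e => max 0 (min (-ext c ψ e.1) (-ext c ψ (head e)))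
  have hY : ∀ ψ e, (0 : ℝ) ≤ Y ψ e := fun ψ e => by
    exact_mod_cast (le_max_left 0 _ : 0 ≤ Y ψ e)
  have hwet : ∀ ψ : Field n, wetWeight β c ψ = freeWeight β c ψ *
      ENNReal.ofReal (Real.exp (-(2 * β * ∑ e ∈ boxEdges n, (Y ψ e : ℝ)))) := by
    intro ψ
    rw [wetWeight, freeWeight, ← ENNReal.ofReal_mul (Real.exp_pos _).le, ← Real.exp_add]
    have : wetEnergy c ψ = freeEnergy c ψ + 2 * ∑ e ∈ boxEdges n, Y ψ e := by
      simp only [wetEnergy, freeEnergy, wetEdge, Finset.sum_add_distrib, Finset.mul_sum, Y]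
    rw [this]
    push_cast
    congr 2
    ring
  simp_rw [hwet]
  refine ofReal_exp_neg_mul_tsum_le (tsum_freeWeight_ne_top hβ2 c n)
    (fun ψ => mul_nonneg (by positivity) (Finset.sum_nonneg fun e _ => hY ψ e)) (by positivity) ?_
  calc ∑' ψ : Field n, freeWeight β c ψ *
        ENNReal.ofReal (2 * β * ∑ e ∈ boxEdges n, (Y ψ e : ℝ))
      = ENNReal.ofReal (2 * β) * ∑ e ∈ boxEdges n, ∑' ψ : Field n, freeWeight β c ψ *
          ENNReal.ofReal (Y ψ e : ℝ) := by
        rw [← Summable.tsum_finsetSum fun _ _ => ENNReal.summable, ← ENNReal.tsum_mul_left]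
        refine tsum_congr fun ψ => ?_
        rw [ENNReal.ofReal_mul (by positivity), ENNReal.ofReal_sum_of_nonneg fun e _ => hY ψ e,
          ← Finset.mul_sum]
        ring
    _ ≤ ENNReal.ofReal (2 * β) * ∑ e ∈ boxEdges n,
          ENNReal.ofReal (4 * Real.exp (-(6 * β) * (c + 1))) *
            ∑' ψ : Field n, freeWeight β c ψ := by
        gcongr with e
        exact tsum_freeWeight_low_domino_le hβ hβ' hβ0 c (adj_head e)
    _ = _ := by
        rw [Finset.sum_const, card_boxEdges, nsmul_eq_mul, ← mul_assoc, ← mul_assoc,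
          ← ENNReal.ofReal_natCast, ← ENNReal.ofReal_mul (by positivity),
          ← ENNReal.ofReal_mul (by positivity)]
        congr 2
        push_cast
        ring

/-! ### High sites are rare -/

/-- Jensen's inequality under the tilted law, from which the free weight is recovered by the factor
`e^{-t·highCount}`. The expected number of high sites is bounded there because the Peierls estimate
holds with the tilt present. -/
theorem tiltPartition_le {t β b : ℝ} (ht : 0 ≤ t) (hβ : 2 ≤ β) {n : ℕ}
    (hb : b ≤ β - t * side n / 2) (hb' : 2 ^ 10 * Real.exp (-b) ≤ 1) (c : ℤ) :
    ∑' ψ : Field n, tiltWeight t β c ψ ≤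
      ENNReal.ofReal (Real.exp (t * side n ^ 2 * (2 ^ 10 * Real.exp (-b)))) *
        ∑' ψ : Field n, freeWeight β c ψ := by
  classical
  set m := t * side n ^ 2 * (2 ^ 10 * Real.exp (-b)) with hm
  have hfree : ∀ ψ : Field n, freeWeight β c ψ =
      tiltWeight t β c ψ * ENNReal.ofReal (Real.exp (-(t * highCount c ψ))) := by
    intro ψ
    rw [freeWeight, tiltWeight, ← ENNReal.ofReal_mul (Real.exp_pos _).le, ← Real.exp_add]
    congr 2
    ring
  have htop : ∑' ψ : Field n, tiltWeight t β c ψ ≠ ∞ := by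
    refine ne_top_of_le_ne_top (ENNReal.mul_ne_top (a := ENNReal.ofReal
      (Real.exp (t * (box n).card))) ENNReal.ofReal_ne_top (tsum_freeWeight_ne_top hβ c n)) ?_
    rw [← ENNReal.tsum_mul_left]
    refine ENNReal.tsum_le_tsum fun ψ => ?_
    rw [freeWeight, tiltWeight, ← ENNReal.ofReal_mul (Real.exp_pos _).le, ← Real.exp_add]
    refine ENNReal.ofReal_le_ofReal (Real.exp_le_exp.2 ?_)
    have h1 : (highCount c ψ : ℝ) ≤ (box n).card := by
      exact_mod_cast Finset.card_le_card (Finset.filter_subset _ _)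
    have := mul_le_mul_of_nonneg_left h1 ht
    linarith
  have hJ := ofReal_exp_neg_mul_tsum_le htop (X := fun ψ => t * highCount c ψ)
    (fun ψ => by positivity) (m := m) (by positivity) (by
      calc ∑' ψ : Field n, tiltWeight t β c ψ * ENNReal.ofReal (t * highCount c ψ)
          = ENNReal.ofReal t * ∑ p ∈ box n, ∑' ψ : Field n,
              {ψ | c < ext c ψ p}.indicator (tiltWeight t β c) ψ := by
            rw [← Summable.tsum_finsetSum fun _ _ => ENNReal.summable, ← ENNReal.tsum_mul_left]
            refine tsum_congr fun ψ => ?_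
            simp only [Set.indicator_apply, Set.mem_ofPred_eq]
            rw [← Finset.sum_filter, Finset.sum_const, nsmul_eq_mul, ENNReal.ofReal_mul ht,
              ENNReal.ofReal_natCast, highCount]
            ring
        _ ≤ ENNReal.ofReal t * ∑ p ∈ box n, ENNReal.ofReal (2 ^ 10 * Real.exp (-b)) *
              ∑' ψ : Field n, tiltWeight t β c ψ := by
            gcongr with p
            exact tsum_tiltWeight_high_le ht hb hb' c p
        _ = _ := by
            rw [Finset.sum_const, card_box, nsmul_eq_mul, ← mul_assoc, ← mul_assoc,
              ← ENNReal.ofReal_natCast, ← ENNReal.ofReal_mul ht,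
              ← ENNReal.ofReal_mul (by positivity), hm]
            push_cast
            rfl)
  simp_rw [← hfree] at hJ
  calc ∑' ψ : Field n, tiltWeight t β c ψ
      = ENNReal.ofReal (Real.exp m) * (ENNReal.ofReal (Real.exp (-m)) *
          ∑' ψ : Field n, tiltWeight t β c ψ) := by
        rw [← mul_assoc, ← ENNReal.ofReal_mul (Real.exp_pos _).le, ← Real.exp_add]
        simp
    _ ≤ _ := by gcongr

theorem tsum_freeWeight_highCount_ge_le {t β b : ℝ} (ht : 0 ≤ t) (hβ : 2 ≤ β) {n : ℕ}
    (hb : b ≤ β - t * side n / 2) (hb' : 2 ^ 10 * Real.exp (-b) ≤ 1) (c : ℤ) (A : ℝ) :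
    ∑' ψ : Field n, {ψ | A ≤ highCount c ψ}.indicator (freeWeight β c) ψ ≤
      ENNReal.ofReal (Real.exp (-(t * A) + t * side n ^ 2 * (2 ^ 10 * Real.exp (-b)))) *
        ∑' ψ : Field n, freeWeight β c ψ := by
  calc ∑' ψ : Field n, {ψ | A ≤ highCount c ψ}.indicator (freeWeight β c) ψ
      ≤ ∑' ψ : Field n, ENNReal.ofReal (Real.exp (-(t * A))) * tiltWeight t β c ψ := by
        refine ENNReal.tsum_le_tsum fun ψ => ?_
        by_cases h : A ≤ highCount c ψ
        · rw [Set.indicator_of_mem (s := {ψ : Field n | A ≤ highCount c ψ}) h, freeWeight,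
            tiltWeight,
            ← ENNReal.ofReal_mul (Real.exp_pos _).le, ← Real.exp_add]
          refine ENNReal.ofReal_le_ofReal (Real.exp_le_exp.2 ?_)
          have := mul_le_mul_of_nonneg_left h ht
          linarith
        · rw [Set.indicator_of_notMem (s := {ψ : Field n | A ≤ highCount c ψ}) h]; exact bot_le
    _ ≤ ENNReal.ofReal (Real.exp (-(t * A))) *
        (ENNReal.ofReal (Real.exp (t * side n ^ 2 * (2 ^ 10 * Real.exp (-b)))) *
          ∑' ψ : Field n, freeWeight β c ψ) := by
        rw [ENNReal.tsum_mul_left]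
        gcongr
        exact tiltPartition_le ht hβ hb hb' c
    _ = _ := by
        rw [← mul_assoc, ← ENNReal.ofReal_mul (Real.exp_pos _).le, ← Real.exp_add]

theorem isUpperSet_highCount {n : ℕ} (c : ℤ) (A : ℝ) :
    IsUpperSet {ψ : Field n | A ≤ highCount c ψ} := by
  intro ψ ψ' hle hψ
  have hψ : A ≤ highCount c ψ := hψ
  refine hψ.trans ?_
  have : highCount c ψ ≤ highCount c ψ' := by
    refine Finset.card_le_card fun p hp => ?_
    obtain ⟨hp, hc⟩ := Finset.mem_filter.1 hp
    refine Finset.mem_filter.2 ⟨hp, ?_⟩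
    rw [ext_of_mem hp] at hc ⊢
    exact hc.trans_le (hle _)
  exact_mod_cast this

/-- The event is increasing, so the boundary value may be raised to `c`; there the numerator is
bounded by the free weight and the denominator by `freePartition_le_wetPartition`. -/
theorem tsum_wetWeight_highCount_ge_le {t β b : ℝ} (ht : 0 ≤ t)
    (hβ : 9 * (2 ^ 10 * Real.exp (-β)) ^ 8 ≤ Real.exp (-β) ^ 6)
    (hβ' : 2 ^ 10 * Real.exp (-β) ≤ 1) (hβ2 : 2 ≤ β) {n : ℕ}
    (hb : b ≤ β - t * side n / 2) (hb' : 2 ^ 10 * Real.exp (-b) ≤ 1) (c : ℕ) (A : ℝ) :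
    ∑' ψ : Field n, {ψ | A ≤ highCount c ψ}.indicator (wetWeight β 0) ψ ≤
      ENNReal.ofReal (Real.exp (-(t * A) + t * side n ^ 2 * (2 ^ 10 * Real.exp (-b)) +
        16 * β * (side n + 1) ^ 2 * Real.exp (-(6 * β) * (c + 1)))) *
        ∑' ψ : Field n, wetWeight β 0 ψ := by
  set E := {ψ : Field n | A ≤ highCount c ψ}
  set m := 16 * β * (side n + 1) ^ 2 * Real.exp (-(6 * β) * (c + 1)) with hm
  set a := -(t * A) + t * side n ^ 2 * (2 ^ 10 * Real.exp (-b)) with ha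
  have h1 := wetWeight_mono_boundary (by linarith : 0 ≤ β) (Int.natCast_nonneg c)
    (isUpperSet_highCount (n := n) c A)
  have h2 : ∑' ψ, E.indicator (wetWeight β c) ψ ≤
      ENNReal.ofReal (Real.exp (a + m)) * ∑' ψ : Field n, wetWeight β c ψ := by
    calc ∑' ψ, E.indicator (wetWeight β c) ψ ≤ ∑' ψ, E.indicator (freeWeight β c) ψ :=
          ENNReal.tsum_le_tsum fun ψ =>
            Set.indicator_le_indicator (wetWeight_le_freeWeight (by linarith) c ψ)
      _ ≤ ENNReal.ofReal (Real.exp a) * ∑' ψ : Field n, freeWeight β c ψ :=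
          tsum_freeWeight_highCount_ge_le ht hβ2 hb hb' c A
      _ = ENNReal.ofReal (Real.exp (a + m)) * (ENNReal.ofReal (Real.exp (-m)) *
            ∑' ψ : Field n, freeWeight β c ψ) := by
          rw [← mul_assoc, ← ENNReal.ofReal_mul (Real.exp_pos _).le, ← Real.exp_add]
          congr 3
          ring_nf
      _ ≤ _ := by
          gcongr
          exact freePartition_le_wetPartition hβ hβ' hβ2 n c
  have hZ0 : ∑' ψ : Field n, wetWeight β c ψ ≠ 0 := by
    intro h
    have := ENNReal.tsum_eq_zero.1 h 0
    simp [wetWeight] at this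
    exact absurd this (not_le.2 (Real.exp_pos _))
  refine (ENNReal.mul_le_mul_iff_left hZ0 (tsum_wetWeight_ne_top hβ2 c n)).1 (h1.trans ?_)
  calc _ ≤ (∑' ψ : Field n, wetWeight β 0 ψ) *
        (ENNReal.ofReal (Real.exp (a + m)) * ∑' ψ : Field n, wetWeight β c ψ) := by gcongr
    _ = _ := by ring

theorem typicalHeight_nonneg {β : ℝ} (hβ : 0 < β) {n : ℕ} (hn : 1 ≤ n) :
    0 ≤ typicalHeight β n := by
  have : 0 ≤ Real.log n := Real.log_nonneg (by exact_mod_cast hn)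
  exact Int.floor_nonneg.2 (by positivity)

theorem tsum_wetWeight_above_typicalHeight_le {β : ℝ} (hβ : 100 ≤ β) {n : ℕ} (hn : 2 ≤ n) :
    ∑' ψ : Field n, {ψ | 300 / β * (n : ℝ) ^ 2 ≤ highCount (typicalHeight β n) ψ}.indicator
        (wetWeight β 0) ψ ≤
      ENNReal.ofReal (Real.exp (-3 * n)) * ∑' ψ : Field n, wetWeight β 0 ψ := by
  have hβ0 : 0 < β := by linarith
  have hn0 : (2 : ℝ) ≤ n := by exact_mod_cast hn
  have hs0 : (0 : ℝ) < side n := by unfold side; positivity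
  have hside : (side n : ℝ) ≤ n + 1 := by exact_mod_cast side_le n
  have he1 : (2 : ℝ) ≤ Real.exp 1 := by have := Real.add_one_le_exp (1 : ℝ); linarith
  have h25 : (2 : ℝ) ^ 25 ≤ Real.exp (β / 4) := by
    calc (2 : ℝ) ^ 25 ≤ Real.exp 1 ^ 25 := pow_le_pow_left₀ (by norm_num) he1 _
      _ = Real.exp 25 := by rw [← Real.exp_nat_mul]; norm_num
      _ ≤ _ := Real.exp_le_exp.2 (by linarith)
  have hβ4 : β / 4 ≤ Real.exp (β / 4) := by have := Real.add_one_le_exp (β / 4); linarith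
  set s := Real.exp (β / 4) with hs
  have hspos : 0 < s := Real.exp_pos _
  have hexp2 : Real.exp (-(β / 2)) = (s ^ 2)⁻¹ := by
    rw [hs, ← Real.exp_nat_mul, ← Real.exp_neg]; congr 1; push_cast; ring
  have hexp1 : Real.exp (-β) = (s ^ 4)⁻¹ := by
    rw [hs, ← Real.exp_nat_mul, ← Real.exp_neg]; congr 1; push_cast; ring
  have hb' : 2 ^ 10 * Real.exp (-(β / 2)) ≤ 1 := by
    rw [hexp2, ← div_eq_mul_inv, div_le_one (by positivity)]
    nlinarith
  have hβ' : 2 ^ 10 * Real.exp (-β) ≤ 1 := by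
    refine le_trans ?_ hb'
    gcongr
    linarith
  have hβ9 : 9 * (2 ^ 10 * Real.exp (-β)) ^ 8 ≤ Real.exp (-β) ^ 6 := by
    have h1 : (0 : ℝ) < Real.exp (-β) := Real.exp_pos _
    have h2 : 9 * 2 ^ 80 * Real.exp (-β) ^ 2 ≤ 1 := by
      rw [hexp1, inv_pow, ← div_eq_mul_inv, div_le_one (by positivity), ← pow_mul]
      calc (9 * 2 ^ 80 : ℝ) ≤ (2 ^ 25) ^ 8 := by norm_num
        _ ≤ s ^ 8 := pow_le_pow_left₀ (by norm_num) h25 _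
    calc 9 * (2 ^ 10 * Real.exp (-β)) ^ 8 =
          (9 * 2 ^ 80 * Real.exp (-β) ^ 2) * Real.exp (-β) ^ 6 := by ring
      _ ≤ 1 * Real.exp (-β) ^ 6 := by gcongr
      _ = _ := one_mul _
  have hnn := typicalHeight_nonneg hβ0 (by omega : 1 ≤ n)
  obtain ⟨c, hc⟩ := Int.eq_ofNat_of_zero_le hnn
  have hlt := lt_typicalHeight hβ0 n
  rw [hc] at hlt ⊢
  push_cast at hlt
  -- The tilt `β / side n` uses exactly half of `β`. The exponent is then at most `-150n + 2n +
  -- 72n`: the gain from the tilt, the mean number of high sites, and the wetting penalty.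
  refine (tsum_wetWeight_highCount_ge_le (t := β / side n) (b := β / 2) (by positivity) hβ9 hβ'
    (by linarith) (by field_simp; linarith) hb' c _).trans ?_
  refine mul_le_mul_left (ENNReal.ofReal_le_ofReal (Real.exp_le_exp.2 ?_)) _
  have hm : 16 * β * ((side n : ℝ) + 1) ^ 2 * Real.exp (-(6 * β) * (c + 1)) ≤ 72 * n := by
    -- Here the choice of `h_n^*` enters from above: `6β(h_n^* + 1) > log n + 2β`.
    have h1 : Real.exp (-(6 * β) * (c + 1)) ≤ Real.exp (-(2 * β)) / n := by
      have : Real.exp (-(2 * β)) / n = Real.exp (-(2 * β) - Real.log n) := by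
        rw [Real.exp_sub, Real.exp_log (by linarith)]
      rw [this]
      exact Real.exp_le_exp.2 (by linarith)
    have h2 : β * Real.exp (-(2 * β)) ≤ 1 / 2 := by
      have h3 := Real.add_one_le_exp (2 * β)
      rw [Real.exp_neg, ← div_eq_mul_inv, div_le_iff₀ (Real.exp_pos _)]
      linarith
    have h4 : ((side n : ℝ) + 1) ^ 2 ≤ (2 * n) ^ 2 := by gcongr; linarith
    calc 16 * β * ((side n : ℝ) + 1) ^ 2 * Real.exp (-(6 * β) * (c + 1))
        ≤ 16 * β * (2 * n) ^ 2 * (Real.exp (-(2 * β)) / n) := by gcongr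
      _ = 64 * n * (β * Real.exp (-(2 * β))) := by field_simp; ring
      _ ≤ 64 * n * (1 / 2) := by gcongr
      _ ≤ _ := by linarith
  have ht1 : β / side n * (300 / β * (n : ℝ) ^ 2) = 300 * n ^ 2 / side n := by
    field_simp
  have ht2 : 300 * (n : ℝ) ^ 2 / side n ≥ 150 * n := by
    rw [ge_iff_le, le_div_iff₀ hs0]
    nlinarith
  have ht3 : β / side n * (side n : ℝ) ^ 2 * (2 ^ 10 * Real.exp (-(β / 2))) ≤ 2 * n := by
    have h1 : β * (2 ^ 10 * Real.exp (-(β / 2))) ≤ 1 := by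
      rw [hexp2, ← mul_assoc, ← div_eq_mul_inv, div_le_one (by positivity)]
      nlinarith
    calc β / side n * (side n : ℝ) ^ 2 * (2 ^ 10 * Real.exp (-(β / 2)))
        = (side n : ℝ) * (β * (2 ^ 10 * Real.exp (-(β / 2)))) := by field_simp
      _ ≤ (side n : ℝ) * 1 := by gcongr
      _ ≤ _ := by linarith
  rw [ht1]
  linarith

/-- Taking positive parts can only raise a site, and it does not alter one above `h_n^* ≥ 0`. The
boundary values used in the two counts are irrelevant on the box. -/
theorem atypicalCount_le {β : ℝ} (hβ : 0 < β) {n : ℕ} (hn : 1 ≤ n) (ψ : Field n) :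
    atypicalCount β (posPart ψ) ≤
      lowCount (typicalHeight β n - 1) ψ + highCount (typicalHeight β n) ψ := by
  classical
  have h0 := typicalHeight_nonneg hβ hn
  set h := typicalHeight β n
  have h1 : atypicalCount β (posPart ψ) ≤ ((box n).filter fun p => ext 0 ψ p < h - 1 ∨
      h < ext h ψ p).card := by
    unfold atypicalCount
    rw [← Finset.card_map (Function.Embedding.subtype _)]
    refine Finset.card_le_card fun p hp => ?_
    obtain ⟨x, hx, rfl⟩ := Finset.mem_map.1 hp
    have hx := (Finset.mem_filter.1 hx).2
    refine Finset.mem_filter.2 ⟨x.2, ?_⟩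
    simp only [Function.Embedding.subtype_apply, ext_coe]
    simp only [posPart] at hx
    omega
  refine h1.trans ?_
  rw [Finset.filter_or]
  exact Finset.card_union_le _ _

end SOS

/-- There is an absolute constant `C` such that, for every large enough `β` and at the critical
pinning, with probability tending to `1` as `n → ∞`, all but at most `(C/β) n²` sites of the box
have height `h_n^* - 1` or `h_n^*`. -/
theorem theorem1 :
    ∃ C β₀ : ℝ, 0 < C ∧ 0 < β₀ ∧ ∀ β : ℝ, β₀ ≤ β →
      Tendsto
        (fun n : ℕ => SOS.measure β (SOS.criticalPinning β) n
          {φ | (SOS.atypicalCount β φ : ℝ) ≤ C / β * (n : ℝ) ^ 2})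
        atTop (𝓝 1) := by
  -- The constant splits as `300 + 300` between low and high sites; `β ≥ 100` is what the estimate
  -- for high sites asks for.
  refine ⟨600, 100, by norm_num, by norm_num, fun β hβ => ?_⟩
  have hβ0 : 0 < β := by linarith
  let a : ℕ → ℝ≥0∞ := fun n => ENNReal.ofReal (2 * Real.exp (-n) + 3 * (n * (1 / 2) ^ n)) +
    ENNReal.ofReal (Real.exp (-3 * n))
  have ha : Tendsto a atTop (𝓝 0) := by
    have h1 : Tendsto (fun n : ℕ => Real.exp (-(n : ℝ))) atTop (𝓝 0) :=
      Real.tendsto_exp_neg_atTop_nhds_zero.comp tendsto_natCast_atTop_atTop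
    have h2 : Tendsto (fun n : ℕ => (n : ℝ) * (1 / 2) ^ n) atTop (𝓝 0) :=
      tendsto_self_mul_const_pow_of_lt_one (by norm_num) (by norm_num)
    have h3 : Tendsto (fun n : ℕ => Real.exp (-3 * (n : ℝ))) atTop (𝓝 0) := by
      refine squeeze_zero (fun n => (Real.exp_pos _).le) (fun n => ?_) h1
      have : (0 : ℝ) ≤ n := Nat.cast_nonneg n
      exact Real.exp_le_exp.2 (by linarith)
    have h4 := (ENNReal.tendsto_ofReal ((h1.const_mul 2).add (h2.const_mul 3))).add
      (ENNReal.tendsto_ofReal h3)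
    simpa [a] using h4
  have hbad : ∀ᶠ n : ℕ in atTop, SOS.measure β (SOS.criticalPinning β) n
      {φ | (SOS.atypicalCount β φ : ℝ) ≤ 600 / β * (n : ℝ) ^ 2}ᶜ ≤ a n := by
    filter_upwards [SOS.eventually_tsum_lowCount_le (by linarith : 4 ≤ β), eventually_ge_atTop 2]
      with n hlow hn
    have hhigh := SOS.tsum_wetWeight_above_typicalHeight_le hβ hn
    rw [SOS.measure_eq_div hβ0]
    refine ENNReal.div_le_of_le_mul ?_
    rw [add_mul]
    refine le_trans ?_ (add_le_add hlow hhigh)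
    refine (SOS.tsum_indicator_mono _ ?_).trans (SOS.tsum_indicator_union_le _ _ _)
    intro ψ hψ
    have hψ : 600 / β * (n : ℝ) ^ 2 < SOS.atypicalCount β (SOS.posPart ψ) := not_le.1 hψ
    have hle : (SOS.atypicalCount β (SOS.posPart ψ) : ℝ) ≤
        SOS.lowCount (SOS.typicalHeight β n - 1) ψ + SOS.highCount (SOS.typicalHeight β n) ψ := by
      exact_mod_cast SOS.atypicalCount_le hβ0 (by omega : 1 ≤ n) ψ
    have hsplit : 600 / β * (n : ℝ) ^ 2 = 300 / β * (n : ℝ) ^ 2 + 300 / β * (n : ℝ) ^ 2 := by ring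
    by_cases h : 300 / β * (n : ℝ) ^ 2 ≤ SOS.lowCount (SOS.typicalHeight β n - 1) ψ
    · exact Or.inl h
    · refine Or.inr ?_
      push Not at h
      change 300 / β * (n : ℝ) ^ 2 ≤ SOS.highCount (SOS.typicalHeight β n) ψ
      linarith
  have hsub : Tendsto (fun n => 1 - a n) atTop (𝓝 1) := by
    simpa using ENNReal.Tendsto.sub tendsto_const_nhds ha (Or.inl ENNReal.one_ne_top)
  refine tendsto_of_tendsto_of_tendsto_of_le_of_le' hsub tendsto_const_nhds ?_ ?_
  · filter_upwards [hbad] with n hn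
    have := SOS.isProbabilityMeasure_measure hβ0 (SOS.criticalPinning β) n
    have hm : MeasurableSet {φ : SOS.Config n |
        (SOS.atypicalCount β φ : ℝ) ≤ 600 / β * (n : ℝ) ^ 2} := (Set.to_countable _).measurableSet
    have h1 := prob_compl_eq_one_sub (μ := SOS.measure β (SOS.criticalPinning β) n) hm.compl
    rw [compl_compl] at h1
    rw [h1]
    exact tsub_le_tsub_left hn 1
  · refine Eventually.of_forall fun n => ?_
    have := SOS.isProbabilityMeasure_measure hβ0 (SOS.criticalPinning β) n
    exact prob_le_one
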